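/- For an integer $n\ge 2$ and a complex number $\beta$ with $|\beta|\le 1$, let $S(n,\beta)$ be the set of complex polynomials of degree $n$ with all roots in the closed unit disk and at least one root at $\beta$. For a polynomial $P$ of degree at least $2$ let $|P|_\beta$ be the distance between $\beta$ and the closest root of the derivative $P'$, and let the Sendov radius be $r_n(\beta)=\sup\{|P|_\beta : P\in S(n,\beta)\}$. **Theorem 1.** Let $n\ge 3$, let $k$ be the largest integer with $k\le (n+1)/3$, and let \[ u_1=\cos\frac{2\pi k}{n+1},\qquad u_2=\cos\frac{2\pi(k+1)}{n+1}, \] \[ D_1=\frac{-2u_1u_2-1}{2(1-u_1)(1-u_2)},\qquad D_2=\frac{-1}{2(1-u_1)(1-u_2)}, \] \[ D_3=\tfrac12\left(-1-4D_1-3D_1^2+2D_2^2\right), \] \[ D_4=\tfrac12\left(3D_1-4D_2+3D_1^2-2D_1D_2-6D_2^2\right), \] \[ D_5=\tfrac12\left(2+4D_1+5D_2+2D_1^2+4D_1D_2+3D_2^2\right), \] \[ D_6=\tfrac12\left(2D_2+2D_1D_2+3D_2^2\right),\qquad D=D_3n+D_4+\frac{D_5}{n}+\frac{D_6}{n^2}.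 \] Let $\alpha=3/2$ if $n=3$ or $n=5$, and $\alpha=2$ otherwise; let $\Delta=7/225$ if $n=5$, and $\Delta=0$ otherwise. Then for real $\beta\le 1$ sufficiently close to $1$, \[ r_{n+1}(\beta)=1+\left(D_1+\frac{D_2}{n}\right)(1-\beta)+(D+\Delta)(1-\beta)^2+O\left((1-\beta)^{\alpha+1}\right), \] where the implied constant depends only on $n$. -/

import Mathlib

open scoped Polynomial Topology Asymptotics

noncomputable section

namespace Sendov

/-- The set `S(n, β)` of complex polynomials of degree `n` with all roots in the closed unit disk
and at least one root at `β`. -/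
def polys (n : ℕ) (β : ℂ) : Set ℂ[X] :=
  {P | P.natDegree = n ∧ P.IsRoot β ∧ ∀ z : ℂ, P.IsRoot z → ‖z‖ ≤ 1}

/-- The distance `|P|_β` between `β` and the closest root of the derivative `P'`
(for `P` of degree at least `2` the set of these roots is finite and nonempty). -/
def critDist (P : ℂ[X]) (β : ℂ) : ℝ :=
  Metric.infDist β {ζ : ℂ | P.derivative.IsRoot ζ}

/-- The Sendov radius `r_n(β)`, the supremum of `|P|_β` over `P` in `S(n, β)`. -/
def radius (n : ℕ) (β : ℂ) : ℝ :=
  sSup ((fun P : ℂ[X] => critDist P β) '' polys n β)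

/-- The largest integer `k` with `k ≤ (n + 1) / 3`. -/
def k (n : ℕ) : ℤ := ⌊((n : ℝ) + 1) / 3⌋

def u₁ (n : ℕ) : ℝ := Real.cos (2 * Real.pi * (k n : ℝ) / ((n : ℝ) + 1))

def u₂ (n : ℕ) : ℝ := Real.cos (2 * Real.pi * ((k n : ℝ) + 1) / ((n : ℝ) + 1))

def D₁ (n : ℕ) : ℝ := (-2 * u₁ n * u₂ n - 1) / (2 * (1 - u₁ n) * (1 - u₂ n))

def D₂ (n : ℕ) : ℝ := -1 / (2 * (1 - u₁ n) * (1 - u₂ n))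

def D₃ (n : ℕ) : ℝ := (-1 - 4 * D₁ n - 3 * D₁ n ^ 2 + 2 * D₂ n ^ 2) / 2

def D₄ (n : ℕ) : ℝ :=
  (3 * D₁ n - 4 * D₂ n + 3 * D₁ n ^ 2 - 2 * D₁ n * D₂ n - 6 * D₂ n ^ 2) / 2

def D₅ (n : ℕ) : ℝ :=
  (2 + 4 * D₁ n + 5 * D₂ n + 2 * D₁ n ^ 2 + 4 * D₁ n * D₂ n + 3 * D₂ n ^ 2) / 2

def D₆ (n : ℕ) : ℝ := (2 * D₂ n + 2 * D₁ n * D₂ n + 3 * D₂ n ^ 2) / 2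

def D (n : ℕ) : ℝ := D₃ n * n + D₄ n + D₅ n / n + D₆ n / (n : ℝ) ^ 2

/-- The exponent `α`. -/
def α (n : ℕ) : ℝ := if n = 3 ∨ n = 5 then 3 / 2 else 2

/-- The correction `Δ` to the quadratic coefficient. -/
def Δ (n : ℕ) : ℝ := if n = 5 then 7 / 225 else 0

end Sendov

end

/-! Put β = 1 - s². Nearly extremal polynomials are perturbations of z^(n+1) - 1: their critical
points ζ_j = x_j + i y_j are small, and near each root of unity ω of order n + 1 there is a root in
the closed disk. Let e_k be the elementary symmetric functions of the ζ_j, u = Re ω, X = -Re e₁/n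
and Y = Re e₂/(n-1). Averaged over ω and its conjugate, the condition |z| ≤ 1 reads X(1-u) +
2Y(1-u²) ≤ s² + O(s⁴). Averaging |β - ζ_j|² ≥ r² over j gives r ≤ 1 - s² + X + Y(n-1)/n + O(s⁴). So
the linear coefficient is the value of a linear program in (X, Y). Its optimum is (A, B)s² with A =
`lpA n` and B = `lpB n`. The slack at u is (u-u₁)(u-u₂)/((1-u₁)(1-u₂)) times s², nonnegative because
u₁ and u₂ are consecutive cosines. The dual multipliers ν₁, ν₂ are positive because `ustar n` lies
strictly between u₂ and u₁.

Upper bound. The localization comes from P''/P' = 2Q'/Q at β, where P = (X - β)Q: the sum of 1/(β -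
ζ_j) is twice the sum of 1/(β - z) over the other roots, whose real parts are almost at least 1/2
(`critical_points_small`). Complementary slackness (`Extremal.first_order`) then says that every
inequality used is an equality up to O(s⁴). Hence x_j = y_j²/2 - ρ s² + O(s⁴) with ρ = `rho n A B`,
and only the y_j remain free, with ∑ y_j² ≈ 2(n-1)B s² and ∑ y_j ≈ 0. Expanding the moduli of the
roots to order s⁴ (`con_expansion`) and combining with the same multipliers removes the unknown
corrections to X and Y. What is left is a constant plus κ ∑ y_j⁴ with κ ≥ 0
(`Extremal.second_order`, `kappa_nonneg`), so ∑ y_j⁴ has to be bounded above.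

If u₂ ≠ -1, comparing ω with its conjugate at both u₁ and u₂ makes ∑ y_j and ∑ y_j³ of order s⁴, and
then ∑ y_j⁴ is at most (∑ y_j²)²/2 up to O(s⁶). This gives D. For n = 3 and n = 5 one has u₂ = -1,
the corresponding ω is real and one of these equations is lost, which costs a power of s in the
error. For n = 3 the identity e₄ = 0 determines ∑ y_j⁴ anyway. For n = 5 only ∑ y_j ≈ 0 remains, the
sharp constant becomes 13/20 instead of 1/2, and the excess is Δ.

Lower bound. Critical points with y_j = a_j s + b_j s³ and suitable real parts attain these values.
The free parameter ∑ a_j b_j makes one active constraint exact at order s⁴, and duality gives the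
other. All roots then lie in a disk of radius 1 + O(s^m), with m the order of the error, and a
rescaling brings them into the unit disk. -/

open Filter

namespace Sendov

/-! ### Orders of magnitude along a filter -/

/-- `f` is of order `s ^ k` along the filter `l`. -/
def OO {ι E : Type*} [Norm E] (l : Filter ι) (s : ι → ℝ) (k : ℕ) (f : ι → E) : Prop :=
  f =O[l] fun i => s i ^ k

section OO

variable {ι : Type*} {l : Filter ι} {s : ι → ℝ} {a b k : ℕ}

theorem OO.congr {E : Type*} [Norm E] {f g : ι → E} (h : OO l s k f) (e : ∀ i, g i = f i) :
    OO l s k g := by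
  have : g = f := funext e
  rwa [this]

theorem OO.congr' {E : Type*} [Norm E] {f g : ι → E} (h : OO l s k f) (e : ∀ᶠ i in l, g i = f i) :
    OO l s k g :=
  Asymptotics.IsBigO.congr' h (e.mono fun _ hi => hi.symm) (EventuallyEq.refl _ _)

theorem OO.mono {E : Type*} [Norm E] {f : ι → E} (hs : Tendsto s l (𝓝 0)) (h : OO l s a f)
    (hk : k ≤ a) : OO l s k f := by
  refine Asymptotics.IsBigO.trans h ?_
  obtain ⟨d, rfl⟩ := Nat.exists_eq_add_of_le hk
  have h1 : (fun i => s i ^ d) =O[l] (fun _ => (1 : ℝ)) := by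
    have := (hs.pow d).isBigO_one ℝ
    exact this
  have h2 : (fun i => s i ^ k * s i ^ d) =O[l] fun i => s i ^ k * 1 :=
    (Asymptotics.isBigO_refl _ _).mul h1
  simpa [pow_add] using h2

theorem OO.add {E : Type*} [SeminormedAddCommGroup E] {f g : ι → E} (hf : OO l s k f)
    (hg : OO l s k g) : OO l s k (fun i => f i + g i) :=
  Asymptotics.IsBigO.add hf hg

theorem OO.sub {E : Type*} [SeminormedAddCommGroup E] {f g : ι → E} (hf : OO l s k f)
    (hg : OO l s k g) : OO l s k (fun i => f i - g i) :=
  Asymptotics.IsBigO.sub hf hg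

theorem OO.neg {E : Type*} [SeminormedAddCommGroup E] {f : ι → E} (hf : OO l s k f) :
    OO l s k (fun i => - f i) :=
  Asymptotics.IsBigO.neg_left hf

theorem OO.sum {E J : Type*} [SeminormedAddCommGroup E] {S : Finset J} {f : J → ι → E}
    (hf : ∀ j ∈ S, OO l s k (f j)) : OO l s k (fun i => ∑ j ∈ S, f j i) :=
  (Asymptotics.IsBigO.sum hf : (∑ j ∈ S, f j) =O[l] fun i => s i ^ k).congr_left
    fun i => Finset.sum_apply i S f

theorem OO.mul {R : Type*} [SeminormedRing R] {f g : ι → R} (hf : OO l s a f)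
    (hg : OO l s b g) : OO l s (a + b) (fun i => f i * g i) := by
  have := Asymptotics.IsBigO.mul hf hg
  simpa [OO, pow_add] using this

theorem OO.mul' {R : Type*} [SeminormedRing R] {f g : ι → R} (hf : OO l s a f)
    (hg : OO l s b g) (hs : Tendsto s l (𝓝 0)) (hk : k ≤ a + b) :
    OO l s k (fun i => f i * g i) :=
  (hf.mul hg).mono hs hk

theorem OO.pow {f : ι → ℂ} (hf : OO l s a f) (d : ℕ) :
    OO l s (a * d) (fun i => f i ^ d) := by
  have := Asymptotics.IsBigO.pow hf d
  simpa [OO, pow_mul] using this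

theorem OO.rpow {f : ι → ℝ} (hf : OO l s a f) (d : ℕ) :
    OO l s (a * d) (fun i => f i ^ d) := by
  have := Asymptotics.IsBigO.pow hf d
  simpa [OO, pow_mul] using this

theorem OO.const_mul {R : Type*} [SeminormedRing R] {f : ι → R} (hf : OO l s k f) (c : R) :
    OO l s k (fun i => c * f i) :=
  Asymptotics.IsBigO.const_mul_left hf c

theorem OO.mul_const {R : Type*} [SeminormedCommRing R] {f : ι → R} (hf : OO l s k f) (c : R) :
    OO l s k (fun i => f i * c) :=
  (hf.const_mul c).congr fun _ => mul_comm _ _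

theorem OO.div_const {f : ι → ℝ} (hf : OO l s k f) (c : ℝ) :
    OO l s k (fun i => f i / c) :=
  (hf.const_mul c⁻¹).congr fun i => by rw [div_eq_inv_mul]

theorem OO.re {f : ι → ℂ} (hf : OO l s k f) : OO l s k (fun i => (f i).re) :=
  Asymptotics.IsBigO.trans (Asymptotics.isBigO_of_le _ fun i => by
    simpa using Complex.abs_re_le_norm (f i)) hf

theorem OO.im {f : ι → ℂ} (hf : OO l s k f) : OO l s k (fun i => (f i).im) :=
  Asymptotics.IsBigO.trans (Asymptotics.isBigO_of_le _ fun i => by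
    simpa using Complex.abs_im_le_norm (f i)) hf

theorem OO.ofReal {f : ι → ℝ} (hf : OO l s k f) : OO l s k (fun i => (f i : ℂ)) :=
  Asymptotics.IsBigO.trans (Asymptotics.isBigO_of_le _ fun _ => by simp) hf

theorem OO.of_re_im {f : ι → ℂ} (hr : OO l s k fun i => (f i).re)
    (hi : OO l s k fun i => (f i).im) : OO l s k f :=
  (hr.ofReal.add (hi.ofReal.mul_const Complex.I)).congr fun i => (Complex.re_add_im (f i)).symm

theorem OO.normSq {f : ι → ℂ} (hf : OO l s k f) :
    OO l s (k + k) (fun i => Complex.normSq (f i)) :=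
  ((hf.re.mul hf.re).add (hf.im.mul hf.im)).congr fun _ => Complex.normSq_apply _

theorem OO.zero {E : Type*} [SeminormedAddCommGroup E] : OO l s k (fun _ => (0 : E)) :=
  Asymptotics.isBigO_zero _ _

theorem OO.const {E : Type*} [SeminormedAddCommGroup E] (c : E) : OO l s 0 (fun _ => c) := by
  simpa [OO] using Asymptotics.isBigO_const_const c (one_ne_zero (α := ℝ)) l

theorem OO.self (k : ℕ) : OO l s k (fun i => s i ^ k) := Asymptotics.isBigO_refl _ _

theorem OO.selfC (k : ℕ) : OO l s k (fun i => (s i : ℂ) ^ k) :=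
  (OO.self k).ofReal.congr fun i => by push_cast; rfl

theorem OO.self' (hs : Tendsto s l (𝓝 0)) (c : ℝ) (h : k ≤ a) : OO l s k (fun i => c * s i ^ a) :=
  ((OO.self a).const_mul c).mono hs h

theorem OO.tendsto {E : Type*} [NormedAddCommGroup E] {f : ι → E} (hs : Tendsto s l (𝓝 0))
    (h : OO l s k f) (hk : 1 ≤ k) : Tendsto f l (𝓝 0) := by
  have h1 : Tendsto (fun i => s i ^ k) l (𝓝 0) := by
    have := hs.pow k
    simpa [zero_pow (by omega : k ≠ 0)] using this
  have h2 : f =O[l] fun i => s i ^ k := h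
  exact h2.trans_tendsto h1

theorem OO.of_tendsto {E : Type*} [SeminormedAddCommGroup E] {f : ι → E} {c : E}
    (h : Tendsto f l (𝓝 c)) : OO l s 0 f := by
  have := h.isBigO_one ℝ
  simpa [OO] using this

/-- `f` is bounded above by a multiple of `s ^ k` along `l`. -/
def UB {ι : Type*} (l : Filter ι) (s : ι → ℝ) (k : ℕ) (f : ι → ℝ) : Prop :=
  ∃ C : ℝ, ∀ᶠ i in l, f i ≤ C * s i ^ k

theorem OO.bound {E : Type*} [Norm E] {f : ι → E} (hs : ∀ᶠ i in l, 0 ≤ s i) (h : OO l s k f) :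
    ∃ C : ℝ, 0 < C ∧ ∀ᶠ i in l, ‖f i‖ ≤ C * s i ^ k := by
  obtain ⟨C, hC, h⟩ := Asymptotics.IsBigO.exists_pos h
  refine ⟨C, hC, ?_⟩
  filter_upwards [h.bound, hs] with i hi hsi
  rwa [Real.norm_of_nonneg (pow_nonneg hsi k)] at hi

theorem OO.ub {f : ι → ℝ} (hs : ∀ᶠ i in l, 0 ≤ s i) (h : OO l s k f) : UB l s k f := by
  obtain ⟨C, -, hC⟩ := h.bound hs
  exact ⟨C, hC.mono fun i hi => (le_abs_self _).trans hi⟩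

theorem UB.add {f g : ι → ℝ} (hf : UB l s k f) (hg : UB l s k g) :
    UB l s k (fun i => f i + g i) := by
  obtain ⟨C, hC⟩ := hf
  obtain ⟨C', hC'⟩ := hg
  refine ⟨C + C', ?_⟩
  filter_upwards [hC, hC'] with i h h'
  linarith

theorem UB.sum {J : Type*} {S : Finset J} {f : J → ι → ℝ} (hf : ∀ j ∈ S, UB l s k (f j)) :
    UB l s k (fun i => ∑ j ∈ S, f j i) := by
  classical
  induction S using Finset.induction_on with
  | empty => exact ⟨0, by simp⟩
  | insert a S ha ih =>
    have h1 := (hf a (by simp)).add (ih fun j hj => hf j (by simp [hj]))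
    obtain ⟨C, hC⟩ := h1
    refine ⟨C, hC.mono fun i hi => ?_⟩
    simpa only [Finset.sum_insert ha] using hi

theorem UB.const_mul {f : ι → ℝ} (hf : UB l s k f) {c : ℝ} (hc : 0 ≤ c) :
    UB l s k (fun i => c * f i) := by
  obtain ⟨C, hC⟩ := hf
  refine ⟨c * C, hC.mono fun i hi => ?_⟩
  have := mul_le_mul_of_nonneg_left hi hc
  linarith

theorem UB.mono {f g : ι → ℝ} (hf : UB l s k f) (h : ∀ᶠ i in l, g i ≤ f i) : UB l s k g := by
  obtain ⟨C, hC⟩ := hf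
  exact ⟨C, by filter_upwards [hC, h] with i a b; exact b.trans a⟩

theorem UB.congr {f g : ι → ℝ} (hf : UB l s k f) (h : ∀ i, g i = f i) : UB l s k g :=
  hf.mono (Eventually.of_forall fun i => (h i).le)

theorem UB.of_le {f : ι → ℝ} (h : ∀ᶠ i in l, f i ≤ 0) : UB l s k f :=
  ⟨0, by simpa using h⟩

theorem UB.weaken {f : ι → ℝ} (hs0 : ∀ᶠ i in l, 0 ≤ s i) (hs : Tendsto s l (𝓝 0))
    (hf : UB l s a f) (hk : k ≤ a) : UB l s k f := by
  obtain ⟨C, hC⟩ := hf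
  have h1 : UB l s k (fun i => C * s i ^ a) := (OO.self' hs C hk).ub hs0
  exact h1.mono hC

theorem UB.antisymm {f : ι → ℝ} (hs : ∀ᶠ i in l, 0 ≤ s i) (h1 : UB l s k f)
    (h2 : UB l s k fun i => - f i) : OO l s k f := by
  obtain ⟨C, hC⟩ := h1
  obtain ⟨C', hC'⟩ := h2
  refine Asymptotics.IsBigO.of_bound (max C C') ?_
  filter_upwards [hC, hC', hs] with i a b c
  have hp := pow_nonneg c k
  rw [Real.norm_of_nonneg hp, Real.norm_eq_abs, abs_le]
  have h3 := mul_le_mul_of_nonneg_right (le_max_left C C') hp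
  have h4 := mul_le_mul_of_nonneg_right (le_max_right C C') hp
  constructor <;> linarith

/-- If a sum of functions which are bounded above is bounded below, then so is each summand. -/
theorem UB.each {J : Type*} {S : Finset J} {f : J → ι → ℝ} (hs : ∀ᶠ i in l, 0 ≤ s i)
    (hf : ∀ j ∈ S, UB l s k (f j)) (h : UB l s k fun i => - ∑ j ∈ S, f j i) {j : J}
    (hj : j ∈ S) : OO l s k (f j) := by
  classical
  refine UB.antisymm hs (hf j hj) ?_
  have h1 : UB l s k (fun i => ∑ j ∈ S.erase j, f j i) :=
    UB.sum fun j' hj' => hf j' (Finset.mem_of_mem_erase hj')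
  refine (h.add h1).congr fun i => ?_
  rw [← Finset.add_sum_erase S (fun j => f j i) hj]
  ring

theorem one_add_pow_OO {δ : ι → ℂ} (hs : Tendsto s l (𝓝 0)) (hδ : OO l s a δ) (p : ℕ) :
    OO l s (2 * a) (fun i => (1 + δ i) ^ p - 1 - p * δ i) := by
  induction p with
  | zero => simpa using (OO.zero : OO l s (2 * a) fun _ : ι => (0 : ℂ))
  | succ p ih =>
    have hb : OO l s 0 (fun i => 1 + δ i) := (OO.const 1).add (hδ.mono hs (Nat.zero_le _))
    have h1 : OO l s (2 * a) (fun i => (1 + δ i) * ((1 + δ i) ^ p - 1 - p * δ i)) :=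
      hb.mul' ih hs (by omega)
    have h2 : OO l s (2 * a) (fun i => (p : ℂ) * (δ i * δ i)) :=
      (hδ.mul' hδ hs (by omega)).const_mul _
    refine (h1.add h2).congr fun i => ?_
    push_cast
    ring

end OO

/-! ### Elementary symmetric functions of the critical points -/

section Algebra

open Polynomial

variable {n : ℕ}

/-- The elementary symmetric functions of a tuple. -/
noncomputable def esym (ζ : Fin n → ℂ) (k : ℕ) : ℂ := (Finset.univ.val.map ζ).esymm k

/-- The power sums of a tuple. -/
noncomputable def psum (ζ : Fin n → ℂ) (k : ℕ) : ℂ := ∑ j, ζ j ^ k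

/-- Minus the coefficient of `X ^ (n + 1 - k)` in the monic polynomial with critical points `ζ`. -/
noncomputable def cf (ζ : Fin n → ℂ) (k : ℕ) : ℂ := (-1) ^ (k + 1) * esym ζ k * (n + 1) / (n + 1 - k)

theorem newton (ζ : Fin n → ℂ) (k : ℕ) :
    k * esym ζ k = (-1) ^ (k + 1) *
      ∑ a ∈ Finset.HasAntidiagonal.antidiagonal k with a.1 < k, (-1) ^ a.1 * esym ζ a.1 * psum ζ a.2 := by
  have h := congrArg (MvPolynomial.aeval ζ) (MvPolynomial.mul_esymm_eq_sum (Fin n) ℂ k)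
  simp only [map_mul, map_sum, map_natCast, map_pow, map_neg, map_one,
    MvPolynomial.aeval_esymm_eq_multiset_esymm, MvPolynomial.psum, MvPolynomial.aeval_X] at h
  exact h

theorem esym_zero (ζ : Fin n → ℂ) : esym ζ 0 = 1 := by simp [esym, Multiset.esymm]

theorem esym_one (ζ : Fin n → ℂ) : esym ζ 1 = psum ζ 1 := by
  have h := newton ζ 1
  have e : (Finset.HasAntidiagonal.antidiagonal 1).filter (fun a : ℕ × ℕ => a.1 < 1) = {(0, 1)} := by decide
  rw [e] at h
  simpa [esym_zero] using h

theorem esym_two (ζ : Fin n → ℂ) : esym ζ 2 = (esym ζ 1 ^ 2 - psum ζ 2) / 2 := by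
  have h := newton ζ 2
  have e : (Finset.HasAntidiagonal.antidiagonal 2).filter (fun a : ℕ × ℕ => a.1 < 2) = {(0, 2), (1, 1)} := by decide
  rw [e, Finset.sum_pair (by decide)] at h
  simp only [esym_zero] at h
  push_cast at h
  rw [← esym_one] at h
  linear_combination h / 2

theorem esym_three (ζ : Fin n → ℂ) :
    esym ζ 3 = (esym ζ 2 * esym ζ 1 - esym ζ 1 * psum ζ 2 + psum ζ 3) / 3 := by
  have h := newton ζ 3
  have e : (Finset.HasAntidiagonal.antidiagonal 3).filter (fun a : ℕ × ℕ => a.1 < 3) =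
    {(0, 3), (1, 2), (2, 1)} := by decide
  rw [e, Finset.sum_insert (by decide), Finset.sum_pair (by decide)] at h
  simp only [esym_zero] at h
  push_cast at h
  rw [← esym_one] at h
  linear_combination h / 3

theorem esym_four (ζ : Fin n → ℂ) :
    esym ζ 4 = (esym ζ 3 * esym ζ 1 - esym ζ 2 * psum ζ 2 + esym ζ 1 * psum ζ 3 - psum ζ 4) / 4 := by
  have h := newton ζ 4
  have e : (Finset.HasAntidiagonal.antidiagonal 4).filter (fun a : ℕ × ℕ => a.1 < 4) =
    {(0, 4), (1, 3), (2, 2), (3, 1)} := by decide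
  rw [e, Finset.sum_insert (by decide), Finset.sum_insert (by decide),
    Finset.sum_pair (by decide)] at h
  simp only [esym_zero] at h
  push_cast at h
  rw [← esym_one] at h
  linear_combination h / 4

theorem esym_five (ζ : Fin n → ℂ) :
    esym ζ 5 = (esym ζ 4 * esym ζ 1 - esym ζ 3 * psum ζ 2 + esym ζ 2 * psum ζ 3
      - esym ζ 1 * psum ζ 4 + psum ζ 5) / 5 := by
  have h := newton ζ 5
  have e : (Finset.HasAntidiagonal.antidiagonal 5).filter (fun a : ℕ × ℕ => a.1 < 5) =
    {(0, 5), (1, 4), (2, 3), (3, 2), (4, 1)} := by decide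
  rw [e, Finset.sum_insert (by decide), Finset.sum_insert (by decide),
    Finset.sum_insert (by decide), Finset.sum_pair (by decide)] at h
  simp only [esym_zero] at h
  push_cast at h
  rw [← esym_one] at h
  linear_combination h / 5

theorem esym_eq_sum (ζ : Fin n → ℂ) (k : ℕ) :
    esym ζ k = ∑ t ∈ Finset.powersetCard k Finset.univ, ∏ j ∈ t, ζ j :=
  Finset.esymm_map_val ζ Finset.univ k

theorem esym_eq_zero (ζ : Fin n → ℂ) {k : ℕ} (hk : n < k) : esym ζ k = 0 := by
  rw [esym_eq_sum, Finset.powersetCard_eq_empty.2 (by simpa using hk), Finset.sum_empty]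

theorem cf_eq_zero (ζ : Fin n → ℂ) {k : ℕ} (hk : n < k) : cf ζ k = 0 := by
  simp [cf, esym_eq_zero ζ hk]

theorem OO.esym {ι : Type*} {l : Filter ι} {s : ι → ℝ} {a : ℕ} {ζ : ι → Fin n → ℂ}
    (h : ∀ j, OO l s a fun i => ζ i j) (k : ℕ) : OO l s (a * k) fun i => esym (ζ i) k := by
  have h1 : ∀ t : Finset (Fin n), OO l s (a * t.card) fun i => ∏ j ∈ t, ζ i j := by
    intro t
    induction t using Finset.induction_on with
    | empty => simpa using (OO.const (1 : ℂ) : OO l s 0 fun _ => (1 : ℂ))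
    | insert j t hj ih =>
      simp only [Finset.prod_insert hj, Finset.card_insert_of_notMem hj]
      have := (h j).mul ih
      rwa [show a + a * t.card = a * (t.card + 1) by ring] at this
  refine (OO.sum (S := Finset.powersetCard k Finset.univ)
    (f := fun t i => ∏ j ∈ t, ζ i j) fun t ht => ?_).congr fun i => esym_eq_sum (ζ i) k
  have := h1 t
  rwa [(Finset.mem_powersetCard.1 ht).2] at this

/-- The monic polynomial without constant term with critical points `ζ`. -/
noncomputable def primitive (ζ : Fin n → ℂ) : ℂ[X] :=
  X ^ (n + 1) - ∑ k ∈ Finset.Icc 1 n, C (cf ζ k) * X ^ (n + 1 - k)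

theorem derivative_primitive (ζ : Fin n → ℂ) :
    (primitive ζ).derivative = C ((n : ℂ) + 1) * ∏ j, (X - C (ζ j)) := by
  have h1 : ∏ j, (X - C (ζ j)) = ∑ k ∈ Finset.range (n + 1), (-1) ^ k * (C (esym ζ k) * X ^ (n - k)) := by
    have := Multiset.prod_X_sub_X_eq_sum_esymm (Finset.univ.val.map ζ)
    simpa [esym, Finset.prod, Function.comp_def] using this
  rw [h1, Finset.sum_range_succ', primitive, derivative_sub, derivative_X_pow, derivative_sum,
    Finset.range_eq_Ico,
    Finset.sum_Ico_add' (fun k => (-1) ^ k * (C (esym ζ k) * X ^ (n - k)) : ℕ → ℂ[X]) 0 n 1]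
  simp only [esym_zero]
  rw [mul_add, add_comm (C _ * _) (C _ * _), sub_eq_add_neg, ← Finset.sum_neg_distrib, Finset.mul_sum]
  congr 1
  · simp
  · refine Finset.sum_congr (by ext; simp) fun k hk => ?_
    rw [Finset.mem_Ico] at hk
    have hk' : n + 1 - k - 1 = n - k := by omega
    have hc : ((n + 1 - k : ℕ) : ℂ) = n + 1 - k := by
      rw [Nat.cast_sub (by omega)]; push_cast; ring
    have hne : (n : ℂ) + 1 - k ≠ 0 := by
      rw [← hc]; exact_mod_cast (by omega : n + 1 - k ≠ 0)
    rw [derivative_C_mul, derivative_X_pow, hk', hc]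
    have e : cf ζ k * ((n : ℂ) + 1 - k) = (-1) ^ (k + 1) * esym ζ k * (n + 1) := by
      rw [cf]; field_simp
    rw [← mul_assoc, ← C_mul, e]
    simp only [C_mul, C_pow, C_neg, C_1]
    ring

theorem eval_primitive (ζ : Fin n → ℂ) (z : ℂ) :
    (primitive ζ).eval z = z ^ (n + 1) - ∑ k ∈ Finset.Icc 1 n, cf ζ k * z ^ (n + 1 - k) := by
  simp [primitive, eval_finsetSum]

/-- Polynomials with equal derivatives differ by a constant, and the root β determines that
constant. -/
theorem eval_of_derivative_eq (ζ : Fin n → ℂ) {P : ℂ[X]} {β : ℂ}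
    (hP : P.derivative = C ((n : ℂ) + 1) * ∏ j, (X - C (ζ j))) (hβ : P.eval β = 0) (z : ℂ) :
    P.eval z = z ^ (n + 1) - β ^ (n + 1) -
      ∑ k ∈ Finset.Icc 1 n, cf ζ k * (z ^ (n + 1 - k) - β ^ (n + 1 - k)) := by
  have h0 : (P - primitive ζ).derivative = 0 := by
    rw [derivative_sub, hP, derivative_primitive, sub_self]
  obtain ⟨c, hc⟩ := natDegree_eq_zero.1 (derivative_eq_zero.1 h0)
  have h1 : ∀ w, P.eval w = (primitive ζ).eval w + c := fun w => by
    have := congrArg (eval w) hc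
    rw [eval_C, eval_sub] at this
    rw [this]; ring
  have h2 := h1 β
  rw [hβ] at h2
  rw [h1 z, eq_neg_of_add_eq_zero_right h2.symm, eval_primitive, eval_primitive]
  simp only [mul_sub, Finset.sum_sub_distrib]
  ring

theorem monic_primitive_sub (ζ : Fin n → ℂ) (c : ℂ) :
    (primitive ζ - C c).Monic ∧ (primitive ζ - C c).natDegree = n + 1 := by
  have hd : (∑ k ∈ Finset.Icc 1 n, C (cf ζ k) * X ^ (n + 1 - k) + C c : ℂ[X]).degree ≤ n := by
    refine (degree_add_le _ _).trans (max_le ?_ (degree_C_le.trans (by exact_mod_cast Nat.zero_le n)))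
    refine (degree_sum_le _ _).trans (Finset.sup_le fun k hk => ?_)
    rw [Finset.mem_Icc] at hk
    exact (degree_C_mul_X_pow_le _ _).trans (by exact_mod_cast (by omega : n + 1 - k ≤ n))
  have e : primitive ζ - C c =
      X ^ (n + 1) - (∑ k ∈ Finset.Icc 1 n, C (cf ζ k) * X ^ (n + 1 - k) + C c) := by
    rw [primitive]; ring
  rw [e]
  refine ⟨monic_X_pow_sub (by exact_mod_cast Order.lt_succ_iff.2 hd), ?_⟩
  rw [natDegree_sub_eq_left_of_natDegree_lt, natDegree_X_pow]
  rw [natDegree_X_pow]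
  exact Nat.lt_succ_of_le (natDegree_le_of_degree_le hd)

theorem exists_polynomial (ζ : Fin n → ℂ) (β : ℂ) : ∃ P : ℂ[X], P.Monic ∧ P.natDegree = n + 1 ∧
    P.eval β = 0 ∧ P.derivative = C ((n : ℂ) + 1) * ∏ j, (X - C (ζ j)) :=
  ⟨primitive ζ - C ((primitive ζ).eval β), (monic_primitive_sub ζ _).1, (monic_primitive_sub ζ _).2,
    by simp, by rw [derivative_sub, derivative_primitive, derivative_C, sub_zero]⟩

/-- |P(w)| is the product of the distances from w to the roots, so the smallest distance, raised to
the degree, is at most |P(w)|. -/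
theorem exists_root_near {P : ℂ[X]} (hP : P.Monic) (hd : P.natDegree ≠ 0) (w : ℂ) :
    ∃ z, P.eval z = 0 ∧ ‖w - z‖ ^ P.natDegree ≤ ‖P.eval w‖ := by
  by_contra! hcon
  have hs := IsAlgClosed.splits P
  have h0 : P.eval w ≠ 0 := fun h => by
    have := hcon w h
    simp [h, hd] at this
  have h1 : ‖P.eval w‖ = (P.roots.map fun z => ‖w - z‖).prod := by
    rw [hs.eval_eq_prod_roots_of_monic hP]
    have := Multiset.prod_hom (P.roots.map fun z => w - z) (normHom : ℂ →*₀ ℝ)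
    rw [Multiset.map_map] at this
    exact this.symm
  -- The exponent stays equal to the degree while the cardinality varies, which is what makes the
  -- induction possible; at the end both agree.
  have key : ∀ m : Multiset ℂ, m ≠ 0 → (∀ z ∈ m, ‖P.eval w‖ < ‖w - z‖ ^ P.natDegree) →
      ‖P.eval w‖ ^ Multiset.card m < (m.map fun z => ‖w - z‖).prod ^ P.natDegree := by
    intro m
    induction m using Multiset.induction_on with
    | empty => intro h; exact absurd rfl h
    | cons a m ih =>
      intro _ hm
      rcases eq_or_ne m 0 with rfl | hm0
      · simpa using hm a (by simp)
      · have h2 := ih hm0 fun z hz => hm z (by simp [hz])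
        have h3 := hm a (by simp)
        rw [Multiset.card_cons, Multiset.map_cons, Multiset.prod_cons, pow_succ', mul_pow]
        exact mul_lt_mul'' h3 h2 (norm_nonneg _) (by positivity)
  have hcard : Multiset.card P.roots = P.natDegree := (splits_iff_card_roots.1 hs)
  have hne : P.roots ≠ 0 := by
    intro h; rw [h] at hcard; exact hd (by simpa using hcard.symm)
  have h4 := key P.roots hne fun z hz => hcon z (by
    have := (mem_roots'.1 hz).2; exact this)
  rw [hcard, h1] at h4
  exact lt_irrefl _ h4

theorem exists_fin_family {m : Multiset ℂ} (hm : Multiset.card m = n) :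
    ∃ ζ : Fin n → ℂ, Finset.univ.val.map ζ = m := by
  subst hm
  induction m using Quotient.inductionOn with
  | h L =>
    refine ⟨fun j => L.get (Fin.cast (by simp) j), ?_⟩
    rw [Fin.univ_val_map]
    simp

/-- Normal form of a polynomial in terms of its critical points. -/
theorem exists_critical_points {P : ℂ[X]} (hd : P.natDegree = n + 1) :
    ∃ (Q : ℂ[X]) (ζ : Fin n → ℂ), Q.Monic ∧ Q.natDegree = n + 1 ∧
      (∀ z, Q.eval z = 0 ↔ P.IsRoot z) ∧
      Q.derivative = C ((n : ℂ) + 1) * ∏ j, (X - C (ζ j)) ∧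
      {z : ℂ | P.derivative.IsRoot z} = Set.range ζ := by
  have hP0 : P ≠ 0 := by rintro rfl; simp at hd
  have hl : P.leadingCoeff ≠ 0 := leadingCoeff_ne_zero.2 hP0
  have hdd : P.derivative.natDegree = n := by
    rw [natDegree_derivative]
    omega
  have hn1 : (n : ℂ) + 1 ≠ 0 := by exact_mod_cast n.succ_ne_zero
  have hs := IsAlgClosed.splits P.derivative
  obtain ⟨ζ, hζ⟩ := exists_fin_family ((splits_iff_card_roots.1 hs).trans hdd)
  have hlc : P.derivative.leadingCoeff = P.leadingCoeff * (n + 1) := by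
    rw [leadingCoeff, hdd, coeff_derivative, leadingCoeff, hd]
  have hprod : P.derivative = C (P.leadingCoeff * (n + 1)) * ∏ j, (X - C (ζ j)) := by
    conv_lhs => rw [hs.eq_prod_roots, hlc, ← hζ, Multiset.map_map]
    rfl
  refine ⟨C P.leadingCoeff⁻¹ * P, ζ, ?_, ?_, ?_, ?_, ?_⟩
  · rw [Monic, leadingCoeff_mul, leadingCoeff_C, inv_mul_cancel₀ hl]
  · rw [natDegree_C_mul (inv_ne_zero hl), hd]
  · intro z
    rw [eval_mul, eval_C, IsRoot.def]
    simp [hl]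
  · rw [derivative_C_mul, hprod, ← mul_assoc, ← C_mul]
    congr 2
    field_simp
  · ext z
    rw [Set.mem_ofPred_eq, hprod, IsRoot.def, eval_mul, eval_C, eval_prod, mul_eq_zero,
      or_iff_right (mul_ne_zero hl hn1), Finset.prod_eq_zero_iff]
    simp [sub_eq_zero, eq_comm]

/-- Write P = (X - β)Q. Then P'(β) = Q(β) and P''(β) = 2Q'(β), so the logarithmic derivative of P'
at β is twice that of Q. The multiset consists of the roots of Q. -/
theorem sum_inv_sub_critical (ζ : Fin n → ℂ) {P : ℂ[X]} {β : ℂ}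
    (hP : P.derivative = C ((n : ℂ) + 1) * ∏ j, (X - C (ζ j))) (hm : P.Monic)
    (hd : P.natDegree = n + 1) (hβ : P.eval β = 0) (hζ : ∀ j, β ≠ ζ j) :
    ∃ m : Multiset ℂ, Multiset.card m = n ∧ (∀ z ∈ m, P.eval z = 0 ∧ z ≠ β) ∧
      ∑ j, 1 / (β - ζ j) = 2 * (m.map fun z => 1 / (β - z)).sum := by
  obtain ⟨Q, hQ⟩ := dvd_iff_isRoot.2 (show P.IsRoot β from hβ)
  have hn1 : (n : ℂ) + 1 ≠ 0 := by exact_mod_cast n.succ_ne_zero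
  have hQm : Q.Monic := (monic_X_sub_C β).of_mul_monic_left (hQ ▸ hm)
  have hd1 : P.derivative = Q + (X - C β) * Q.derivative := by
    rw [hQ, derivative_mul, derivative_X_sub_C, one_mul]
  have hd2 : P.derivative.derivative = 2 * Q.derivative + (X - C β) * Q.derivative.derivative := by
    rw [hd1, derivative_add, derivative_mul, derivative_X_sub_C]; ring
  have e1 : P.derivative.eval β = Q.eval β := by rw [hd1]; simp
  have e2 : P.derivative.derivative.eval β = 2 * Q.derivative.eval β := by rw [hd2]; simp
  have hne : P.derivative.eval β ≠ 0 := by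
    rw [hP, eval_mul, eval_C, eval_prod]
    refine mul_ne_zero hn1 (Finset.prod_ne_zero_iff.2 fun j _ => ?_)
    simpa [sub_eq_zero] using hζ j
  have hneQ : Q.eval β ≠ 0 := e1 ▸ hne
  have h1 := (IsAlgClosed.splits P.derivative).eval_derivative_div_eval_of_ne_zero hne
  have h2 := (IsAlgClosed.splits Q).eval_derivative_div_eval_of_ne_zero hneQ
  have hr : P.derivative.roots = Finset.univ.val.map ζ := by
    rw [hP, roots_C_mul _ hn1]
    have := roots_multiset_prod_X_sub_C (Finset.univ.val.map ζ)
    rw [Multiset.map_map] at this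
    exact this
  refine ⟨Q.roots, ?_, ?_, ?_⟩
  · rw [splits_iff_card_roots.1 (IsAlgClosed.splits Q)]
    have := congrArg natDegree hQ
    rw [(monic_X_sub_C β).natDegree_mul hQm, natDegree_X_sub_C, hd] at this
    omega
  · intro z hz
    have hz' : Q.eval z = 0 := (mem_roots'.1 hz).2
    refine ⟨by rw [hQ, eval_mul, hz', mul_zero], ?_⟩
    rintro rfl
    exact hneQ hz'
  · rw [hr, Multiset.map_map] at h1
    rw [← h2, ← mul_div_assoc, ← e1, ← e2, h1]
    rfl

end Algebra

/-! ### Expansion of a root near a root of unity -/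

section Root

variable {ι : Type*} {l : Filter ι} {s : ι → ℝ} {n : ℕ}

/-- The equation satisfied by a root `z` of the monic polynomial of degree `n + 1` vanishing at
`1 - s ^ 2` whose lower coefficients are `- c k`. -/
def RootEq (n : ℕ) (s : ι → ℝ) (c : ℕ → ι → ℂ) (z : ι → ℂ) : Prop :=
  ∀ i, z i ^ (n + 1) - (1 - (s i : ℂ) ^ 2) ^ (n + 1) =
    ∑ k ∈ Finset.Icc 1 n, c k i * (z i ^ (n + 1 - k) - (1 - (s i : ℂ) ^ 2) ^ (n + 1 - k))

theorem pow_sub_eq {ω o : ℂ} {N k : ℕ} (ho : o * ω = 1) (hω : ω ^ N = 1) (hk : k ≤ N) :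
    ω ^ (N - k) = o ^ k := by
  have h1 : ω ^ (N - k) * ω ^ k = 1 := by rw [← pow_add, Nat.sub_add_cancel hk, hω]
  have h2 : o ^ k * ω ^ k = 1 := by rw [← mul_pow, ho, one_pow]
  have h3 : ω ^ k ≠ 0 := right_ne_zero_of_mul_eq_one h2
  exact mul_right_cancel₀ h3 (h1.trans h2.symm)

/-- (1+δ)^(n+1) - 1 is δ times a geometric sum that tends to n + 1, so it bounds δ. -/
theorem OO.of_pow_sub_one {δ : ι → ℂ} {a : ℕ} (hδ : Tendsto δ l (𝓝 0))
    (h : OO l s a fun i => (1 + δ i) ^ (n + 1) - 1) : OO l s a δ := by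
  have h1 : Tendsto (fun i => ∑ j ∈ Finset.range (n + 1), (1 + δ i) ^ j) l (𝓝 ((n : ℂ) + 1)) := by
    have : Tendsto (fun i => ∑ j ∈ Finset.range (n + 1), (1 + δ i) ^ j) l
        (𝓝 (∑ j ∈ Finset.range (n + 1), (1 + 0) ^ j)) :=
      tendsto_finsetSum _ fun j _ => (hδ.const_add 1).pow j
    simpa using this
  have h2 : ∀ᶠ i in l, 1 / 2 < ‖∑ j ∈ Finset.range (n + 1), (1 + δ i) ^ j‖ := by
    refine h1.norm.eventually_const_lt ?_
    have : ‖(n : ℂ) + 1‖ = n + 1 := by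
      have := Complex.norm_natCast (n + 1)
      push_cast at this
      exact this
    rw [this]
    have : (0 : ℝ) ≤ n := n.cast_nonneg
    linarith
  refine Asymptotics.IsBigO.trans (Asymptotics.IsBigO.of_bound 2 ?_) h
  filter_upwards [h2] with i hi
  have h3 : (1 + δ i) ^ (n + 1) - 1 = (∑ j ∈ Finset.range (n + 1), (1 + δ i) ^ j) * δ i := by
    have := geom_sum_mul (1 + δ i) (n + 1)
    rw [← this]; ring
  rw [h3, norm_mul]
  nlinarith [norm_nonneg (δ i)]

theorem eps_pow_OO (hs : Tendsto s l (𝓝 0)) (p : ℕ) :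
    OO l s 4 fun i => (1 - (s i : ℂ) ^ 2) ^ p - 1 + p * (s i : ℂ) ^ 2 :=
  (one_add_pow_OO hs ((OO.selfC 2).neg) p).congr fun i => by ring

variable {ω o : ℂ} {c : ℕ → ι → ℂ} {z : ι → ℂ}

theorem root_pow_expansion {a : ℕ} (hs : Tendsto s l (𝓝 0)) (ho : o * ω = 1)
    (hω : ω ^ (n + 1) = 1) {k : ℕ} (hk : k ≤ n + 1) {δ : ι → ℂ} (hz : ∀ i, z i = ω * (1 + δ i))
    (hδ : OO l s a δ) :
    OO l s (2 * a) fun i => z i ^ (n + 1 - k) - o ^ k - (n + 1 - k) * o ^ k * δ i := by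
  refine ((one_add_pow_OO hs hδ (n + 1 - k)).const_mul (o ^ k)).congr fun i => ?_
  rw [hz, mul_pow, pow_sub_eq ho hω hk, Nat.cast_sub hk]
  push_cast
  ring

theorem root_shift (ho : o * ω = 1) (i : ι) : z i = ω * (1 + (o * z i - 1)) := by
  have : ω * (1 + (o * z i - 1)) = (o * ω) * z i := by ring
  rw [this, ho, one_mul]

/-- Write z = ω(1+δ). The equation bounds (1+δ)^(n+1) - 1, hence δ, by the size s^a of the
coefficients. Replacing z by ω in the terms multiplied by a coefficient then costs only O(s^(2a)).
-/
theorem root_first_order {a : ℕ} (ha1 : 1 ≤ a) (ha : a ≤ 2) (hs : Tendsto s l (𝓝 0))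
    (ho : o * ω = 1) (hω : ω ^ (n + 1) = 1) (hz : Tendsto z l (𝓝 ω)) (h : RootEq n s c z)
    (hc : ∀ k, 1 ≤ k → OO l s a (c k)) :
    OO l s a (fun i => o * z i - 1) ∧
    OO l s (2 * a) (fun i => z i ^ (n + 1) - 1 + (n + 1) * (s i : ℂ) ^ 2
      - ∑ k ∈ Finset.Icc 1 n, c k i * (o ^ k - 1)) := by
  set δ : ι → ℂ := fun i => o * z i - 1 with hδdef
  have hzδ : ∀ i, z i = ω * (1 + δ i) := fun i => root_shift ho i
  have hδ0 : Tendsto δ l (𝓝 0) := by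
    have := (hz.const_mul o).sub_const 1
    rwa [ho, sub_self] at this
  have hzN : ∀ i, z i ^ (n + 1) = (1 + δ i) ^ (n + 1) := fun i => by
    rw [hzδ, mul_pow, hω, one_mul]
  have hβ : ∀ p : ℕ, OO l s 2 fun i => (1 - (s i : ℂ) ^ 2) ^ p - 1 := fun p =>
    (((eps_pow_OO hs p).mono hs (by norm_num : 2 ≤ 4)).sub ((OO.selfC 2).const_mul (p : ℂ))).congr
      fun i => by ring
  have hz0 : OO l s 0 z := OO.of_tendsto hz
  have hg : OO l s a fun i => z i ^ (n + 1) - 1 := by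
    have h1 : OO l s a fun i => ∑ k ∈ Finset.Icc 1 n,
        c k i * (z i ^ (n + 1 - k) - (1 - (s i : ℂ) ^ 2) ^ (n + 1 - k)) := by
      refine OO.sum fun k hk => (hc k (Finset.mem_Icc.1 hk).1).mul' (b := 0) ?_ hs (by omega)
      exact ((((hz0.pow (n + 1 - k)).mono hs (Nat.zero_le _)).sub
        ((hβ (n + 1 - k)).mono hs (Nat.zero_le _))).sub (OO.const 1)).congr fun i => by ring
    exact (h1.add ((hβ (n + 1)).mono hs ha)).congr fun i => by rw [← h i]; ring
  have hδ : OO l s a δ := OO.of_pow_sub_one (n := n) hδ0 (hg.congr fun i => by rw [hzN])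
  refine ⟨hδ, ?_⟩
  have hterm : OO l s (2 * a) fun i => ∑ k ∈ Finset.Icc 1 n,
      c k i * (z i ^ (n + 1 - k) - (1 - (s i : ℂ) ^ 2) ^ (n + 1 - k) - (o ^ k - 1)) := by
    refine OO.sum fun k hk => (hc k (Finset.mem_Icc.1 hk).1).mul' (b := a) ?_ hs (by omega)
    rw [Finset.mem_Icc] at hk
    have h1 := (root_pow_expansion hs ho hω (k := k) (by omega) hzδ hδ).mono hs (by omega : a ≤ 2 * a)
    exact ((h1.add (hδ.const_mul ((n + 1 - k) * o ^ k))).sub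
      ((hβ (n + 1 - k)).mono hs ha)).congr fun i => by ring
  refine (hterm.add ((eps_pow_OO hs (n + 1)).mono hs (by omega))).congr fun i => ?_
  have := h i
  simp only [mul_sub, Finset.sum_sub_distrib] at this ⊢
  push_cast
  linear_combination this

/-- The first order coefficient of `z ^ (n + 1)` at a root `z`. -/
noncomputable def dir (n : ℕ) (γ₁ γ₂ : ℝ) (o : ℂ) : ℂ :=
  -(n + 1) + γ₁ * (o - 1) + γ₂ * (o ^ 2 - 1)

/-- The second order coefficient coming from the motion of the roots. -/
noncomputable def quad (n : ℕ) (γ₁ γ₂ : ℝ) (o : ℂ) : ℂ :=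
  (n + 1) * n / 2 + γ₁ * n * (o * dir n γ₁ γ₂ o / (n + 1) + 1)
    + γ₂ * (n - 1) * (o ^ 2 * dir n γ₁ γ₂ o / (n + 1) + 1)

theorem eps_pow_OO' (hs : Tendsto s l (𝓝 0)) (p : ℕ) :
    OO l s 6 fun i => (1 - (s i : ℂ) ^ 2) ^ p - 1 + p * (s i : ℂ) ^ 2
      - p * (p - 1) / 2 * (s i : ℂ) ^ 4 := by
  induction p with
  | zero => simpa using (OO.zero : OO l s 6 fun _ => (0 : ℂ))
  | succ p ih =>
    have h1 : OO l s 6 fun i => (1 - (s i : ℂ) ^ 2) * ((1 - (s i : ℂ) ^ 2) ^ p - 1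
        + p * (s i : ℂ) ^ 2 - p * (p - 1) / 2 * (s i : ℂ) ^ 4) :=
      OO.mul' (a := 0) ((OO.const 1).sub ((OO.selfC 2).mono hs (by norm_num))) ih hs (by norm_num)
    have h2 : OO l s 6 fun i => ((p : ℂ) * (p - 1) / 2) * (s i : ℂ) ^ 6 :=
      (OO.selfC 6).const_mul _
    refine (h1.sub h2).congr fun i => ?_
    push_cast
    ring

/-- Only c₁ and c₂ have a term of size s² known to matter, so the shift δ is known modulo s^(m-2).
Multiplied by coefficients of size s², this gives an error s^m; the known part of δ produces `quad`.
Coefficients with k ≥ 3 are O(s^(m-2)), so against factors of size s² they contribute nothing beyond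
their value at ω. -/
theorem root_second_order {m : ℕ} (hm5 : 5 ≤ m) (hm6 : m ≤ 6) (hn : 3 ≤ n)
    (hs : Tendsto s l (𝓝 0)) (ho : o * ω = 1) (hω : ω ^ (n + 1) = 1) (hz : Tendsto z l (𝓝 ω))
    (h : RootEq n s c z) {γ₁ γ₂ : ℝ}
    (hc1 : OO l s (m - 2) fun i => c 1 i - γ₁ * (s i : ℂ) ^ 2)
    (hc2 : OO l s (m - 2) fun i => c 2 i - γ₂ * (s i : ℂ) ^ 2)
    (hc : ∀ k, 3 ≤ k → OO l s (m - 2) (c k)) :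
    OO l s (m - 2) (fun i => z i ^ (n + 1) - 1 - dir n γ₁ γ₂ o * (s i : ℂ) ^ 2) ∧
    OO l s m (fun i => z i ^ (n + 1) - 1 + (n + 1) * (s i : ℂ) ^ 2
      - ∑ k ∈ Finset.Icc 1 n, c k i * (o ^ k - 1) - quad n γ₁ γ₂ o * (s i : ℂ) ^ 4) := by
  have hc1' : OO l s 2 (c 1) := ((hc1.mono hs (by omega)).add
    ((OO.selfC 2).const_mul (γ₁ : ℂ))).congr fun i => by ring
  have hc2' : OO l s 2 (c 2) := ((hc2.mono hs (by omega)).add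
    ((OO.selfC 2).const_mul (γ₂ : ℂ))).congr fun i => by ring
  have hc' : ∀ k, 1 ≤ k → OO l s 2 (c k) := fun k hk => by
    rcases (by omega : k = 1 ∨ k = 2 ∨ 3 ≤ k) with rfl | rfl | h3
    exacts [hc1', hc2', (hc k h3).mono hs (by omega)]
  obtain ⟨hδ, hg⟩ := root_first_order (a := 2) (by norm_num) le_rfl hs ho hω hz h hc'
  set δ : ι → ℂ := fun i => o * z i - 1 with hδdef
  have hzδ : ∀ i, z i = ω * (1 + δ i) := fun i => root_shift ho i
  have hzN : ∀ i, z i ^ (n + 1) = (1 + δ i) ^ (n + 1) := fun i => by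
    rw [hzδ, mul_pow, hω, one_mul]
  have hsplit : ∀ f : ℕ → ℂ, ∑ k ∈ Finset.Icc 1 n, f k = f 1 + f 2 + ∑ k ∈ Finset.Icc 3 n, f k := by
    intro f
    rw [← Finset.add_sum_Ioc_eq_sum_Icc (by omega : 1 ≤ n), add_assoc,
      ← Finset.Icc_add_one_left_eq_Ioc, ← Finset.add_sum_Ioc_eq_sum_Icc (by omega : 1 + 1 ≤ n),
      ← Finset.Icc_add_one_left_eq_Ioc]
    ring_nf
  have hrest : OO l s (m - 2) fun i => ∑ k ∈ Finset.Icc 3 n, c k i * (o ^ k - 1) :=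
    OO.sum fun k hk => (hc k (Finset.mem_Icc.1 hk).1).mul_const _
  have hdir : OO l s (m - 2) (fun i => z i ^ (n + 1) - 1 - dir n γ₁ γ₂ o * (s i : ℂ) ^ 2) := by
    have h1 := (hg.mono hs (by omega : m - 2 ≤ 2 * 2)).add hrest
    refine ((h1.add (hc1.mul_const (o - 1))).add (hc2.mul_const (o ^ 2 - 1))).congr fun i => ?_
    rw [hsplit]
    simp only [dir, pow_one]
    ring
  refine ⟨hdir, ?_⟩
  have hn1 : (n : ℂ) + 1 ≠ 0 := by exact_mod_cast n.succ_ne_zero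
  have hδ' : OO l s (m - 2) fun i => δ i - dir n γ₁ γ₂ o / (n + 1) * (s i : ℂ) ^ 2 := by
    have h1 := (one_add_pow_OO hs hδ (n + 1)).mono hs (by omega : m - 2 ≤ 2 * 2)
    refine ((hdir.sub h1).const_mul ((n + 1 : ℂ)⁻¹)).congr fun i => ?_
    rw [hzN]
    push_cast
    field_simp
    ring
  have hpow : ∀ k, k ≤ n → OO l s (m - 2) fun i => z i ^ (n + 1 - k) -
      (1 - (s i : ℂ) ^ 2) ^ (n + 1 - k) - (o ^ k - 1)
      - (n + 1 - k) * (o ^ k * dir n γ₁ γ₂ o / (n + 1) + 1) * (s i : ℂ) ^ 2 := by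
    intro k hk
    have h1 := (root_pow_expansion hs ho hω (k := k) (by omega) hzδ hδ).mono hs
      (by omega : m - 2 ≤ 2 * 2)
    have h2 := (eps_pow_OO hs (n + 1 - k)).mono hs (by omega : m - 2 ≤ 4)
    refine ((h1.sub h2).add (hδ'.const_mul ((n + 1 - k) * o ^ k))).congr fun i => ?_
    rw [Nat.cast_sub (by omega)]
    push_cast
    ring
  have hk3 : OO l s m fun i => ∑ k ∈ Finset.Icc 3 n, c k i * (z i ^ (n + 1 - k) -
      (1 - (s i : ℂ) ^ 2) ^ (n + 1 - k) - (o ^ k - 1)) := by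
    refine OO.sum fun k hk => ?_
    rw [Finset.mem_Icc] at hk
    refine (hc k hk.1).mul' (b := 2) ?_ hs (by omega)
    exact (((hpow k hk.2).mono hs (by omega : 2 ≤ m - 2)).add ((OO.selfC 2).const_mul
      ((n + 1 - k) * (o ^ k * dir n γ₁ γ₂ o / (n + 1) + 1)))).congr fun i => by ring
  have hk12 : ∀ k, 1 ≤ k → k ≤ n → ∀ γ : ℝ, (OO l s (m - 2) fun i => c k i - γ * (s i : ℂ) ^ 2) →
      OO l s m fun i => c k i * (z i ^ (n + 1 - k) -
      (1 - (s i : ℂ) ^ 2) ^ (n + 1 - k) - (o ^ k - 1))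
      - γ * (n + 1 - k) * (o ^ k * dir n γ₁ γ₂ o / (n + 1) + 1) * (s i : ℂ) ^ 4 := by
    intro k hk1 hk γ hγ
    have h1 := (hc' k hk1).mul' (hpow k hk) hs (by omega : m ≤ 2 + (m - 2))
    have h2 := (hγ.mul' (OO.selfC 2) hs (by omega : m ≤ m - 2 + 2)).const_mul
      ((n + 1 - k) * (o ^ k * dir n γ₁ γ₂ o / (n + 1) + 1))
    exact (h1.add h2).congr fun i => by ring
  have h1 := hk12 1 le_rfl (by omega) γ₁ hc1
  have h2 := hk12 2 (by norm_num) (by omega) γ₂ hc2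
  have h3 := (eps_pow_OO' hs (n + 1)).mono hs hm6
  refine (((h1.add h2).add hk3).add h3).congr fun i => ?_
  have h4 := h i
  rw [hsplit] at h4 ⊢
  simp only [mul_sub, Finset.sum_sub_distrib] at h4 ⊢
  simp only [quad]
  push_cast
  push_cast at h4
  linear_combination h4

end Root

/-! ### Families of critical points close to the origin -/

section Family

variable {ι : Type*} {l : Filter ι} {s : ι → ℝ} {n m : ℕ} {ζ : ι → Fin n → ℂ} {A B : ℝ}

/-- The first order coefficient of the distance of the critical points. -/
noncomputable def rho (n : ℕ) (A B : ℝ) : ℝ := A + B * (n - 1) / n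

/-- Families of critical points whose first two symmetric functions are `-n A s²` and
`(n - 1) B s²` to leading order, and whose distances from `1 - s²` agree to order `s⁴`. -/
structure Fam (l : Filter ι) (s : ι → ℝ) (ζ : ι → Fin n → ℂ) (A B : ℝ) (m : ℕ) : Prop where
  im_O : ∀ j, OO l s 1 fun i => (ζ i j).im
  re_exp : ∀ j, OO l s 4 fun i => (ζ i j).re - (ζ i j).im ^ 2 / 2 + rho n A B * s i ^ 2
  sq : OO l s 4 fun i => ∑ j, (ζ i j).im ^ 2 - 2 * ((n - 1) * B) * s i ^ 2
  im1 : OO l s (m - 2) fun i => ∑ j, (ζ i j).im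
  im3 : OO l s (m - 2) fun i => ∑ j, (ζ i j).im ^ 3

theorem re_sq (z : ℂ) : (z ^ 2).re = z.re ^ 2 - z.im ^ 2 := by
  simp [pow_succ, Complex.mul_re]

theorem im_sq (z : ℂ) : (z ^ 2).im = 2 * z.re * z.im := by
  simp [pow_succ, Complex.mul_im]; ring

theorem re_cube (z : ℂ) : (z ^ 3).re = z.re ^ 3 - 3 * z.re * z.im ^ 2 := by
  simp [pow_succ, Complex.mul_re, Complex.mul_im]; ring

theorem im_cube (z : ℂ) : (z ^ 3).im = 3 * z.re ^ 2 * z.im - z.im ^ 3 := by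
  simp [pow_succ, Complex.mul_re, Complex.mul_im]; ring

theorem re_four (z : ℂ) : (z ^ 4).re = z.re ^ 4 - 6 * z.re ^ 2 * z.im ^ 2 + z.im ^ 4 := by
  simp [pow_succ, Complex.mul_re, Complex.mul_im]; ring

theorem im_four (z : ℂ) : (z ^ 4).im = 4 * z.re ^ 3 * z.im - 4 * z.re * z.im ^ 3 := by
  simp [pow_succ, Complex.mul_re, Complex.mul_im]; ring

theorem re_five (z : ℂ) :
    (z ^ 5).re = z.re ^ 5 - 10 * z.re ^ 3 * z.im ^ 2 + 5 * z.re * z.im ^ 4 := by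
  simp [pow_succ, Complex.mul_re, Complex.mul_im]; ring

theorem im_five (z : ℂ) :
    (z ^ 5).im = 5 * z.re ^ 4 * z.im - 10 * z.re ^ 2 * z.im ^ 3 + z.im ^ 5 := by
  simp [pow_succ, Complex.mul_re, Complex.mul_im]; ring

theorem OO.mul_re {f g : ι → ℂ} {k a b c d : ℕ} (hs : Tendsto s l (𝓝 0))
    (h1 : OO l s a fun i => (f i).re) (h2 : OO l s b fun i => (g i).re)
    (h3 : OO l s c fun i => (f i).im) (h4 : OO l s d fun i => (g i).im)
    (hab : k ≤ a + b) (hcd : k ≤ c + d) : OO l s k fun i => (f i * g i).re :=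
  ((h1.mul' h2 hs hab).sub (h3.mul' h4 hs hcd)).congr fun _ => Complex.mul_re _ _

theorem OO.mul_im {f g : ι → ℂ} {k a b c d : ℕ} (hs : Tendsto s l (𝓝 0))
    (h1 : OO l s a fun i => (f i).re) (h2 : OO l s b fun i => (g i).re)
    (h3 : OO l s c fun i => (f i).im) (h4 : OO l s d fun i => (g i).im)
    (had : k ≤ a + d) (hbc : k ≤ c + b) : OO l s k fun i => (f i * g i).im :=
  ((h1.mul' h4 hs had).add (h3.mul' h2 hs hbc)).congr fun _ => Complex.mul_im _ _

theorem OO.re_mul_approx {f g : ι → ℂ} {p q : ℝ} (hs : Tendsto s l (𝓝 0))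
    (h1 : OO l s 4 fun i => (f i).re - p * s i ^ 2) (h2 : OO l s 4 fun i => (g i).re - q * s i ^ 2)
    (h3 : OO l s 3 fun i => (f i).im) (h4 : OO l s 3 fun i => (g i).im) :
    OO l s 6 fun i => (f i * g i).re - p * q * s i ^ 4 := by
  have a1 := h1.mul' (OO.self 2) hs (by norm_num : 6 ≤ 4 + 2)
  have a2 := h2.mul' (OO.self 2) hs (by norm_num : 6 ≤ 4 + 2)
  have a3 := h1.mul' h2 hs (by norm_num : 6 ≤ 4 + 4)
  refine ((((a1.const_mul q).add (a2.const_mul p)).add a3).sub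
    (h3.mul' h4 hs (by norm_num : 6 ≤ 3 + 3))).congr fun i => ?_
  rw [Complex.mul_re]; ring

namespace Fam

variable (hs : Tendsto s l (𝓝 0)) (hm : 5 ≤ m)

include hs in
theorem re_O (h : Fam l s ζ A B m) (j : Fin n) : OO l s 2 fun i => (ζ i j).re :=
  ((((h.re_exp j).mono hs (by norm_num)).add (((h.im_O j).rpow 2).const_mul (1 / 2))).sub
    (OO.self' hs (rho n A B) le_rfl)).congr fun i => by ring

include hs in
theorem O_one (h : Fam l s ζ A B m) (j : Fin n) : OO l s 1 fun i => ζ i j :=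
  OO.of_re_im ((h.re_O hs j).mono hs (by norm_num)) (h.im_O j)

include hs hm in
theorem im1' (h : Fam l s ζ A B m) : OO l s 3 fun i => ∑ j, (ζ i j).im := h.im1.mono hs (by omega)

include hs hm in
theorem im3' (h : Fam l s ζ A B m) : OO l s 3 fun i => ∑ j, (ζ i j).im ^ 3 :=
  h.im3.mono hs (by omega)

theorem sum_xy_aux (c : ℝ) (x y : Fin n → ℝ) (p : ℕ) : ∑ j, (x j - y j ^ 2 / 2 + c) * y j ^ p =
    ∑ j, x j * y j ^ p - (∑ j, y j ^ (p + 2)) / 2 + c * ∑ j, y j ^ p := by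
  rw [Finset.sum_div, Finset.mul_sum, ← Finset.sum_sub_distrib, ← Finset.sum_add_distrib]
  exact Finset.sum_congr rfl fun j _ => by ring

-- In mixed moments x_j may be replaced by y_j²/2 - ρ s², so all power sums reduce to sums of powers
-- of the y_j.
include hs in
theorem sum_xy (h : Fam l s ζ A B m) (p : ℕ) : OO l s (4 + p) fun i =>
    ∑ j, (ζ i j).re * (ζ i j).im ^ p - (∑ j, (ζ i j).im ^ (p + 2)) / 2
      + rho n A B * s i ^ 2 * ∑ j, (ζ i j).im ^ p := by
  refine (OO.sum (S := Finset.univ) (f := fun j i => ((ζ i j).re - (ζ i j).im ^ 2 / 2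
    + rho n A B * s i ^ 2) * (ζ i j).im ^ p) fun j _ => ?_).congr fun i => ?_
  · exact (h.re_exp j).mul' ((h.im_O j).rpow p) hs (by omega)
  · exact (sum_xy_aux _ _ _ _).symm

include hs in
theorem mono_O (h : Fam l s ζ A B m) (a b k : ℕ) (hk : k ≤ 2 * a + b) :
    OO l s k fun i => ∑ j, (ζ i j).re ^ a * (ζ i j).im ^ b :=
  OO.sum fun j _ => ((h.re_O hs j).rpow a).mul' ((h.im_O j).rpow b) hs (by omega)

include hs in
theorem sum_re (h : Fam l s ζ A B m) (hn : (n : ℝ) ≠ 0) :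
    OO l s 4 fun i => ∑ j, (ζ i j).re + n * A * s i ^ 2 := by
  refine ((h.sum_xy hs 0).add (h.sq.const_mul (1 / 2))).congr fun i => ?_
  simp only [pow_zero, mul_one, zero_add, Finset.sum_const, Finset.card_univ, Fintype.card_fin,
    nsmul_eq_mul, rho]
  field_simp
  ring

-- Factor x² - (y²/2 - ρ s²)² as a difference of squares: one factor is O(s⁴), the other O(s²).
include hs in
theorem sum_re_sq (h : Fam l s ζ A B m) : OO l s 6 fun i => ∑ j, (ζ i j).re ^ 2
    - (∑ j, (ζ i j).im ^ 4) / 4 + 2 * rho n A B * ((n - 1) * B) * s i ^ 4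
    - n * rho n A B ^ 2 * s i ^ 4 := by
  have h1 : OO l s 6 fun i => ∑ j, ((ζ i j).re - (ζ i j).im ^ 2 / 2 + rho n A B * s i ^ 2) *
      ((ζ i j).re + (ζ i j).im ^ 2 / 2 - rho n A B * s i ^ 2) := by
    refine OO.sum fun j _ => (h.re_exp j).mul' (b := 2) ?_ hs (by norm_num)
    exact (((h.re_O hs j).add (((h.im_O j).rpow 2).const_mul (1 / 2))).sub
      (OO.self' hs (rho n A B) le_rfl)).congr fun i => by ring
  refine (h1.sub ((h.sq.mul' (OO.self 2) hs (by norm_num : 6 ≤ 4 + 2)).const_mul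
    (rho n A B))).congr fun i => ?_
  have e : ∑ j, ((ζ i j).re - (ζ i j).im ^ 2 / 2 + rho n A B * s i ^ 2) *
      ((ζ i j).re + (ζ i j).im ^ 2 / 2 - rho n A B * s i ^ 2) = ∑ j, (ζ i j).re ^ 2
      - (∑ j, (ζ i j).im ^ 4) / 4 + rho n A B * s i ^ 2 * ∑ j, (ζ i j).im ^ 2
      - n * rho n A B ^ 2 * s i ^ 4 := by
    have e0 : (n : ℝ) * rho n A B ^ 2 * s i ^ 4 = ∑ _j : Fin n, rho n A B ^ 2 * s i ^ 4 := by
      simp; ring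
    rw [e0, Finset.sum_div, Finset.mul_sum, ← Finset.sum_sub_distrib, ← Finset.sum_add_distrib,
      ← Finset.sum_sub_distrib]
    exact Finset.sum_congr rfl fun j _ => by ring
  rw [e]; ring

/-! #### Power sums -/

include hs in
theorem psum_one_re (h : Fam l s ζ A B m) (hn : (n : ℝ) ≠ 0) :
    OO l s 4 fun i => (esym (ζ i) 1).re - -(n * A) * s i ^ 2 :=
  (h.sum_re hs hn).congr fun i => by
    rw [esym_one, psum, Complex.re_sum]; simp only [pow_one]; ring

theorem esym_one_im (i : ι) : (esym (ζ i) 1).im = ∑ j, (ζ i j).im := by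
  rw [esym_one, psum, Complex.im_sum]; simp only [pow_one]

include hs hm in
theorem psum_one_im (h : Fam l s ζ A B m) : OO l s 3 fun i => (esym (ζ i) 1).im :=
  (h.im1' hs hm).congr fun i => esym_one_im i

include hs in
theorem psum_two_re (h : Fam l s ζ A B m) :
    OO l s 4 fun i => (psum (ζ i) 2).re - -(2 * ((n - 1) * B)) * s i ^ 2 := by
  refine ((h.mono_O hs 2 0 4 (by norm_num)).sub h.sq).congr fun i => ?_
  simp only [psum, Complex.re_sum, re_sq, pow_zero, mul_one, Finset.sum_sub_distrib]
  ring

include hs hm in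
theorem psum_two_im (h : Fam l s ζ A B m) :
    OO l s 5 fun i => (psum (ζ i) 2).im - ∑ j, (ζ i j).im ^ 3 := by
  refine (((h.sum_xy hs 1).sub (((OO.self' hs (rho n A B) le_rfl).mul' (h.im1' hs hm) hs
    (by norm_num : 4 + 1 ≤ 2 + 3)))).const_mul 2).congr fun i => ?_
  simp only [psum, Complex.im_sum, im_sq, pow_one, mul_assoc, ← Finset.mul_sum]
  ring

include hs in
theorem psum_three_re (h : Fam l s ζ A B m) :
    OO l s 6 fun i => (psum (ζ i) 3).re + 3 / 2 * ∑ j, (ζ i j).im ^ 4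
      - 6 * rho n A B * ((n - 1) * B) * s i ^ 4 := by
  have h1 := (h.sq.mul' (OO.self 2) hs (by norm_num : 6 ≤ 4 + 2)).const_mul (rho n A B)
  refine ((h.mono_O hs 3 0 6 (by norm_num)).sub (((h.sum_xy hs 2).sub h1).const_mul 3)).congr
    fun i => ?_
  simp only [psum, Complex.re_sum, re_cube, pow_zero, mul_one, Finset.sum_sub_distrib, mul_assoc,
    ← Finset.mul_sum]
  ring

include hs in
theorem psum_three_im (h : Fam l s ζ A B m) :
    OO l s 5 fun i => (psum (ζ i) 3).im + ∑ j, (ζ i j).im ^ 3 := by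
  refine ((h.mono_O hs 2 1 5 (by norm_num)).const_mul 3).congr fun i => ?_
  simp only [psum, Complex.im_sum, im_cube, pow_one, Finset.sum_sub_distrib, mul_assoc,
    ← Finset.mul_sum]
  ring

include hs in
theorem psum_four_re (h : Fam l s ζ A B m) :
    OO l s 6 fun i => (psum (ζ i) 4).re - ∑ j, (ζ i j).im ^ 4 := by
  refine ((h.mono_O hs 4 0 6 (by norm_num)).sub
    ((h.mono_O hs 2 2 6 (by norm_num)).const_mul 6)).congr fun i => ?_
  simp only [psum, Complex.re_sum, re_four, pow_zero, mul_one, Finset.sum_sub_distrib,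
    Finset.sum_add_distrib, mul_assoc, ← Finset.mul_sum]
  ring

include hs in
theorem psum_four_im (h : Fam l s ζ A B m) : OO l s 5 fun i => (psum (ζ i) 4).im := by
  refine (((h.mono_O hs 3 1 5 (by norm_num)).const_mul 4).sub
    ((h.mono_O hs 1 3 5 (by norm_num)).const_mul 4)).congr fun i => ?_
  simp only [psum, Complex.im_sum, im_four, pow_one, Finset.sum_sub_distrib,
    mul_assoc, ← Finset.mul_sum]

include hs in
theorem psum_five_re (h : Fam l s ζ A B m) : OO l s 6 fun i => (psum (ζ i) 5).re := by
  refine (((h.mono_O hs 5 0 6 (by norm_num)).sub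
    ((h.mono_O hs 3 2 6 (by norm_num)).const_mul 10)).add
    ((h.mono_O hs 1 4 6 (by norm_num)).const_mul 5)).congr fun i => ?_
  simp only [psum, Complex.re_sum, re_five, pow_one, pow_zero, mul_one, Finset.sum_sub_distrib,
    Finset.sum_add_distrib, mul_assoc, ← Finset.mul_sum]

include hs in
theorem sum_four_O (h : Fam l s ζ A B m) : OO l s 4 fun i => ∑ j, (ζ i j).im ^ 4 :=
  (h.mono_O hs 0 4 4 (by norm_num)).congr fun i => by simp

/-! #### Elementary symmetric functions -/

include hs in
theorem of_re_approx {f : ι → ℝ} {p : ℝ} (h : OO l s 4 fun i => f i - p * s i ^ 2) : OO l s 2 f :=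
  ((h.mono hs (by norm_num)).add (OO.self' hs p le_rfl)).congr fun i => by ring

include hs in
theorem of_im_approx {f g : ι → ℝ} (h : OO l s 5 fun i => f i - g i) (hg : OO l s 3 g) :
    OO l s 3 f :=
  ((h.mono hs (by norm_num)).add hg).congr fun i => by ring

include hs hm in
theorem esym_two_re (h : Fam l s ζ A B m) (hn : (n : ℝ) ≠ 0) :
    OO l s 4 fun i => (esym (ζ i) 2).re - (n - 1) * B * s i ^ 2 := by
  have h1 := of_re_approx hs (h.psum_one_re hs hn)
  have h2 := h1.mul_re hs h1 (h.psum_one_im hs hm) (h.psum_one_im hs hm)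
    (by norm_num : 4 ≤ 2 + 2) (by norm_num)
  refine ((h2.sub (h.psum_two_re hs)).const_mul (1 / 2)).congr fun i => ?_
  have : (esym (ζ i) 2).re = ((esym (ζ i) 1 * esym (ζ i) 1).re - (psum (ζ i) 2).re) / 2 := by
    rw [esym_two, pow_two, Complex.div_ofNat_re, Complex.sub_re]
  rw [this]; ring

include hs hm in
theorem esym_two_im (h : Fam l s ζ A B m) (hn : (n : ℝ) ≠ 0) :
    OO l s 5 fun i => (esym (ζ i) 2).im - -(1 / 2) * ∑ j, (ζ i j).im ^ 3 := by
  have h1 := of_re_approx hs (h.psum_one_re hs hn)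
  have h2 := h1.mul_im hs h1 (h.psum_one_im hs hm) (h.psum_one_im hs hm)
    (by norm_num : 5 ≤ 2 + 3) (by norm_num)
  refine ((h2.sub (h.psum_two_im hs hm)).const_mul (1 / 2)).congr fun i => ?_
  have : (esym (ζ i) 2).im = ((esym (ζ i) 1 * esym (ζ i) 1).im - (psum (ζ i) 2).im) / 2 := by
    rw [esym_two, pow_two, Complex.div_ofNat_im, Complex.sub_im]
  rw [this]; ring

include hs hm in
theorem esym_two_im' (h : Fam l s ζ A B m) (hn : (n : ℝ) ≠ 0) :
    OO l s 3 fun i => (esym (ζ i) 2).im :=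
  of_im_approx hs (h.esym_two_im hs hm hn) ((h.im3' hs hm).const_mul _)

include hs hm in
theorem psum_two_im' (h : Fam l s ζ A B m) : OO l s 3 fun i => (psum (ζ i) 2).im :=
  of_im_approx hs (h.psum_two_im hs hm) (h.im3' hs hm)

include hs in
theorem psum_three_re' (h : Fam l s ζ A B m) : OO l s 4 fun i => (psum (ζ i) 3).re :=
  ((((h.psum_three_re hs).mono hs (by norm_num)).sub ((h.sum_four_O hs).const_mul (3 / 2))).add
    (OO.self' hs (6 * rho n A B * ((n - 1) * B)) le_rfl)).congr fun i => by ring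

include hs hm in
theorem psum_three_im' (h : Fam l s ζ A B m) : OO l s 3 fun i => (psum (ζ i) 3).im :=
  (((h.psum_three_im hs).mono hs (by norm_num)).sub (h.im3' hs hm)).congr fun i => by ring

theorem re_div3 (a b c : ℂ) : ((a - b + c) / 3).re = (a.re - b.re + c.re) / 3 := by
  rw [Complex.div_ofNat_re, Complex.add_re, Complex.sub_re]

theorem im_div3 (a b c : ℂ) : ((a - b + c) / 3).im = (a.im - b.im + c.im) / 3 := by
  rw [Complex.div_ofNat_im, Complex.add_im, Complex.sub_im]

-- Re e₁ and Re e₂ are only needed modulo s⁴ here, because their corrections are later eliminated by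
-- duality. From e₃ on, real parts must be known modulo s⁶. There ∑ y_j⁴ enters through e₃ and e₄
-- and is the only quantity not determined by A and B.
include hs hm in
theorem esym_three_re (h : Fam l s ζ A B m) (hn : (n : ℝ) ≠ 0) :
    OO l s 6 fun i => (esym (ζ i) 3).re + 1 / 2 * ∑ j, (ζ i j).im ^ 4
      - (-(n * A) * ((n - 1) * B) + 2 * rho n A B * ((n - 1) * B)) * s i ^ 4 := by
  have h1 := OO.re_mul_approx hs (h.esym_two_re hs hm hn) (h.psum_one_re hs hn)
    (h.esym_two_im' hs hm hn) (h.psum_one_im hs hm)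
  have h2 := OO.re_mul_approx hs (h.psum_one_re hs hn) (h.psum_two_re hs)
    (h.psum_one_im hs hm) (h.psum_two_im' hs hm)
  refine (((h1.sub h2).add (h.psum_three_re hs)).const_mul (1 / 3)).congr fun i => ?_
  rw [esym_three, re_div3]; ring

include hs hm in
theorem esym_three_im (h : Fam l s ζ A B m) (hn : (n : ℝ) ≠ 0) :
    OO l s 5 fun i => (esym (ζ i) 3).im - -(1 / 3) * ∑ j, (ζ i j).im ^ 3 := by
  have p1 := of_re_approx hs (h.psum_one_re hs hn)
  have p2 := of_re_approx hs (h.psum_two_re hs)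
  have q2 := of_re_approx hs (h.esym_two_re hs hm hn)
  have h1 := q2.mul_im hs p1 (h.esym_two_im' hs hm hn) (h.psum_one_im hs hm)
    (by norm_num : 5 ≤ 2 + 3) (by norm_num)
  have h2 := p1.mul_im hs p2 (h.psum_one_im hs hm) (h.psum_two_im' hs hm)
    (by norm_num : 5 ≤ 2 + 3) (by norm_num)
  refine (((h1.sub h2).add (h.psum_three_im hs)).const_mul (1 / 3)).congr fun i => ?_
  rw [esym_three, im_div3]; ring

include hs hm in
theorem esym_three_re' (h : Fam l s ζ A B m) (hn : (n : ℝ) ≠ 0) :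
    OO l s 4 fun i => (esym (ζ i) 3).re :=
  ((((h.esym_three_re hs hm hn).mono hs (by norm_num)).sub
    ((h.sum_four_O hs).const_mul (1 / 2))).add (OO.self' hs
    (-(n * A) * ((n - 1) * B) + 2 * rho n A B * ((n - 1) * B)) le_rfl)).congr fun i => by ring

include hs hm in
theorem esym_three_im' (h : Fam l s ζ A B m) (hn : (n : ℝ) ≠ 0) :
    OO l s 3 fun i => (esym (ζ i) 3).im :=
  of_im_approx hs (h.esym_three_im hs hm hn) ((h.im3' hs hm).const_mul _)

theorem re_div4 (a b c d : ℂ) :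
    ((a - b + c - d) / 4).re = (a.re - b.re + c.re - d.re) / 4 := by
  rw [Complex.div_ofNat_re, Complex.sub_re, Complex.add_re, Complex.sub_re]

theorem im_div4 (a b c d : ℂ) :
    ((a - b + c - d) / 4).im = (a.im - b.im + c.im - d.im) / 4 := by
  rw [Complex.div_ofNat_im, Complex.sub_im, Complex.add_im, Complex.sub_im]

include hs hm in
theorem esym_four_re (h : Fam l s ζ A B m) (hn : (n : ℝ) ≠ 0) :
    OO l s 6 fun i => (esym (ζ i) 4).re + 1 / 4 * ∑ j, (ζ i j).im ^ 4
      - ((n - 1) * B) ^ 2 / 2 * s i ^ 4 := by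
  have p1 := of_re_approx hs (h.psum_one_re hs hn)
  have h1 := (h.esym_three_re' hs hm hn).mul_re hs p1 (h.esym_three_im' hs hm hn)
    (h.psum_one_im hs hm) (by norm_num : 6 ≤ 4 + 2) (by norm_num)
  have h2 := OO.re_mul_approx hs (h.esym_two_re hs hm hn) (h.psum_two_re hs)
    (h.esym_two_im' hs hm hn) (h.psum_two_im' hs hm)
  have h3 := p1.mul_re hs (h.psum_three_re' hs) (h.psum_one_im hs hm) (h.psum_three_im' hs hm)
    (by norm_num : 6 ≤ 2 + 4) (by norm_num)
  refine ((((h1.sub h2).add h3).sub (h.psum_four_re hs)).const_mul (1 / 4)).congr fun i => ?_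
  rw [esym_four, re_div4]; ring

include hs in
theorem psum_four_re' (h : Fam l s ζ A B m) : OO l s 4 fun i => (psum (ζ i) 4).re :=
  (((h.psum_four_re hs).mono hs (by norm_num)).add (h.sum_four_O hs)).congr fun i => by ring

include hs hm in
theorem esym_four_im (h : Fam l s ζ A B m) (hn : (n : ℝ) ≠ 0) :
    OO l s 5 fun i => (esym (ζ i) 4).im := by
  have p1 := of_re_approx hs (h.psum_one_re hs hn)
  have p2 := of_re_approx hs (h.psum_two_re hs)
  have q2 := of_re_approx hs (h.esym_two_re hs hm hn)
  have h1 := (h.esym_three_re' hs hm hn).mul_im hs p1 (h.esym_three_im' hs hm hn)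
    (h.psum_one_im hs hm) (by norm_num : 5 ≤ 4 + 3) (by norm_num)
  have h2 := q2.mul_im hs p2 (h.esym_two_im' hs hm hn) (h.psum_two_im' hs hm)
    (by norm_num : 5 ≤ 2 + 3) (by norm_num)
  have h3 := p1.mul_im hs (h.psum_three_re' hs) (h.psum_one_im hs hm) (h.psum_three_im' hs hm)
    (by norm_num : 5 ≤ 2 + 3) (by norm_num)
  refine ((((h1.sub h2).add h3).sub (h.psum_four_im hs)).const_mul (1 / 4)).congr fun i => ?_
  rw [esym_four, im_div4]; ring

include hs in
theorem esym_O (h : Fam l s ζ A B m) (k : ℕ) : OO l s k fun i => esym (ζ i) k := by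
  simpa using OO.esym (h.O_one hs) k

include hs hm in
theorem esym_five_re (h : Fam l s ζ A B m) (hn : (n : ℝ) ≠ 0) :
    OO l s 6 fun i => (esym (ζ i) 5).re := by
  have p1 := of_re_approx hs (h.psum_one_re hs hn)
  have p2 := of_re_approx hs (h.psum_two_re hs)
  have q2 := of_re_approx hs (h.esym_two_re hs hm hn)
  have h1 := ((h.esym_O hs 4).re).mul_re hs p1 (h.esym_four_im hs hm hn)
    (h.psum_one_im hs hm) (by norm_num : 6 ≤ 4 + 2) (by norm_num)
  have h2 := (h.esym_three_re' hs hm hn).mul_re hs p2 (h.esym_three_im' hs hm hn)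
    (h.psum_two_im' hs hm) (by norm_num : 6 ≤ 4 + 2) (by norm_num)
  have h3 := q2.mul_re hs (h.psum_three_re' hs) (h.esym_two_im' hs hm hn)
    (h.psum_three_im' hs hm) (by norm_num : 6 ≤ 2 + 4) (by norm_num)
  have h4 := p1.mul_re hs (h.psum_four_re' hs) (h.psum_one_im hs hm) (h.psum_four_im hs)
    (by norm_num : 6 ≤ 2 + 4) (by norm_num)
  refine (((((h1.sub h2).add h3).sub h4).add (h.psum_five_re hs)).const_mul (1 / 5)).congr
    fun i => ?_
  rw [esym_five, Complex.div_ofNat_re, Complex.add_re, Complex.sub_re, Complex.add_re,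
    Complex.sub_re]
  ring

end Fam

end Family

/-! ### The modulus of a root to second order -/

section Constraint

variable {ι : Type*} {l : Filter ι} {s : ι → ℝ} {n m : ℕ} {ζ : ι → Fin n → ℂ} {A B : ℝ}

/-- The second order coefficient of the modulus of a root due to the first order motion. -/
noncomputable def conK (n : ℕ) (A B u : ℝ) : ℝ :=
  n / 2
  - n * A * (1 - (u * (1 + A * (u - 1) + 2 * B * (u ^ 2 - 1)) - (1 - u ^ 2) * (A + 2 * B * u)))
  - (n - 1) * B * (1 - ((2 * u ^ 2 - 1) * (1 + A * (u - 1) + 2 * B * (u ^ 2 - 1))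
      - 2 * u * (1 - u ^ 2) * (A + 2 * B * u)))
  + (n + 1) / 2 * ((1 + A * (u - 1) + 2 * B * (u ^ 2 - 1)) ^ 2 + (1 - u ^ 2) * (A + 2 * B * u) ^ 2)

/-- The coefficient of the fourth power sum in the modulus of a root. -/
noncomputable def conQ (n : ℕ) (u : ℝ) : ℝ :=
  (1 - u) * (1 + 2 * u) ^ 2 / (2 * (n - 2)) - 2 * u ^ 2 * (1 - u ^ 2) / (n - 3)

/-- The coefficient of `s ^ 4` in the modulus of a root. -/
noncomputable def conS (n : ℕ) (A B u : ℝ) : ℝ :=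
  conK n A B u - (1 - u) * (1 + 2 * u) ^ 2 * ((n - 1) * B * (2 * rho n A B - n * A)) / (n - 2)
    + 4 * u ^ 2 * (1 - u ^ 2) * ((n - 1) * B) ^ 2 / (n - 3)

/-- The contribution of the imaginary parts of the symmetric functions to the modulus. -/
noncomputable def conJ (ζ : Fin n → ℂ) (u : ℝ) : ℝ :=
  (esym ζ 1).im / n - 2 * u * (esym ζ 2).im / (n - 1) + (4 * u ^ 2 - 1) * (esym ζ 3).im / (n - 2)
    - (8 * u ^ 3 - 4 * u) * (esym ζ 4).im / (n - 3)
    + (16 * u ^ 4 - 12 * u ^ 2 + 1) * (esym ζ 5).im / (n - 4)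

theorem cf_eq (ζ : Fin n → ℂ) (k : ℕ) :
    cf ζ k = (((-1) ^ (k + 1) * (n + 1) / (n + 1 - k) : ℝ) : ℂ) * esym ζ k := by
  rw [cf]; push_cast; ring

theorem re_ofReal_mul_mul (a : ℝ) (e p : ℂ) :
    (a * e * (p - 1)).re = a * (e.re * (p.re - 1) - e.im * p.im) := by
  simp [Complex.mul_re, Complex.mul_im]; ring

theorem cf_OO {a k : ℕ} (h : OO l s a fun i => esym (ζ i) k) : OO l s a fun i => cf (ζ i) k :=
  (h.const_mul _).congr fun _ => cf_eq _ _

/-- Extending the range to n + 6 adds only zeros and makes the first five terms available for every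
n, including n = 3 and n = 4. -/
theorem sum_cf_split (ζ : Fin n → ℂ) (o : ℂ) : ∑ k ∈ Finset.Icc 1 n, cf ζ k * (o ^ k - 1) =
    cf ζ 1 * (o - 1) + cf ζ 2 * (o ^ 2 - 1) + cf ζ 3 * (o ^ 3 - 1) + cf ζ 4 * (o ^ 4 - 1)
      + cf ζ 5 * (o ^ 5 - 1) + ∑ k ∈ Finset.Icc 6 (n + 6), cf ζ k * (o ^ k - 1) := by
  have h1 : ∑ k ∈ Finset.Icc 1 n, cf ζ k * (o ^ k - 1) =
      ∑ k ∈ Finset.Icc 1 (n + 6), cf ζ k * (o ^ k - 1) := by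
    refine Finset.sum_subset (Finset.Icc_subset_Icc_right (by omega)) fun k _ hk => ?_
    rw [Finset.mem_Icc, not_and_or] at hk
    rw [cf_eq_zero ζ (by rw [Finset.mem_Icc] at *; omega), zero_mul]
  rw [h1]
  iterate 5
    rw [← Finset.add_sum_Ioc_eq_sum_Icc (by omega), ← Finset.Icc_add_one_left_eq_Ioc]
  norm_num
  ring

/-- With these coefficients `dir` equals -(n+1)w, where w = 1 + A(o-1) + B(o²-1). Its real part is
the slack 1 - A(1-u) - 2B(1-u²) of the linear program, and its imaginary part is (A + 2Bu) Im o. The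
half norm square comes from (|Z|² - 1)/2 = Re(Z-1) + |Z-1|²/2. -/
theorem re_quad {o : ℂ} (ho : o.re ^ 2 + o.im ^ 2 = 1) :
    (quad n (-(n + 1) * A) (-(n + 1) * B) o).re
      + Complex.normSq (dir n (-(n + 1) * A) (-(n + 1) * B) o) / 2 =
    (n + 1) * conK n A B o.re := by
  have hd : dir n (-(n + 1) * A) (-(n + 1) * B) o =
      ((-(n + 1) : ℝ) : ℂ) * (1 + A * (o - 1) + B * (o ^ 2 - 1)) := by
    rw [dir]; push_cast; ring
  have hn1 : (n : ℂ) + 1 ≠ 0 := by exact_mod_cast n.succ_ne_zero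
  set w : ℂ := 1 + A * (o - 1) + B * (o ^ 2 - 1) with hw
  have hq : quad n (-(n + 1) * A) (-(n + 1) * B) o = (((n + 1) * n / 2 : ℝ) : ℂ)
      + ((-(n + 1) * A * n : ℝ) : ℂ) * (1 - o * w)
      + ((-(n + 1) * B * (n - 1) : ℝ) : ℂ) * (1 - o ^ 2 * w) := by
    rw [quad, hd]; push_cast; field_simp; ring
  have hv : o.im ^ 2 = 1 - o.re ^ 2 := by linarith
  have w1 : w.re = 1 + A * (o.re - 1) + 2 * B * (o.re ^ 2 - 1) := by
    simp [hw, re_sq, hv, Complex.mul_re]; ring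
  have w2 : w.im = o.im * (A + 2 * B * o.re) := by
    simp [hw, im_sq, Complex.mul_im]; ring
  rw [hq, hd, map_mul, Complex.normSq_ofReal, Complex.normSq_apply]
  simp only [Complex.add_re, Complex.ofReal_re, Complex.re_ofReal_mul, Complex.sub_re,
    Complex.one_re]
  simp only [Complex.mul_re, re_sq, im_sq, w1, w2, conK]
  linear_combination ((n + 1 : ℝ) ^ 2 * (A + 2 * B * o.re) ^ 2 / 2
    - (n + 1) * A * n * (A + 2 * B * o.re)
    - (n + 1) * B * (n - 1) * (1 + A * (o.re - 1) + 2 * B * (o.re ^ 2 - 1)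
      + 2 * o.re * (A + 2 * B * o.re))) * hv

/-- Apply |Z|² - 1 = 2 Re(Z-1) + |Z-1|² to Z = z^(n+1), whose deviation from 1 is known to second
order. The real parts of e₁ and e₂ and the odd part `conJ` are left unexpanded; the real parts of e₃
and e₄ turn into ∑ y_j⁴ and s⁴, and Re e₅ is negligible. -/
theorem con_expansion (h : Fam l s ζ A B m) (hs : Tendsto s l (𝓝 0)) (hm5 : 5 ≤ m) (hm6 : m ≤ 6)
    (hn : 3 ≤ n) {ω : ℂ} (hω : ω ^ (n + 1) = 1) (hω1 : ω.re ^ 2 + ω.im ^ 2 = 1) {z : ι → ℂ}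
    (hz : Tendsto z l (𝓝 ω)) (hr : RootEq n s (fun k i => cf (ζ i) k) z) :
    OO l s m fun i => (Complex.normSq (z i ^ (n + 1)) - 1) / (2 * (n + 1)) -
      (- s i ^ 2 + -(esym (ζ i) 1).re / n * (1 - ω.re)
        + 2 * ((esym (ζ i) 2).re / (n - 1)) * (1 - ω.re ^ 2) + ω.im * conJ (ζ i) ω.re
        + conQ n ω.re * ∑ j, (ζ i j).im ^ 4 + conS n A B ω.re * s i ^ 4) := by
  have hnR : (n : ℝ) ≠ 0 := by positivity
  have hn1R : (n : ℝ) + 1 ≠ 0 := by positivity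
  have hn3R : (3 : ℝ) ≤ n := by exact_mod_cast hn
  set o : ℂ := (starRingEnd ℂ) ω with ho
  have hoω : o * ω = 1 := by
    rw [mul_comm, ho, Complex.mul_conj, Complex.normSq_apply]
    have : ω.re * ω.re + ω.im * ω.im = 1 := by nlinarith
    rw [this, Complex.ofReal_one]
  have ore : o.re = ω.re := Complex.conj_re ω
  have oim : o.im = -ω.im := Complex.conj_im ω
  have hor : o.re ^ 2 + o.im ^ 2 = 1 := by rw [ore, oim]; linarith
  have him2 : OO l s (m - 2) fun i => (esym (ζ i) 2).im :=
    (((h.esym_two_im hs hm5 hnR).mono hs (by omega)).add (h.im3.const_mul (-(1 / 2)))).congr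
      fun i => by ring
  have him3 : OO l s (m - 2) fun i => (esym (ζ i) 3).im :=
    (((h.esym_three_im hs hm5 hnR).mono hs (by omega)).add (h.im3.const_mul (-(1 / 3)))).congr
      fun i => by ring
  have e1 : OO l s (m - 2) fun i => esym (ζ i) 1 - ((-(n * A) : ℝ) : ℂ) * (s i : ℂ) ^ 2 := by
    refine OO.of_re_im (((h.psum_one_re hs hnR).mono hs (by omega)).congr fun i => ?_)
      (h.im1.congr fun i => ?_)
    · rw [← Complex.ofReal_pow, ← Complex.ofReal_mul, Complex.sub_re, Complex.ofReal_re]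
    · rw [← Complex.ofReal_pow, ← Complex.ofReal_mul, Complex.sub_im, Complex.ofReal_im, sub_zero,
        Fam.esym_one_im]
  have e2 : OO l s (m - 2) fun i => esym (ζ i) 2 - (((n - 1) * B : ℝ) : ℂ) * (s i : ℂ) ^ 2 := by
    refine OO.of_re_im (((h.esym_two_re hs hm5 hnR).mono hs (by omega)).congr fun i => ?_)
      (him2.congr fun i => ?_)
    · rw [← Complex.ofReal_pow, ← Complex.ofReal_mul, Complex.sub_re, Complex.ofReal_re]
    · rw [← Complex.ofReal_pow, ← Complex.ofReal_mul, Complex.sub_im, Complex.ofReal_im, sub_zero]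
  have hnC : (n : ℂ) ≠ 0 := by exact_mod_cast hnR
  have hnC1 : (n : ℂ) - 1 ≠ 0 := by
    have : (n : ℝ) - 1 ≠ 0 := by linarith
    exact_mod_cast this
  have hc1 : OO l s (m - 2) fun i => cf (ζ i) 1 - ((-(n + 1) * A : ℝ) : ℂ) * (s i : ℂ) ^ 2 := by
    refine (e1.const_mul (((n : ℂ) + 1) / n)).congr fun i => ?_
    rw [cf]; push_cast
    rw [show (n : ℂ) + 1 - 1 = n by ring]
    field_simp
    try ring
  have hc2 : OO l s (m - 2) fun i => cf (ζ i) 2 - ((-(n + 1) * B : ℝ) : ℂ) * (s i : ℂ) ^ 2 := by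
    refine (e2.const_mul (-((n : ℂ) + 1) / (n - 1))).congr fun i => ?_
    rw [cf]; push_cast
    rw [show (n : ℂ) + 1 - 2 = n - 1 by ring]
    field_simp
    ring
  have hck : ∀ k, 3 ≤ k → OO l s (m - 2) fun i => cf (ζ i) k := by
    intro k hk
    refine cf_OO ?_
    rcases (by omega : k = 3 ∨ 4 ≤ k) with rfl | hk
    · exact OO.of_re_im ((h.esym_three_re' hs hm5 hnR).mono hs (by omega)) him3
    · exact (h.esym_O hs k).mono hs (by omega)
  obtain ⟨hd, hg⟩ := root_second_order hm5 hm6 hn hs hoω hω hz hr (γ₁ := -(n + 1) * A)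
    (γ₂ := -(n + 1) * B) (by simpa using hc1) (by simpa using hc2) hck
  have hns : OO l s m fun i => Complex.normSq (z i ^ (n + 1) - 1)
      - Complex.normSq (dir n (-(n + 1) * A) (-(n + 1) * B) o) * s i ^ 4 := by
    set D := dir n (-(n + 1) * A) (-(n + 1) * B) o with hD
    have a1 := hd.normSq.mono hs (by omega : m ≤ m - 2 + (m - 2))
    have a2 := (hd.re.mul' (OO.self 2) hs (by omega : m ≤ m - 2 + 2)).const_mul (2 * D.re)
    have a3 := (hd.im.mul' (OO.self 2) hs (by omega : m ≤ m - 2 + 2)).const_mul (2 * D.im)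
    refine ((a1.add a2).add a3).congr fun i => ?_
    have r1 : (D * (s i : ℂ) ^ 2).re = D.re * s i ^ 2 := by
      rw [← Complex.ofReal_pow, Complex.re_mul_ofReal]
    have r2 : (D * (s i : ℂ) ^ 2).im = D.im * s i ^ 2 := by
      rw [← Complex.ofReal_pow, Complex.im_mul_ofReal]
    simp only [Complex.normSq_apply, Complex.sub_re _ (D * _), Complex.sub_im _ (D * _), r1, r2]
    ring
  have hrest : OO l s 6 fun i => (∑ k ∈ Finset.Icc 6 (n + 6), cf (ζ i) k * (o ^ k - 1)).re := by
    refine OO.re (OO.sum fun k hk => ?_)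
    exact ((cf_OO (h.esym_O hs k)).mono hs (Finset.mem_Icc.1 hk).1).mul_const _
  have h5 := (h.esym_five_re hs hm5 hnR).const_mul ((n + 1) / (n - 4) * ((o ^ 5).re - 1))
  have h4 := (h.esym_four_re hs hm5 hnR).const_mul (-(n + 1) / (n - 3) * ((o ^ 4).re - 1))
  have h3 := (h.esym_three_re hs hm5 hnR).const_mul ((n + 1) / (n - 2) * ((o ^ 3).re - 1))
  have hre := hg.re
  have htot := ((hre.add (hns.const_mul (1 / 2))).add
    ((((hrest.add h5).add h4).add h3).mono hs hm6)).const_mul (1 / (n + 1))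
  refine htot.congr fun i => ?_
  have hq := re_quad (n := n) (A := A) (B := B) hor
  have hsq4 : ∀ w : ℂ, (w * (s i : ℂ) ^ 4).re = w.re * s i ^ 4 := fun w => by
    rw [← Complex.ofReal_pow, Complex.re_mul_ofReal]
  have hsq2 : (((n : ℂ) + 1) * (s i : ℂ) ^ 2).re = (n + 1) * s i ^ 2 := by
    rw [← Complex.ofReal_pow, Complex.re_mul_ofReal]; simp
  have hZ : Complex.normSq (z i ^ (n + 1)) - 1 =
      2 * (z i ^ (n + 1) - 1).re + Complex.normSq (z i ^ (n + 1) - 1) := by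
    simp only [Complex.normSq_apply, Complex.sub_re, Complex.sub_im, Complex.one_re, Complex.one_im]
    ring
  have hv : o.im ^ 2 = 1 - o.re ^ 2 := by linarith
  have hr2 : (o ^ 2).re = 2 * o.re ^ 2 - 1 := by rw [re_sq]; linarith
  have hr3 : (o ^ 3).re = 4 * o.re ^ 3 - 3 * o.re := by rw [re_cube, hv]; ring
  have hr4 : (o ^ 4).re = 8 * o.re ^ 4 - 8 * o.re ^ 2 + 1 := by
    rw [re_four, show o.im ^ 4 = (o.im ^ 2) ^ 2 by ring, hv]; ring
  -- Im o^k / Im o is the Chebyshev polynomial U_(k-1) evaluated at Re o; these are the coefficients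
  -- in `conJ`.
  have hi2 : (o ^ 2).im = 2 * o.re * o.im := im_sq o
  have hi3 : (o ^ 3).im = (4 * o.re ^ 2 - 1) * o.im := by
    rw [im_cube]; linear_combination (-o.im) * hv
  have hi4 : (o ^ 4).im = (8 * o.re ^ 3 - 4 * o.re) * o.im := by
    rw [im_four]; linear_combination (-4 * o.re * o.im) * hv
  have hi5 : (o ^ 5).im = (16 * o.re ^ 4 - 12 * o.re ^ 2 + 1) * o.im := by
    rw [im_five]
    linear_combination (-10 * o.re ^ 2 * o.im + o.im * (o.im ^ 2 + 1 - o.re ^ 2)) * hv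
  rw [hZ, sum_cf_split]
  simp only [Complex.sub_re _ (_ * (s i : ℂ) ^ 4), hsq4,
    Complex.sub_re _ (_ + _ : ℂ), Complex.add_re _ (_ * (s i : ℂ) ^ 2), hsq2,
    Complex.add_re _ (Finset.sum _ _), Complex.add_re _ (cf _ _ * _)]
  simp only [cf_eq (ζ i) 1, cf_eq (ζ i) 2, cf_eq (ζ i) 3, cf_eq (ζ i) 4, cf_eq (ζ i) 5,
    re_ofReal_mul_mul]
  rw [hr2, hr3, hr4, hi2, hi3, hi4, hi5, conJ, conQ, conS, ← ore,
    show ω.im = -o.im by rw [oim, neg_neg]]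
  have hK : conK n A B o.re = ((quad n (-(n + 1) * A) (-(n + 1) * B) o).re
      + Complex.normSq (dir n (-(n + 1) * A) (-(n + 1) * B) o) / 2) / (n + 1) := by
    rw [hq]; field_simp
  rw [hK]
  push_cast
  have n2 : (n : ℝ) - 2 ≠ 0 := by linarith
  have n1 : (n : ℝ) - 1 ≠ 0 := by linarith
  rw [show (n : ℝ) + 1 - 1 = n by ring, show (n : ℝ) + 1 - 2 = n - 1 by ring,
    show (n : ℝ) + 1 - 3 = n - 2 by ring, show (n : ℝ) + 1 - 4 = n - 3 by ring,
    show (n : ℝ) + 1 - 5 = n - 4 by ring]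
  -- For n = 3 or n = 4 one of these denominators is 0 and its inverse is 0 by convention. The
  -- identity is linear in both inverses, with the same convention in `cf`, so they can be treated
  -- as free variables.
  simp only [div_eq_mul_inv _ ((n : ℝ) - 3), div_eq_mul_inv _ ((n : ℝ) - 4)]
  generalize ((n : ℝ) - 3)⁻¹ = w3
  generalize ((n : ℝ) - 4)⁻¹ = w4
  field_simp
  ring

end Constraint

/-! ### The two active roots of unity -/

section Trig

variable {n : ℕ}

theorem k_eq (n : ℕ) : k n = (((n + 1) / 3 : ℕ) : ℤ) := by
  rw [k, Int.floor_eq_iff]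
  have h1 : 3 * ((n + 1) / 3) ≤ n + 1 := Nat.mul_div_le _ _
  have h2 : n + 1 < 3 * ((n + 1) / 3) + 3 := by omega
  have h1' : (3 : ℝ) * (((n + 1) / 3 : ℕ) : ℝ) ≤ n + 1 := by exact_mod_cast h1
  have h2' : (n : ℝ) + 1 < 3 * (((n + 1) / 3 : ℕ) : ℝ) + 3 := by exact_mod_cast h2
  rw [Int.cast_natCast]
  constructor <;> linarith

/-- The angle of the `j`-th root of unity of order `n + 1`. -/
noncomputable def ang (n j : ℕ) : ℝ := 2 * Real.pi * j / (n + 1)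

theorem u₁_eq (n : ℕ) : u₁ n = Real.cos (ang n ((n + 1) / 3)) := by
  rw [u₁, k_eq, Int.cast_natCast, ang]

theorem u₂_eq (n : ℕ) : u₂ n = Real.cos (ang n ((n + 1) / 3 + 1)) := by
  rw [u₂, k_eq, Int.cast_natCast, ang]; push_cast; rfl

theorem ang_lt {i j : ℕ} (h : i < j) : ang n i < ang n j := by
  have hn : (0 : ℝ) < n + 1 := by positivity
  have : (i : ℝ) < j := by exact_mod_cast h
  unfold ang
  have := Real.pi_pos
  gcongr

theorem ang_nonneg (j : ℕ) : 0 ≤ ang n j := by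
  unfold ang; have := Real.pi_pos; positivity

theorem ang_le_pi {j : ℕ} (h : 2 * j ≤ n + 1) : ang n j ≤ Real.pi := by
  have hn : (0 : ℝ) < n + 1 := by positivity
  have : (2 : ℝ) * j ≤ n + 1 := by exact_mod_cast h
  rw [ang, div_le_iff₀ hn]
  nlinarith [Real.pi_pos]

theorem cos_ang_lt {i j : ℕ} (h : i < j) (hj : 2 * j ≤ n + 1) :
    Real.cos (ang n j) < Real.cos (ang n i) :=
  Real.cos_lt_cos_of_nonneg_of_le_pi (ang_nonneg i) (ang_le_pi hj) (ang_lt h)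

theorem cos_ang_symm {j : ℕ} (hj : j ≤ n + 1) :
    Real.cos (ang n (n + 1 - j)) = Real.cos (ang n j) := by
  have : ang n (n + 1 - j) = 2 * Real.pi - ang n j := by
    have hn : (n : ℝ) + 1 ≠ 0 := by positivity
    rw [ang, ang, Nat.cast_sub hj]; push_cast; field_simp
  rw [this, Real.cos_two_pi_sub]

/-- The abscissa at which the linear program is evaluated. -/
noncomputable def ustar (n : ℕ) : ℝ := -(n + 1) / (2 * n)

theorem u₁_ge (n : ℕ) : -1 / 2 ≤ u₁ n := by
  have h3 : Real.cos (2 * Real.pi / 3) = -1 / 2 := by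
    have : 2 * Real.pi / 3 = Real.pi - Real.pi / 3 := by ring
    rw [this, Real.cos_pi_sub, Real.cos_pi_div_three]; norm_num
  rw [u₁_eq, ← h3]
  refine Real.cos_le_cos_of_nonneg_of_le_pi (ang_nonneg _) (by linarith [Real.pi_pos]) ?_
  have hn : (0 : ℝ) < n + 1 := by positivity
  have h1 : (3 : ℝ) * (((n + 1) / 3 : ℕ) : ℝ) ≤ n + 1 := by
    exact_mod_cast Nat.mul_div_le (n + 1) 3
  rw [ang, div_le_div_iff₀ hn (by norm_num)]
  nlinarith [Real.pi_pos]

theorem ustar_lt_u₁ (hn : 3 ≤ n) : ustar n < u₁ n := by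
  refine lt_of_lt_of_le ?_ (u₁_ge n)
  have h3 : (3 : ℝ) ≤ n := by exact_mod_cast hn
  rw [ustar, div_lt_div_iff₀ (by positivity) (by norm_num)]
  linarith

/-- The angle of u₂ exceeds 2π/3 by at least φ = 2π/(3(n+1)), because it is the first multiple of
2π/(n+1) beyond 2π/3. At 2π/3 + φ the cosine has dropped below -1/2 by about (√3/2)φ, and 1/(2n) ≤
0.33 φ is enough room. For n ≥ 3 one has φ ≤ 0.525. -/
theorem u₂_lt_ustar (hn : 3 ≤ n) : u₂ n < ustar n := by
  have h3 : (3 : ℝ) ≤ n := by exact_mod_cast hn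
  set φ : ℝ := 2 * Real.pi / (3 * (n + 1)) with hφ
  have hN : (0 : ℝ) < n + 1 := by positivity
  have hπ := Real.pi_gt_d2
  have hπ' := Real.pi_lt_d2
  have hφN : φ * (n + 1) = 2 * Real.pi / 3 := by rw [hφ]; field_simp
  have hφ0 : 0 < φ := by rw [hφ]; positivity
  have hφ1 : φ ≤ 0.525 := by nlinarith
  have h1 : u₂ n ≤ Real.cos (2 * Real.pi / 3 + φ) := by
    rw [u₂_eq]
    have hj : 2 * ((n + 1) / 3 + 1) ≤ n + 1 := by omega
    refine Real.cos_le_cos_of_nonneg_of_le_pi (by positivity) (ang_le_pi hj) ?_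
    have h2 : (n : ℝ) + 1 + 1 ≤ 3 * (((n + 1) / 3 + 1 : ℕ) : ℝ) := by
      have : n + 1 + 1 ≤ 3 * ((n + 1) / 3 + 1) := by omega
      exact_mod_cast this
    have e : 2 * Real.pi / 3 + φ = 2 * Real.pi * ((n + 1 + 1) / 3) / (n + 1) := by
      rw [hφ]; field_simp
    rw [e, ang]
    have : ((n : ℝ) + 1 + 1) / 3 ≤ (((n + 1) / 3 + 1 : ℕ) : ℝ) := by linarith
    gcongr
  refine lt_of_le_of_lt h1 ?_
  have e2 : Real.cos (2 * Real.pi / 3 + φ) = -(1 / 2) * Real.cos φ - √3 / 2 * Real.sin φ := by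
    have : 2 * Real.pi / 3 = Real.pi - Real.pi / 3 := by ring
    rw [Real.cos_add, this, Real.cos_pi_sub, Real.sin_pi_sub, Real.cos_pi_div_three,
      Real.sin_pi_div_three]
  rw [e2]
  have hs3 : (1.73 : ℝ) ≤ √3 := Real.le_sqrt_of_sq_le (by norm_num)
  have hc := Real.one_sub_sq_div_two_le_cos (x := φ)
  have hs := Real.sin_gt_sub_cube hφ0
  have hs0 : 0 ≤ φ - φ ^ 3 / 6 := by nlinarith [sq_nonneg φ]
  have hmul : 1.73 / 2 * (φ - φ ^ 3 / 6) ≤ √3 / 2 * Real.sin φ := by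
    refine mul_le_mul (by linarith) hs.le hs0 (by positivity)
  have hu : ustar n = -(1 / 2) - 1 / (2 * n) := by
    rw [ustar]; field_simp; ring
  have hinv : 1 / (2 * (n : ℝ)) ≤ 0.33 * φ := by
    rw [div_le_iff₀ (by positivity)]
    nlinarith
  rw [hu]
  have hφ3 : φ ^ 3 ≤ 0.525 ^ 2 * φ := by
    have := mul_le_mul_of_nonneg_right (pow_le_pow_left₀ hφ0.le hφ1 2) hφ0.le
    nlinarith
  have hφ2 : φ ^ 2 ≤ 0.525 * φ := by nlinarith
  nlinarith

theorem u₂_lt_u₁ (hn : 3 ≤ n) : u₂ n < u₁ n := (u₂_lt_ustar hn).trans (ustar_lt_u₁ hn)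

theorem u₁_lt_one (hn : 3 ≤ n) : u₁ n < 1 := by
  have := cos_ang_lt (n := n) (i := 0) (j := (n + 1) / 3) (by omega) (by omega)
  rw [u₁_eq]
  simpa [ang] using this

theorem u₂_lt_one (hn : 3 ≤ n) : u₂ n < 1 := (u₂_lt_u₁ hn).trans (u₁_lt_one hn)

theorem neg_one_le_u₂ (n : ℕ) : -1 ≤ u₂ n := Real.neg_one_le_cos _

theorem u₂_ne_neg_one (hn : 3 ≤ n) (h3 : n ≠ 3) (h5 : n ≠ 5) : u₂ n ≠ -1 := by
  rw [u₂_eq]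
  have hj : 2 * ((n + 1) / 3 + 1) < n + 1 := by omega
  have hN : (0 : ℝ) < n + 1 := by positivity
  have hlt : ang n ((n + 1) / 3 + 1) < Real.pi := by
    have : (2 : ℝ) * (((n + 1) / 3 + 1 : ℕ) : ℝ) < n + 1 := by exact_mod_cast hj
    rw [ang, div_lt_iff₀ hN]
    nlinarith [Real.pi_pos]
  have := Real.cos_lt_cos_of_nonneg_of_le_pi (ang_nonneg (n := n) ((n + 1) / 3 + 1)) le_rfl hlt
  rw [Real.cos_pi] at this
  exact this.ne'

/-- The mean of the two angles lies between π/2 and 3π/2. The sign keeps a determinant in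
`Extremal.fam_six` away from 0. -/
theorem u₁_add_u₂_nonpos (hn : 3 ≤ n) : u₁ n + u₂ n ≤ 0 := by
  rw [u₁_eq, u₂_eq, Real.cos_add_cos]
  have hN : (0 : ℝ) < n + 1 := by positivity
  have hπ := Real.pi_pos
  have e1 : (ang n ((n + 1) / 3) + ang n ((n + 1) / 3 + 1)) / 2 =
      Real.pi * (2 * (((n + 1) / 3 : ℕ) : ℝ) + 1) / (n + 1) := by
    rw [ang, ang]; push_cast; field_simp; ring
  have e2 : (ang n ((n + 1) / 3) - ang n ((n + 1) / 3 + 1)) / 2 = -(Real.pi / (n + 1)) := by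
    rw [ang, ang]; push_cast; field_simp; ring
  rw [e1, e2, Real.cos_neg]
  have h1 : (n : ℝ) + 1 ≤ 2 * (2 * (((n + 1) / 3 : ℕ) : ℝ) + 1) := by
    have : n + 1 ≤ 2 * (2 * ((n + 1) / 3) + 1) := by omega
    exact_mod_cast this
  have h2 : 2 * (2 * (((n + 1) / 3 : ℕ) : ℝ) + 1) ≤ 3 * (n + 1) := by
    have : 2 * (2 * ((n + 1) / 3) + 1) ≤ 3 * (n + 1) := by omega
    exact_mod_cast this
  have c1 : Real.cos (Real.pi * (2 * (((n + 1) / 3 : ℕ) : ℝ) + 1) / (n + 1)) ≤ 0 := by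
    refine Real.cos_nonpos_of_pi_div_two_le_of_le ?_ ?_
    · rw [div_le_div_iff₀ (by norm_num) hN]; nlinarith
    · rw [div_le_iff₀ hN]; nlinarith
  have c2 : 0 ≤ Real.cos (Real.pi / (n + 1)) := by
    refine Real.cos_nonneg_of_neg_pi_div_two_le_of_le (by
      have : 0 ≤ Real.pi / (n + 1 : ℝ) := by positivity
      linarith) ?_
    have h3 : (3 : ℝ) ≤ n := by exact_mod_cast hn
    gcongr
    linarith
  nlinarith

theorem root_of_unity_re {ω : ℂ} (hω : ω ^ (n + 1) = 1) :
    ∃ j, 2 * j ≤ n + 1 ∧ ω.re = Real.cos (ang n j) := by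
  have hp := Complex.isPrimitiveRoot_exp (n + 1) (by omega)
  obtain ⟨j, hj, rfl⟩ := hp.eq_pow_of_pow_eq_one hω
  have hre : (Complex.exp (2 * Real.pi * Complex.I / (n + 1 : ℕ)) ^ j).re = Real.cos (ang n j) := by
    rw [← Complex.exp_nat_mul,
      show (j : ℂ) * (2 * Real.pi * Complex.I / (n + 1 : ℕ)) = (ang n j : ℂ) * Complex.I by
        rw [ang]; push_cast; ring, Complex.exp_ofReal_mul_I_re]
  rcases le_or_gt (2 * j) (n + 1) with h | h
  · exact ⟨j, h, hre⟩
  · exact ⟨n + 1 - j, by omega, by rw [hre, cos_ang_symm (by omega)]⟩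

/-- u₁ and u₂ are consecutive among the cosines of the roots of unity, so no other cosine lies
between them. This is feasibility of the optimum, with strict slack at all inactive roots. -/
theorem root_of_unity_cases (hn : 3 ≤ n) {ω : ℂ} (hω : ω ^ (n + 1) = 1) :
    ω.re = u₁ n ∨ ω.re = u₂ n ∨ 0 < (ω.re - u₁ n) * (ω.re - u₂ n) := by
  obtain ⟨j, hj, hre⟩ := root_of_unity_re hω
  have h12 := u₂_lt_u₁ hn
  rcases (by omega : j = (n + 1) / 3 ∨ j = (n + 1) / 3 + 1 ∨ j < (n + 1) / 3 ∨
    (n + 1) / 3 + 1 < j) with h | h | h | h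
  · left; rw [hre, h, u₁_eq]
  · right; left; rw [hre, h, u₂_eq]
  · right; right
    have h1 := cos_ang_lt (n := n) h (by omega)
    rw [← u₁_eq, ← hre] at h1
    exact mul_pos (by linarith) (by linarith)
  · right; right
    have h1 := cos_ang_lt (n := n) h hj
    rw [← u₂_eq, ← hre] at h1
    exact mul_pos_of_neg_of_neg (by linarith) (by linarith)

theorem exists_root_of_unity (n j : ℕ) : ∃ ω : ℂ, ω ^ (n + 1) = 1 ∧ ω.re = Real.cos (ang n j) := by
  refine ⟨Complex.exp ((ang n j : ℂ) * Complex.I), ?_, Complex.exp_ofReal_mul_I_re _⟩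
  rw [← Complex.exp_nat_mul]
  have hN : (n : ℂ) + 1 ≠ 0 := by exact_mod_cast n.succ_ne_zero
  rw [Complex.exp_eq_one_iff]
  refine ⟨j, ?_⟩
  rw [ang]; push_cast; field_simp

theorem re_sq_add_im_sq {ω : ℂ} (hω : ω ^ (n + 1) = 1) : ω.re ^ 2 + ω.im ^ 2 = 1 := by
  have := Complex.norm_eq_one_of_pow_eq_one hω (by omega)
  have h2 := Complex.sq_norm ω
  rw [this, Complex.normSq_apply] at h2
  nlinarith

theorem conj_pow_eq_one {ω : ℂ} (hω : ω ^ (n + 1) = 1) :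
    (starRingEnd ℂ) ω ^ (n + 1) = 1 := by
  rw [← map_pow, hω, map_one]

end Trig

/-! ### The linear program and the second order coefficient -/

section LP

variable {n : ℕ}

/-- `lpA` and `lpB` solve the two active constraints, at u₁ and u₂, of the linear program. -/
noncomputable def lpA (n : ℕ) : ℝ := -(u₁ n + u₂ n) / ((1 - u₁ n) * (1 - u₂ n))

noncomputable def lpB (n : ℕ) : ℝ := 1 / (2 * ((1 - u₁ n) * (1 - u₂ n)))

/-- The dual multipliers of the linear program. -/
noncomputable def nu₁ (n : ℕ) : ℝ := (ustar n - u₂ n) / (u₁ n - u₂ n) / (1 - u₁ n)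

noncomputable def nu₂ (n : ℕ) : ℝ := (u₁ n - ustar n) / (u₁ n - u₂ n) / (1 - u₂ n)

theorem nu₁_pos (hn : 3 ≤ n) : 0 < nu₁ n := by
  have := u₂_lt_ustar hn
  have := u₂_lt_u₁ hn
  have := u₁_lt_one hn
  exact div_pos (div_pos (by linarith) (by linarith)) (by linarith)

theorem nu₂_pos (hn : 3 ≤ n) : 0 < nu₂ n := by
  have := ustar_lt_u₁ hn
  have := u₂_lt_u₁ hn
  have := u₂_lt_one hn
  exact div_pos (div_pos (by linarith) (by linarith)) (by linarith)

theorem lpB_pos (hn : 3 ≤ n) : 0 < lpB n := by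
  have h1 : 0 < 1 - u₁ n := by linarith [u₁_lt_one hn]
  have h2 : 0 < 1 - u₂ n := by linarith [u₂_lt_one hn]
  unfold lpB; positivity

theorem lp_slack (hn : 3 ≤ n) (u : ℝ) : 1 - lpA n * (1 - u) - 2 * lpB n * (1 - u ^ 2) =
    (u - u₁ n) * (u - u₂ n) / ((1 - u₁ n) * (1 - u₂ n)) := by
  have h1 : 1 - u₁ n ≠ 0 := by linarith [u₁_lt_one hn]
  have h2 : 1 - u₂ n ≠ 0 := by linarith [u₂_lt_one hn]
  rw [lpA, lpB]; field_simp; ring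

theorem lp_active₁ (hn : 3 ≤ n) : lpA n * (1 - u₁ n) + 2 * lpB n * (1 - u₁ n ^ 2) = 1 := by
  have := lp_slack hn (u₁ n)
  rw [sub_self, zero_mul, zero_div] at this; linarith

theorem lp_active₂ (hn : 3 ≤ n) : lpA n * (1 - u₂ n) + 2 * lpB n * (1 - u₂ n ^ 2) = 1 := by
  have := lp_slack hn (u₂ n)
  rw [sub_self, mul_zero, zero_div] at this; linarith

/-- The numbers ν_i(1-u_i) are the weights of a convex combination of u₁ and u₂ with mean `ustar n`.
Sum 1 and mean -(n+1)/(2n) are exactly the two dual equations, for the objective X + Y(n-1)/n. -/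
theorem nu_sum_one (hn : 3 ≤ n) : nu₁ n * (1 - u₁ n) + nu₂ n * (1 - u₂ n) = 1 := by
  have h1 : 1 - u₁ n ≠ 0 := by linarith [u₁_lt_one hn]
  have h2 : 1 - u₂ n ≠ 0 := by linarith [u₂_lt_one hn]
  have h3 : u₁ n - u₂ n ≠ 0 := by linarith [u₂_lt_u₁ hn]
  rw [nu₁, nu₂]; field_simp; ring

theorem nu_sum_two (hn : 3 ≤ n) :
    nu₁ n * (1 - u₁ n ^ 2) + nu₂ n * (1 - u₂ n ^ 2) = ((n : ℝ) - 1) / (2 * n) := by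
  have h1 : 1 - u₁ n ≠ 0 := by linarith [u₁_lt_one hn]
  have h2 : 1 - u₂ n ≠ 0 := by linarith [u₂_lt_one hn]
  have h3 : u₁ n - u₂ n ≠ 0 := by linarith [u₂_lt_u₁ hn]
  have hn0 : (n : ℝ) ≠ 0 := by positivity
  rw [nu₁, nu₂, ustar]; field_simp; ring

/-- Strong duality: the dual value ν₁ + ν₂ equals the primal value. -/
theorem nu_sum (hn : 3 ≤ n) : nu₁ n + nu₂ n = rho n (lpA n) (lpB n) := by
  have e1 := lp_active₁ hn
  have e2 := lp_active₂ hn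
  have e3 := nu_sum_one hn
  have e4 := nu_sum_two hn
  have hn0 : (n : ℝ) ≠ 0 := by positivity
  have e5 : rho n (lpA n) (lpB n) = lpA n + 2 * lpB n * (((n : ℝ) - 1) / (2 * n)) := by
    rw [rho]; field_simp
  rw [e5, ← e4]
  linear_combination (-nu₁ n) * e1 - nu₂ n * e2 + lpA n * e3

theorem rho_eq (hn : 3 ≤ n) : rho n (lpA n) (lpB n) - 1 = D₁ n + D₂ n / n := by
  have h1 : 1 - u₁ n ≠ 0 := by linarith [u₁_lt_one hn]
  have h2 : 1 - u₂ n ≠ 0 := by linarith [u₂_lt_one hn]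
  have hn0 : (n : ℝ) ≠ 0 := by positivity
  rw [rho, lpA, lpB, D₁, D₂]; field_simp; ring

/-- The coefficient of the fourth power sum in the second order objective. -/
noncomputable def kappa (n : ℕ) : ℝ := 1 / (4 * n) - nu₁ n * conQ n (u₁ n) - nu₂ n * conQ n (u₂ n)

/-- The second order coefficient of the objective when the fourth power sum is `Q s ^ 4`. -/
noncomputable def objC (n : ℕ) (Q : ℝ) : ℝ :=
  1 / 2 - lpA n - n * lpA n ^ 2 / 2 + kappa n * Q
    + (-2 * rho n (lpA n) (lpB n) * ((n - 1) * lpB n) + n * rho n (lpA n) (lpB n) ^ 2) / n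
    - nu₁ n * conS n (lpA n) (lpB n) (u₁ n) - nu₂ n * conS n (lpA n) (lpB n) (u₂ n)
    - (rho n (lpA n) (lpB n) - 1) ^ 2 / 2

/-- At the value 2((n-1)B)² of the fourth power sum the terms with denominator n - 3 cancel. The
formula is therefore valid for n = 3 as well. -/
theorem conQ_add_conS (hn : 3 ≤ n) (A B u : ℝ) :
    conQ n u * (2 * ((n - 1) * B) ^ 2) + conS n A B u =
      conK n A B u + (1 - u) * (1 + 2 * u) ^ 2 * ((n - 1) * B * rho n A B) := by
  have h3 : (3 : ℝ) ≤ n := by exact_mod_cast hn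
  have h2 : (n : ℝ) - 2 ≠ 0 := by linarith
  have h0 : (n : ℝ) ≠ 0 := by linarith
  rw [conQ, conS, rho]
  simp only [div_eq_mul_inv _ ((n : ℝ) - 3)]
  generalize ((n : ℝ) - 3)⁻¹ = w
  field_simp
  ring

theorem objC_eq (hn : 3 ≤ n) : objC n (2 * ((n - 1) * lpB n) ^ 2) = D n := by
  have h1 : 1 - u₁ n ≠ 0 := by linarith [u₁_lt_one hn]
  have h2 : 1 - u₂ n ≠ 0 := by linarith [u₂_lt_one hn]
  have h3 : u₁ n - u₂ n ≠ 0 := by linarith [u₂_lt_u₁ hn]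
  have hn0 : (n : ℝ) ≠ 0 := by positivity
  have k1 := conQ_add_conS hn (lpA n) (lpB n) (u₁ n)
  have k2 := conQ_add_conS hn (lpA n) (lpB n) (u₂ n)
  -- The first order slack vanishes at the active abscissae, which removes most of `conK`.
  have d1 : 1 + lpA n * (u₁ n - 1) + 2 * lpB n * (u₁ n ^ 2 - 1) = 0 := by
    linarith [lp_active₁ hn]
  have d2 : 1 + lpA n * (u₂ n - 1) + 2 * lpB n * (u₂ n ^ 2 - 1) = 0 := by
    linarith [lp_active₂ hn]
  rw [conK, d1] at k1
  rw [conK, d2] at k2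
  have : objC n (2 * ((n - 1) * lpB n) ^ 2) = 1 / 2 - lpA n - n * lpA n ^ 2 / 2
    + 1 / (4 * n) * (2 * ((n - 1) * lpB n) ^ 2)
    + (-2 * rho n (lpA n) (lpB n) * ((n - 1) * lpB n) + n * rho n (lpA n) (lpB n) ^ 2) / n
    - nu₁ n * (conQ n (u₁ n) * (2 * ((n - 1) * lpB n) ^ 2) + conS n (lpA n) (lpB n) (u₁ n))
    - nu₂ n * (conQ n (u₂ n) * (2 * ((n - 1) * lpB n) ^ 2) + conS n (lpA n) (lpB n) (u₂ n))
    - (rho n (lpA n) (lpB n) - 1) ^ 2 / 2 := by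
    rw [objC, kappa]; ring
  rw [this, k1, k2]
  rw [D, D₃, D₄, D₅, D₆, D₁, D₂, rho, nu₁, nu₂, ustar, lpA, lpB]
  generalize u₁ n = a at *
  generalize u₂ n = b at *
  obtain ⟨p, rfl⟩ : ∃ p, a = 1 - p := ⟨1 - a, by ring⟩
  obtain ⟨q, rfl⟩ : ∃ q, b = 1 - q := ⟨1 - b, by ring⟩
  have hp : p ≠ 0 := by simpa using h1
  have hq : q ≠ 0 := by simpa using h2
  have hpq : q - p ≠ 0 := by
    intro h; apply h3; linarith
  simp only [sub_sub_cancel, show (1 - p - (1 - q) : ℝ) = q - p by ring]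
  clear this k1 k2 d1 d2 h1 h2 h3
  generalize (n : ℝ) = N at *
  field_simp
  ring

end LP

/-! ### Sign of the coefficient of the fourth power sum -/

section Kappa

variable {n : ℕ}

theorem objC_add (n : ℕ) (Q Q' : ℝ) : objC n Q' = objC n Q + kappa n * (Q' - Q) := by
  rw [objC, objC]; ring

theorem u₁_five : u₁ 5 = -1 / 2 := by
  rw [u₁_eq, ang]
  have : 2 * Real.pi * (((5 + 1) / 3 : ℕ) : ℝ) / ((5 : ℕ) + 1) = Real.pi - Real.pi / 3 := by
    norm_num; ring
  rw [this, Real.cos_pi_sub, Real.cos_pi_div_three]; norm_num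

theorem u₂_five : u₂ 5 = -1 := by
  rw [u₂_eq, ang]
  have : 2 * Real.pi * (((5 + 1) / 3 + 1 : ℕ) : ℝ) / ((5 : ℕ) + 1) = Real.pi := by
    norm_num; ring
  rw [this, Real.cos_pi]

theorem lpB_five : lpB 5 = 1 / 6 := by
  rw [lpB, u₁_five, u₂_five]; norm_num

theorem kappa_five : kappa 5 = 7 / 60 := by
  rw [kappa, nu₁, nu₂, ustar, conQ, conQ, u₁_five, u₂_five]; norm_num

/-- The correction is κ(13/5 - 2)E² with κ = 7/60 and E = 4B = 2/3. -/
theorem objC_five : objC 5 (13 / 20 * (2 * (((5 : ℕ) - 1) * lpB 5)) ^ 2) = D 5 + 7 / 225 := by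
  rw [objC_add 5 (2 * (((5 : ℕ) - 1) * lpB 5) ^ 2), objC_eq (by norm_num), kappa_five, lpB_five]
  norm_num

/-- In the variable v = 1 + 2u the dual weights ν_i(1-u_i) have mean -1/n. V and W are the second
and third moments of v, computed from the quadratic equation satisfied by v₁ and v₂. Then 2u²(1+u) =
(v³ - v² - v + 1)/4 gives the last term. -/
theorem kappa_eq (hn : 4 ≤ n) {v₁ v₂ V W : ℝ} (h₁ : v₁ = 1 + 2 * u₁ n) (h₂ : v₂ = 1 + 2 * u₂ n)
    (hV : V = -(v₁ + v₂) / n - v₁ * v₂) (hW : W = (v₁ + v₂) * V + v₁ * v₂ / n) :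
    kappa n = 1 / (4 * n) - V / (2 * (n - 2)) + (W - V + 1 / n + 1) / (4 * (n - 3)) := by
  have g1 : 1 - u₁ n ≠ 0 := by linarith [u₁_lt_one (n := n) (by omega)]
  have g2 : 1 - u₂ n ≠ 0 := by linarith [u₂_lt_one (n := n) (by omega)]
  have g3 : u₁ n - u₂ n ≠ 0 := by linarith [u₂_lt_u₁ (n := n) (by omega)]
  have h4 : (4 : ℝ) ≤ n := by exact_mod_cast hn
  have n2 : (n : ℝ) - 2 ≠ 0 := by linarith
  have n3 : (n : ℝ) - 3 ≠ 0 := by linarith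
  have hn0 : (n : ℝ) ≠ 0 := by positivity
  rw [kappa, nu₁, nu₂, ustar, conQ, conQ, hW, hV, h₁, h₂]
  generalize u₁ n = a at *
  generalize u₂ n = b at *
  generalize (n : ℝ) = N at *
  field_simp
  ring

/-- V is a second moment of points at mutual distance O(1/n) with mean -1/n, hence O(1/n²), while
the positive terms of `kappa_eq` are of order 1/n. The constants are good enough from n = 9 on. -/
theorem kappa_nonneg_of_nine_le (hn : 9 ≤ n) : 0 ≤ kappa n := by
  have h9 : (9 : ℝ) ≤ n := by exact_mod_cast hn
  set v₁ := 1 + 2 * u₁ n with h₁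
  set v₂ := 1 + 2 * u₂ n with h₂
  set V := -(v₁ + v₂) / n - v₁ * v₂ with hV
  set W := (v₁ + v₂) * V + v₁ * v₂ / n with hW
  have hv1 : 0 ≤ v₁ := by linarith [u₁_ge n]
  have hv2 : -1 ≤ v₂ := by linarith [neg_one_le_u₂ n]
  have hm : v₂ < -(1 / n) := by
    have := u₂_lt_ustar (n := n) (by omega)
    have e : ustar n = -1 / 2 - 1 / (2 * n) := by rw [ustar]; field_simp; ring
    have e2 : 1 / (2 * (n : ℝ)) = 1 / 2 * (1 / n) := by field_simp
    rw [e, e2] at this; linarith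
  have hinv : (0 : ℝ) < 1 / n := by positivity
  have hdiff : v₁ - v₂ ≤ 4 * Real.pi / (n + 1) := by
    have hN : (0 : ℝ) < n + 1 := by positivity
    have e : v₁ - v₂ = 2 * (u₁ n - u₂ n) := by rw [h₁, h₂]; ring
    rw [e, u₁_eq, u₂_eq]
    have h1 := Real.abs_cos_sub_cos_le (ang n ((n + 1) / 3)) (ang n ((n + 1) / 3 + 1))
    have h2 : ang n ((n + 1) / 3) - ang n ((n + 1) / 3 + 1) = -(2 * Real.pi / (n + 1)) := by
      rw [ang, ang]; push_cast; field_simp; ring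
    have := (le_abs_self _).trans h1
    rw [h2, abs_neg, abs_of_pos (div_pos (mul_pos two_pos Real.pi_pos) hN)] at this
    have e3 : 4 * Real.pi / ((n : ℝ) + 1) = 2 * (2 * Real.pi / (n + 1)) := by ring
    rw [e3]; linarith
  -- V - 1/n² is the variance of v, at most a quarter of the squared range.
  have hVle : V ≤ (v₁ - v₂) ^ 2 / 4 + (1 / n) ^ 2 := by
    have : V = (v₁ + 1 / n) * (-(1 / n) - v₂) + (1 / n) ^ 2 := by rw [hV]; ring
    rw [this]
    nlinarith [sq_nonneg (v₁ + 1 / n + (1 / n) + v₂)]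
  have hV0 : V ≤ 41 / (n * (n + 1)) := by
    have hN : (0 : ℝ) < n + 1 := by positivity
    have h0 : 0 ≤ v₁ - v₂ := by linarith
    have h1 : (v₁ - v₂) ^ 2 ≤ (4 * Real.pi / (n + 1)) ^ 2 := pow_le_pow_left₀ h0 hdiff 2
    have h2 : (4 * Real.pi / ((n : ℝ) + 1)) ^ 2 / 4 ≤ 39.7 / (n + 1) ^ 2 := by
      rw [div_pow, div_div, div_le_div_iff₀ (by positivity) (by positivity)]
      have := Real.pi_lt_d2
      have hp : Real.pi ^ 2 ≤ 3.15 ^ 2 := pow_le_pow_left₀ Real.pi_pos.le this.le 2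
      have hq : 0 < ((n : ℝ) + 1) ^ 2 := by positivity
      nlinarith
    have h3 : 39.7 / ((n : ℝ) + 1) ^ 2 + (1 / n) ^ 2 ≤ 41 / (n * (n + 1)) := by
      rw [div_pow, one_pow, div_add_div _ _ (by positivity) (by positivity),
        div_le_div_iff₀ (by positivity) (by positivity)]
      obtain ⟨t, ht, e⟩ : ∃ t : ℝ, 0 ≤ t ∧ (n : ℝ) = t + 9 := ⟨n - 9, by linarith, by ring⟩
      rw [e]
      have : 0 ≤ (t + 9) * (t + 9 + 1) * (0.3 * t ^ 2 + 5 * t + 10) := by positivity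
      nlinarith [pow_nonneg ht 2, pow_nonneg ht 3, pow_nonneg ht 4]
    linarith
  have hVpos : 0 ≤ V := by
    have : V = (v₁ + 1 / n) * (-(1 / n) - v₂) + (1 / n) ^ 2 := by rw [hV]; ring
    rw [this]
    have : 0 ≤ (v₁ + 1 / n) * (-(1 / n) - v₂) := mul_nonneg (by linarith) (by linarith)
    positivity
  -- W + V is the mean of v²(1+v), and v ≥ -1.
  have hWV : -V ≤ W := by
    have : W + V = ((-(1 / n) - v₂) * (v₁ ^ 2 * (v₁ + 1)) +
        (v₁ + 1 / n) * (v₂ ^ 2 * (v₂ + 1))) / (v₁ - v₂) := by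
      rw [eq_div_iff (by linarith : v₁ - v₂ ≠ 0), hW, hV]; field_simp; ring
    have h2 : 0 ≤ W + V := by
      rw [this]
      refine div_nonneg (add_nonneg (mul_nonneg (by linarith) (by positivity))
        (mul_nonneg (by linarith) (mul_nonneg (sq_nonneg _) (by linarith)))) (by linarith)
    linarith
  rw [kappa_eq (by omega) h₁ h₂ hV hW]
  have n2 : (0 : ℝ) < n - 2 := by linarith
  have n3 : (0 : ℝ) < n - 3 := by linarith
  have b1 : V / (2 * (n - 2)) ≤ 41 / (n * (n + 1)) / (2 * ((n : ℝ) - 2)) := by gcongr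
  have b2 : (1 - 2 * (41 / (n * (n + 1))) + 1 / n) / (4 * ((n : ℝ) - 3)) ≤
      (W - V + 1 / n + 1) / (4 * (n - 3)) := by
    gcongr ?_ / _
    linarith
  have b3 : 41 / (n * (n + 1)) / (2 * ((n : ℝ) - 2)) ≤ 1 / (4 * n) +
      (1 - 2 * (41 / (n * (n + 1))) + 1 / n) / (4 * ((n : ℝ) - 3)) := by
    rw [← sub_nonneg]
    have e : 1 / (4 * (n : ℝ)) + (1 - 2 * (41 / (n * (n + 1))) + 1 / n) / (4 * ((n : ℝ) - 3)) -
        41 / (n * (n + 1)) / (2 * ((n : ℝ) - 2)) =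
        ((n + 1) * (n - 2) * (n - 3) + (n * (n + 1) - 82 + (n + 1)) * (n - 2) - 82 * (n - 3)) /
        (4 * n * (n + 1) * (n - 2) * (n - 3)) := by
      have := n2.ne'; have := n3.ne'
      field_simp
      ring
    rw [e]
    refine div_nonneg ?_ (by positivity)
    obtain ⟨t, ht, e⟩ : ∃ t : ℝ, 0 ≤ t ∧ (n : ℝ) = t + 9 := ⟨n - 9, by linarith, by ring⟩
    rw [e]
    nlinarith [pow_nonneg ht 2, pow_nonneg ht 3]
  linarith

theorem kappa_four : 0 ≤ kappa 4 := by
  have a1 : u₁ 4 = (√5 - 1) / 4 := by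
    rw [u₁_eq, ang]
    have : 2 * Real.pi * (((4 + 1) / 3 : ℕ) : ℝ) / ((4 : ℕ) + 1) = 2 * (Real.pi / 5) := by
      norm_num; ring
    rw [this, Real.cos_two_mul, Real.cos_pi_div_five]
    nlinarith [Real.sq_sqrt (show (0 : ℝ) ≤ 5 by norm_num)]
  have a2 : u₂ 4 = -(1 + √5) / 4 := by
    rw [u₂_eq, ang]
    have : 2 * Real.pi * (((4 + 1) / 3 + 1 : ℕ) : ℝ) / ((4 : ℕ) + 1) = Real.pi - Real.pi / 5 := by
      norm_num; ring
    rw [this, Real.cos_pi_sub, Real.cos_pi_div_five]; ring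
  have h5 := Real.sq_sqrt (show (0 : ℝ) ≤ 5 by norm_num)
  rw [kappa_eq le_rfl rfl rfl rfl rfl, a1, a2]
  push_cast
  nlinarith

theorem kappa_eight : 0 ≤ kappa 8 := by
  have a1 : u₁ 8 = -1 / 2 := by
    rw [u₁_eq, ang]
    have : 2 * Real.pi * (((8 + 1) / 3 : ℕ) : ℝ) / ((8 : ℕ) + 1) = Real.pi - Real.pi / 3 := by
      norm_num; ring
    rw [this, Real.cos_pi_sub, Real.cos_pi_div_three]; norm_num
  have a2 := neg_one_le_u₂ 8
  have a3 := u₂_lt_ustar (n := 8) (by norm_num)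
  rw [ustar] at a3
  push_cast at a3
  rw [kappa_eq (by norm_num) rfl rfl rfl rfl, a1]
  push_cast
  norm_num
  nlinarith

theorem kappa_seven : 0 ≤ kappa 7 := by
  have a1 : u₁ 7 = 0 := by
    rw [u₁_eq, ang]
    have : 2 * Real.pi * (((7 + 1) / 3 : ℕ) : ℝ) / ((7 : ℕ) + 1) = Real.pi / 2 := by
      norm_num; ring
    rw [this, Real.cos_pi_div_two]
  have a2 : u₂ 7 = -(√2 / 2) := by
    rw [u₂_eq, ang]
    have : 2 * Real.pi * (((7 + 1) / 3 + 1 : ℕ) : ℝ) / ((7 : ℕ) + 1) = Real.pi - Real.pi / 4 := by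
      norm_num; ring
    rw [this, Real.cos_pi_sub, Real.cos_pi_div_four]
  have h2 := Real.sq_sqrt (show (0 : ℝ) ≤ 2 by norm_num)
  have h3 : √2 ≤ 1.42 := Real.sqrt_le_iff.2 ⟨by norm_num, by norm_num⟩
  have h4 : 1.41 ≤ √2 := Real.le_sqrt_of_sq_le (by norm_num)
  rw [kappa_eq (by norm_num) rfl rfl rfl rfl, a1, a2]
  push_cast
  norm_num
  nlinarith

theorem kappa_six : 0 ≤ kappa 6 := by
  have hπ := Real.pi_gt_d4
  have hπ' := Real.pi_lt_d4
  have a1 : u₁ 6 = -Real.sin (Real.pi / 14) := by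
    rw [u₁_eq, ang]
    have : 2 * Real.pi * (((6 + 1) / 3 : ℕ) : ℝ) / ((6 : ℕ) + 1) = Real.pi / 14 + Real.pi / 2 := by
      norm_num; ring
    rw [this, Real.cos_add_pi_div_two]
  have a2 : u₂ 6 = -Real.cos (Real.pi / 7) := by
    rw [u₂_eq, ang]
    have : 2 * Real.pi * (((6 + 1) / 3 + 1 : ℕ) : ℝ) / ((6 : ℕ) + 1) = Real.pi - Real.pi / 7 := by
      norm_num; ring
    rw [this, Real.cos_pi_sub]
  have s1 : Real.sin (Real.pi / 14) ≤ 0.2245 := (Real.sin_le (by positivity)).trans (by linarith)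
  have s2 : 0.222 ≤ Real.sin (Real.pi / 14) := by
    have := Real.sin_gt_sub_cube (x := Real.pi / 14) (by positivity)
    have h3 : (Real.pi / 14) ^ 3 ≤ 0.2245 ^ 3 := pow_le_pow_left₀ (by positivity) (by linarith) 3
    norm_num at h3 ⊢
    linarith
  have c1 : 0.899 ≤ Real.cos (Real.pi / 7) := by
    have := Real.one_sub_sq_div_two_le_cos (x := Real.pi / 7)
    have h3 : (Real.pi / 7) ^ 2 ≤ 0.449 ^ 2 := pow_le_pow_left₀ (by positivity) (by linarith) 2
    norm_num at h3 ⊢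
    linarith
  have c2 : Real.cos (Real.pi / 7) ≤ 0.913 := by
    have h := Real.cos_le_one_div_sqrt_sq_add_one (x := Real.pi / 7) (by linarith) (by linarith)
    refine h.trans ?_
    rw [div_le_iff₀ (by positivity)]
    have h3 : (0.4487 : ℝ) ^ 2 ≤ (Real.pi / 7) ^ 2 := pow_le_pow_left₀ (by norm_num) (by linarith) 2
    have : (1.0958 : ℝ) ≤ √((Real.pi / 7) ^ 2 + 1) := Real.le_sqrt_of_sq_le (by norm_num at h3 ⊢; linarith)
    linarith
  rw [kappa_eq (by norm_num) rfl rfl rfl rfl, a1, a2]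
  -- `kappa` depends only on the sum S and the product -p of v₁ and v₂, so crude intervals for these
  -- two numbers suffice.
  obtain ⟨p, hp⟩ : ∃ p, p = (1 - 2 * Real.sin (Real.pi / 14)) * (2 * Real.cos (Real.pi / 7) - 1) :=
    ⟨_, rfl⟩
  obtain ⟨S, hS⟩ : ∃ S, S = 2 - 2 * Real.sin (Real.pi / 14) - 2 * Real.cos (Real.pi / 7) := ⟨_, rfl⟩
  have p1 : p ≤ 0.556 * 0.826 := by
    rw [hp]; exact mul_le_mul (by linarith) (by linarith) (by linarith) (by norm_num)
  have p0 : 0 ≤ p := by rw [hp]; exact mul_nonneg (by linarith) (by linarith)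
  have S1 : -0.275 ≤ S := by linarith
  have S2 : S ≤ -0.242 := by linarith
  have e1 : 1 + 2 * -Real.sin (Real.pi / 14) + (1 + 2 * -Real.cos (Real.pi / 7)) = S := by
    rw [hS]; ring
  have e2 : (1 + 2 * -Real.sin (Real.pi / 14)) * (1 + 2 * -Real.cos (Real.pi / 7)) = -p := by
    rw [hp]; ring
  rw [e1, e2]
  push_cast
  nlinarith [mul_nonneg (by linarith : 0 ≤ S + 0.275) p0, mul_nonneg (by linarith : 0 ≤ S + 0.275)
    (by linarith : 0 ≤ -S)]

theorem kappa_nonneg (hn : 4 ≤ n) : 0 ≤ kappa n := by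
  rcases (by omega : n = 4 ∨ n = 5 ∨ n = 6 ∨ n = 7 ∨ n = 8 ∨ 9 ≤ n) with
    rfl | rfl | rfl | rfl | rfl | h
  exacts [kappa_four, by rw [kappa_five]; norm_num, kappa_six, kappa_seven, kappa_eight,
    kappa_nonneg_of_nine_le h]

end Kappa

/-! ### Localization of the critical points -/

section Localization

open Polynomial

variable {n : ℕ}

/-- For β = 1 the map z ↦ 1/(β - z) sends the unit disk to the half plane Re ≥ 1/2. For β < 1 the
defect is at most (3/2)(1-β)/|β - z|². -/
theorem one_sub_le_re_inv {β : ℝ} {z : ℂ} {c : ℝ} (hc : 0 < c) (h0 : 0 ≤ β) (h1 : β ≤ 1)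
    (hz : ‖z‖ ≤ 1) (hzβ : c ≤ ‖(β : ℂ) - z‖) :
    1 / 2 - 3 / 2 * (1 - β) / c ^ 2 ≤ (1 / ((β : ℂ) - z)).re := by
  have hN : Complex.normSq ((β : ℂ) - z) = (β - z.re) ^ 2 + z.im ^ 2 := by
    rw [Complex.normSq_apply]; simp; ring
  have hc2 : c ^ 2 ≤ (β - z.re) ^ 2 + z.im ^ 2 := by
    rw [← hN, ← Complex.sq_norm]; exact pow_le_pow_left₀ hc.le hzβ 2
  have hz2 : z.re ^ 2 + z.im ^ 2 ≤ 1 := by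
    have : ‖z‖ ^ 2 ≤ 1 := pow_le_one₀ (norm_nonneg _) hz
    rw [Complex.sq_norm, Complex.normSq_apply] at this
    nlinarith
  have hpos : 0 < (β - z.re) ^ 2 + z.im ^ 2 := lt_of_lt_of_le (by positivity) hc2
  have e : (1 / ((β : ℂ) - z)).re = (β - z.re) / ((β - z.re) ^ 2 + z.im ^ 2) := by
    rw [one_div, Complex.inv_re, hN]; simp
  have hre : z.re ≤ 1 := by nlinarith [sq_nonneg z.im]
  have h3 : 3 / 2 * (1 - β) / ((β - z.re) ^ 2 + z.im ^ 2) ≤ 3 / 2 * (1 - β) / c ^ 2 := by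
    have : 0 ≤ 3 / 2 * (1 - β) := by linarith
    gcongr
  rw [e]
  have h4 : 1 / 2 - 3 / 2 * (1 - β) / ((β - z.re) ^ 2 + z.im ^ 2) ≤
      (β - z.re) / ((β - z.re) ^ 2 + z.im ^ 2) := by
    rw [sub_le_iff_le_add, ← add_div, le_div_iff₀ hpos]
    nlinarith
  linarith

/-- If all critical points are at distance at least 1/2 from β, then on a disk of radius below
1/(4n) the derivative varies by at most 3/4 of |P'(β)|, since exp(1/2) - 1 ≤ 3/4. By the mean value
inequality P takes the value 0 there only at β. -/
theorem root_far {ζ : Fin n → ℂ} {P : ℂ[X]} {β : ℂ} (hn : 1 ≤ n)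
    (hP : P.derivative = C ((n : ℂ) + 1) * ∏ j, (X - C (ζ j))) (hβ : P.eval β = 0)
    (hζ : ∀ j, 1 / 2 ≤ ‖β - ζ j‖) {z : ℂ} (hz : P.eval z = 0) (hne : z ≠ β) :
    1 / (4 * (n : ℝ)) ≤ ‖β - z‖ := by
  by_contra! hlt
  set d := ‖β - z‖ with hd
  set a : ℂ := P.derivative.eval β with ha
  have hn0 : (0 : ℝ) < n := by exact_mod_cast hn
  have hev : ∀ w, P.derivative.eval w = ((n : ℂ) + 1) * ∏ j, (w - ζ j) := fun w => by
    rw [hP, eval_mul, eval_C, eval_prod]; simp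
  have hζ0 : ∀ j, β - ζ j ≠ 0 := fun j h => by
    have := hζ j
    rw [h, norm_zero] at this
    norm_num at this
  have ha0 : a ≠ 0 := by
    rw [ha, hev]
    exact mul_ne_zero (by exact_mod_cast n.succ_ne_zero) (Finset.prod_ne_zero_iff.2 fun j _ => hζ0 j)
  have hbound : ∀ w ∈ Metric.closedBall β d, ‖P.derivative.eval w - a‖ ≤ ‖a‖ * (3 / 4) := by
    intro w hw
    rw [Metric.mem_closedBall, dist_eq_norm] at hw
    have e : P.derivative.eval w - a = a * (∏ j, (1 + (w - β) / (β - ζ j)) - 1) := by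
      have : ∏ j, (w - ζ j) = (∏ j, (β - ζ j)) * ∏ j, (1 + (w - β) / (β - ζ j)) := by
        rw [← Finset.prod_mul_distrib]
        refine Finset.prod_congr rfl fun j _ => ?_
        have := hζ0 j
        field_simp
        ring
      rw [ha, hev, hev, this]; ring
    rw [e, norm_mul]
    refine mul_le_mul_of_nonneg_left ?_ (norm_nonneg _)
    refine (Finset.norm_prod_one_add_sub_one_le _ _).trans ?_
    have hs : ∑ j, ‖(w - β) / (β - ζ j)‖ ≤ 1 / 2 := by
      have h1 : ∀ j ∈ Finset.univ, ‖(w - β) / (β - ζ j)‖ ≤ 2 * (1 / (4 * (n : ℝ))) := by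
        intro j _
        rw [norm_div, div_le_iff₀ (by linarith [hζ j])]
        have h2 : 0 ≤ 1 / (4 * (n : ℝ)) := by positivity
        nlinarith [hζ j]
      refine (Finset.sum_le_sum h1).trans ?_
      rw [Finset.sum_const, Finset.card_univ, Fintype.card_fin, nsmul_eq_mul]
      apply le_of_eq; field_simp; norm_num
    have h3 : Real.exp (∑ j, ‖(w - β) / (β - ζ j)‖) ≤ Real.exp (1 / 2) := Real.exp_le_exp.2 hs
    have h4 : Real.exp (1 / 2) ≤ 7 / 4 := by
      have h5 : Real.exp (1 / 2) ^ 2 = Real.exp 1 := by rw [← Real.exp_nat_mul]; norm_num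
      have h6 := Real.exp_one_lt_d9
      nlinarith [Real.exp_pos (1 / 2 : ℝ)]
    linarith
  have hmv := Convex.norm_image_sub_le_of_norm_hasDerivWithin_le
    (f := fun w => P.eval w - a * w) (f' := fun w => P.derivative.eval w - a)
    (s := Metric.closedBall β d) (C := ‖a‖ * (3 / 4)) (x := β) (y := z)
    (fun w _ => by
      have := ((P.hasDerivAt w).sub ((hasDerivAt_id w).const_mul a)).hasDerivWithinAt
        (s := Metric.closedBall β d)
      rw [mul_one] at this
      exact this)
    hbound (convex_closedBall _ _) (Metric.mem_closedBall_self (norm_nonneg _))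
    (by rw [Metric.mem_closedBall, dist_comm, dist_eq_norm])
  rw [hz, hβ] at hmv
  have e2 : (0 - a * z) - (0 - a * β) = a * (β - z) := by ring
  rw [e2, norm_mul, norm_sub_rev z β] at hmv
  have hd0 : 0 < ‖β - z‖ := norm_pos_iff.2 (sub_ne_zero.2 hne.symm)
  have ha1 : 0 < ‖a‖ := norm_pos_iff.2 ha0
  nlinarith [mul_pos ha1 hd0]

/-- In the identity of `sum_inv_sub_critical` the right side has real part at least n - O(1-β), and
each term on the left has real part at most 1/r. If r is close to 1, no single term can be much
smaller than 1. The constant 48n³ is 2n times the defect 24n² of `one_sub_le_re_inv` at c = 1/(4n).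
-/
theorem re_inv_critical_ge {ζ : Fin n → ℂ} {P : ℂ[X]} {β r : ℝ} (hn : 1 ≤ n) (h0 : 0 ≤ β)
    (h1 : β ≤ 1) (hP : P.derivative = C ((n : ℂ) + 1) * ∏ j, (X - C (ζ j))) (hm : P.Monic)
    (hd : P.natDegree = n + 1) (hβ : P.eval (β : ℂ) = 0) (hr : ∀ z, P.eval z = 0 → ‖z‖ ≤ 1)
    (hr2 : 1 / 2 ≤ r) (hζ : ∀ j, r ≤ ‖(β : ℂ) - ζ j‖) (j : Fin n) :
    1 - 48 * n ^ 3 * (1 - β) - (n - 1) * (1 / r - 1) ≤ (1 / ((β : ℂ) - ζ j)).re := by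
  have hr0 : 0 < r := by linarith
  have hn0 : (0 : ℝ) < n := by exact_mod_cast hn
  obtain ⟨m, hcard, hmroot, hsum⟩ := sum_inv_sub_critical ζ hP hm hd hβ (fun j h => by
    have := hζ j
    rw [h, sub_self, norm_zero] at this
    linarith)
  have hlow : ∀ z ∈ m, 1 / 2 - 24 * n ^ 2 * (1 - β) ≤ (1 / ((β : ℂ) - z)).re := by
    intro z hz
    obtain ⟨hz0, hzne⟩ := hmroot z hz
    have hfar := root_far hn hP hβ (fun j => hr2.trans (hζ j)) hz0 hzne
    have := one_sub_le_re_inv (c := 1 / (4 * n)) (by positivity) h0 h1 (hr z hz0) hfar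
    have e : 3 / 2 * (1 - β) / (1 / (4 * (n : ℝ))) ^ 2 = 24 * n ^ 2 * (1 - β) := by
      field_simp; ring
    linarith
  have hmsum : ∀ m' : Multiset ℂ, (∀ z ∈ m', 1 / 2 - 24 * n ^ 2 * (1 - β) ≤ (1 / ((β : ℂ) - z)).re) →
      Multiset.card m' * (1 / 2 - 24 * n ^ 2 * (1 - β)) ≤
        ((m'.map fun z => 1 / ((β : ℂ) - z)).sum).re := by
    intro m'
    induction m' using Multiset.induction_on with
    | empty => simp
    | cons a t ih =>
      intro h
      have h2 := ih fun z hz => h z (by simp [hz])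
      have h3 := h a (by simp)
      rw [Multiset.card_cons, Multiset.map_cons, Multiset.sum_cons, Complex.add_re]
      push_cast
      linarith
  have hm2 := hmsum m hlow
  rw [hcard] at hm2
  have hre := congrArg Complex.re hsum
  rw [Complex.re_sum] at hre
  have e2 : (2 * (m.map fun z => 1 / ((β : ℂ) - z)).sum).re =
      2 * ((m.map fun z => 1 / ((β : ℂ) - z)).sum).re := by simp
  rw [e2] at hre
  have hup : ∀ i, (1 / ((β : ℂ) - ζ i)).re ≤ 1 / r := fun i => by
    refine (Complex.re_le_norm _).trans ?_
    rw [norm_div, norm_one]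
    exact one_div_le_one_div_of_le hr0 (hζ i)
  have herase : ∑ i ∈ Finset.univ.erase j, (1 / ((β : ℂ) - ζ i)).re ≤ (n - 1) * (1 / r) := by
    refine (Finset.sum_le_sum fun i _ => hup i).trans ?_
    rw [Finset.sum_const, Finset.card_erase_of_mem (Finset.mem_univ _), Finset.card_univ,
      Fintype.card_fin, nsmul_eq_mul, Nat.cast_sub hn, Nat.cast_one]
  rw [← Finset.add_sum_erase _ _ (Finset.mem_univ j)] at hre
  nlinarith

variable {ι : Type*} {l : Filter ι} {s : ι → ℝ}

/-- For w = 1/(β - ζ_j) one has Re w ≥ 1 - O(s²) and |w| ≤ 1 + O(s²). Then |w - 1|² = |w|² - 1 + 2(1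
- Re w) is O(s²), so w - 1 is O(s) with real part O(s²), and ζ_j inherits this. -/
theorem critical_points_small (hn : 1 ≤ n) (hs : Tendsto s l (𝓝 0)) (hs0 : ∀ᶠ i in l, 0 ≤ s i)
    {ζ : ι → Fin n → ℂ} {P : ι → ℂ[X]} {r : ι → ℝ}
    (hP : ∀ i, (P i).derivative = C ((n : ℂ) + 1) * ∏ j, (X - C (ζ i j)))
    (hm : ∀ i, (P i).Monic) (hd : ∀ i, (P i).natDegree = n + 1)
    (hβ : ∀ i, (P i).eval (1 - (s i : ℂ) ^ 2) = 0) (hr : ∀ i z, (P i).eval z = 0 → ‖z‖ ≤ 1)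
    (hζ : ∀ i j, r i ≤ ‖(1 - (s i : ℂ) ^ 2) - ζ i j‖) (hr1 : UB l s 2 fun i => 1 - r i)
    (j : Fin n) : OO l s 1 (fun i => ζ i j) ∧ OO l s 2 fun i => (ζ i j).re := by
  have hcast : ∀ i, (1 - (s i : ℂ) ^ 2) = ((1 - s i ^ 2 : ℝ) : ℂ) := fun i => by push_cast; rfl
  obtain ⟨K, hK⟩ := hr1
  have hs2 : Tendsto (fun i => (|K| + 1) * s i ^ 2) l (𝓝 0) := by
    simpa using (hs.pow 2).const_mul (|K| + 1)
  have hsmall : ∀ᶠ i in l, (|K| + 1) * s i ^ 2 < 1 / 2 := hs2.eventually_lt_const (by norm_num)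
  set w : ι → ℂ := fun i => 1 / ((1 - (s i : ℂ) ^ 2) - ζ i j) with hw
  have hrinv : ∀ᶠ i in l, 1 / 2 ≤ r i ∧ 1 / r i ≤ 1 + 2 * |K| * s i ^ 2 ∧ s i ^ 2 ≤ 1 / 2 := by
    filter_upwards [hK, hsmall] with i h1 h2
    have h3 : K * s i ^ 2 ≤ |K| * s i ^ 2 :=
      mul_le_mul_of_nonneg_right (le_abs_self _) (sq_nonneg _)
    have h4 : 0 ≤ |K| * s i ^ 2 := by positivity
    have h5 : 0 ≤ s i ^ 2 := sq_nonneg _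
    have hr2 : 1 / 2 ≤ r i := by nlinarith
    refine ⟨hr2, ?_, by nlinarith⟩
    rw [div_le_iff₀ (by linarith)]
    nlinarith
  have hlow : UB l s 2 fun i => 1 - (w i).re := by
    refine ⟨48 * n ^ 3 + n * (2 * |K|), ?_⟩
    filter_upwards [hrinv] with i ⟨h1, h2, h3⟩
    have hb := re_inv_critical_ge (β := 1 - s i ^ 2) hn (by linarith)
      (by linarith [sq_nonneg (s i)]) (hP i) (hm i) (hd i) (by rw [← hcast]; exact hβ i) (hr i) h1
      (fun j => by rw [← hcast]; exact hζ i j) j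
    rw [← hcast] at hb
    have h4 : (1 : ℝ) ≤ n := by exact_mod_cast hn
    have h5 : ((n : ℝ) - 1) * (1 / r i - 1) ≤ (n - 1) * (2 * |K| * s i ^ 2) :=
      mul_le_mul_of_nonneg_left (by linarith) (by linarith)
    have h6 : 0 ≤ |K| * s i ^ 2 := by positivity
    simp only [hw]
    nlinarith
  have hupn : ∀ᶠ i in l, ‖w i‖ ≤ 1 + 2 * |K| * s i ^ 2 := by
    filter_upwards [hrinv] with i ⟨h1, h2, _⟩
    refine le_trans ?_ h2
    rw [hw, norm_div, norm_one]
    exact one_div_le_one_div_of_le (by linarith) (hζ i j)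
  have hre : OO l s 2 fun i => (w i).re - 1 := by
    refine UB.antisymm hs0 ⟨2 * |K|, ?_⟩ (hlow.congr fun i => by ring)
    filter_upwards [hupn] with i h
    linarith [Complex.re_le_norm (w i)]
  have hw1 : OO l s 1 fun i => w i - 1 := by
    have hnorm : UB l s 2 fun i => ‖w i - 1‖ ^ 2 := by
      have h1 : UB l s 2 fun i => ‖w i‖ ^ 2 - 1 := by
        refine ⟨6 * |K|, ?_⟩
        filter_upwards [hupn, hsmall] with i h h2
        have h3 : ‖w i‖ ^ 2 ≤ (1 + 2 * |K| * s i ^ 2) ^ 2 := pow_le_pow_left₀ (norm_nonneg _) h 2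
        have h4 : 0 ≤ |K| * s i ^ 2 := by positivity
        nlinarith [sq_nonneg (s i)]
      refine (h1.add (hlow.const_mul (by norm_num : (0 : ℝ) ≤ 2))).congr fun i => ?_
      rw [Complex.sq_norm, Complex.sq_norm, Complex.normSq_apply, Complex.normSq_apply]
      simp only [Complex.sub_re, Complex.sub_im, Complex.one_re, Complex.one_im]
      ring
    obtain ⟨C, hC⟩ := hnorm
    refine Asymptotics.IsBigO.of_bound (√(max C 0)) ?_
    filter_upwards [hC, hs0] with i h h2
    rw [pow_one, Real.norm_of_nonneg h2]
    have h3 : 0 ≤ √(max C 0) * s i := by positivity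
    refine abs_le_of_sq_le_sq' ?_ h3 |>.2
    rw [mul_pow, Real.sq_sqrt (le_max_right _ _)]
    exact h.trans (mul_le_mul_of_nonneg_right (le_max_left _ _) (sq_nonneg _))
  have hwt : Tendsto w l (𝓝 1) := by
    have := (hw1.tendsto hs le_rfl).add_const 1
    simpa using this
  have hwi : OO l s 0 fun i => (w i)⁻¹ := OO.of_tendsto (hwt.inv₀ one_ne_zero)
  have hne : ∀ᶠ i in l, w i ≠ 0 := hwt.eventually_ne one_ne_zero
  -- This is 1 - 1/w = (w-1) - (w-1)²/w, which isolates the first order term whose real part is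
  -- O(s²).
  have hζw : ∀ᶠ i in l, ζ i j = (w i - 1) - (w i - 1) * (w i - 1) * (w i)⁻¹ - (s i : ℂ) ^ 2 := by
    filter_upwards [hne] with i hi
    have h1 : (1 - (s i : ℂ) ^ 2) - ζ i j = (w i)⁻¹ := by simp [hw]
    have h2 : ζ i j = 1 - (s i : ℂ) ^ 2 - (w i)⁻¹ := by rw [← h1]; ring
    rw [h2]; field_simp; ring
  have hq : OO l s 2 fun i => (w i - 1) * (w i - 1) * (w i)⁻¹ :=
    (hw1.mul hw1).mul' hwi hs (by norm_num)
  constructor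
  · exact ((hw1.sub (hq.mono hs (by norm_num))).sub
      ((OO.selfC 2).mono hs (by norm_num))).congr' hζw
  · refine (((hre.sub hq.re)).sub (OO.selfC 2).re).congr' ?_
    filter_upwards [hζw] with i hi
    rw [hi, Complex.sub_re, Complex.sub_re, Complex.sub_re, Complex.one_re]

end Localization

/-! ### First order analysis of nearly extremal families -/

section Upper

variable {n : ℕ} {ι : Type*} {l : Filter ι} {s : ι → ℝ} {ζ : ι → Fin n → ℂ} {r : ι → ℝ}

/-- Near every root of unity there is a root in the closed unit disk of the polynomial with
critical points `ζ` and a root at `1 - s ^ 2`. -/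
def Constrained (l : Filter ι) (s : ι → ℝ) (ζ : ι → Fin n → ℂ) : Prop :=
  ∀ ω : ℂ, ω ^ (n + 1) = 1 → ∃ z : ι → ℂ, Tendsto z l (𝓝 ω) ∧
    RootEq n s (fun k i => cf (ζ i) k) z ∧ ∀ i, ‖z i‖ ≤ 1

theorem esym_OO (hs : Tendsto s l (𝓝 0)) (h1 : ∀ j, OO l s 1 fun i => ζ i j) {a k : ℕ}
    (hk : a ≤ k) : OO l s a fun i => esym (ζ i) k := by
  have := OO.esym h1 k
  rw [one_mul] at this
  exact this.mono hs hk

theorem tendsto_of_norm_pow_le {f : ι → ℂ} {g : ι → ℝ} {N : ℕ}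
    (h : ∀ i, ‖f i‖ ^ N ≤ g i) (hg : Tendsto g l (𝓝 0)) : Tendsto f l (𝓝 0) := by
  rw [tendsto_zero_iff_norm_tendsto_zero]
  have h1 : Tendsto (fun i => ‖f i‖ ^ N) l (𝓝 0) :=
    squeeze_zero (fun i => by positivity) h hg
  rw [Metric.tendsto_nhds] at h1 ⊢
  intro e he
  filter_upwards [h1 (e ^ N) (pow_pos he N)] with i hi
  rw [dist_zero_right, norm_pow, norm_norm] at hi
  rw [dist_zero_right, norm_norm]
  exact lt_of_pow_lt_pow_left₀ N he.le hi

theorem tendsto_defect (hs : Tendsto s l (𝓝 0)) (h1 : ∀ j, OO l s 1 fun i => ζ i j)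
    (z : ι → ℂ) (hz : OO l s 0 z) : Tendsto (fun i => (1 - (1 - (s i : ℂ) ^ 2) ^ (n + 1)) -
      ∑ k ∈ Finset.Icc 1 n, cf (ζ i) k * (z i ^ (n + 1 - k) - (1 - (s i : ℂ) ^ 2) ^ (n + 1 - k)))
      l (𝓝 0) := by
  have hb : OO l s 0 fun i => 1 - (s i : ℂ) ^ 2 :=
    (OO.const 1).sub ((OO.selfC 2).mono hs (by norm_num))
  refine OO.tendsto (k := 1) hs (OO.sub ?_ (OO.sum fun k hk => ?_)) le_rfl
  · refine (((eps_pow_OO hs (n + 1)).mono hs (by norm_num)).sub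
      (((OO.selfC 2).mono hs (by norm_num : 1 ≤ 2)).const_mul ((n + 1 : ℕ) : ℂ))).neg.congr
      fun i => by ring
  · refine (cf_OO (esym_OO hs h1 (Finset.mem_Icc.1 hk).1)).mul' (b := 0) ?_ hs le_rfl
    exact ((hz.pow _).mono hs (Nat.zero_le _)).sub ((hb.pow _).mono hs (Nat.zero_le _))

-- At z = ω the expression of `tendsto_defect` is P(ω), which tends to 0; hence by
-- `exists_root_near` the nearest root converges to ω.
open Polynomial in
theorem exists_root_tendsto (hs : Tendsto s l (𝓝 0)) (h1 : ∀ j, OO l s 1 fun i => ζ i j)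
    {P : ι → ℂ[X]} (hP : ∀ i, (P i).derivative = C ((n : ℂ) + 1) * ∏ j, (X - C (ζ i j)))
    (hm : ∀ i, (P i).Monic) (hd : ∀ i, (P i).natDegree = n + 1)
    (hβ : ∀ i, (P i).eval (1 - (s i : ℂ) ^ 2) = 0) {ω : ℂ} (hω : ω ^ (n + 1) = 1) :
    ∃ z : ι → ℂ, Tendsto z l (𝓝 ω) ∧ RootEq n s (fun k i => cf (ζ i) k) z ∧
      ∀ i, (P i).eval (z i) = 0 := by
  have hex := fun i => exists_root_near (hm i) (by rw [hd i]; omega) ω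
  choose z hz0 hz using hex
  have hev : ∀ i w, (P i).eval w = _ := fun i w => eval_of_derivative_eq (ζ i) (hP i) (hβ i) w
  refine ⟨z, ?_, fun i => ?_, hz0⟩
  · have h2 := (tendsto_defect hs h1 (fun _ => ω) (OO.const ω)).norm
    rw [norm_zero] at h2
    have h3 := tendsto_of_norm_pow_le (f := fun i => ω - z i) (N := n + 1)
      (fun i => (by
        have := hz i
        rw [hd i, hev i, hω] at this
        exact this)) h2
    simpa using h3.const_sub ω
  · have := hev i (z i)
    rw [hz0 i] at this
    exact (sub_eq_zero.1 this.symm)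

open Polynomial in
theorem constrained_of_polynomials (hs : Tendsto s l (𝓝 0)) (h1 : ∀ j, OO l s 1 fun i => ζ i j)
    {P : ι → ℂ[X]} (hP : ∀ i, (P i).derivative = C ((n : ℂ) + 1) * ∏ j, (X - C (ζ i j)))
    (hm : ∀ i, (P i).Monic) (hd : ∀ i, (P i).natDegree = n + 1)
    (hβ : ∀ i, (P i).eval (1 - (s i : ℂ) ^ 2) = 0)
    (hr : ∀ i z, (P i).eval z = 0 → ‖z‖ ≤ 1) : Constrained l s ζ := fun ω hω => by
  obtain ⟨z, hz, he, h0⟩ := exists_root_tendsto hs h1 hP hm hd hβ hω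
  exact ⟨z, hz, he, fun i => hr i _ (h0 i)⟩

theorem normSq_pow_le_one {z : ℂ} (hz : ‖z‖ ≤ 1) (N : ℕ) : Complex.normSq (z ^ N) ≤ 1 := by
  rw [← Complex.sq_norm, norm_pow]
  exact pow_le_one₀ (by positivity) (pow_le_one₀ (norm_nonneg _) hz)

theorem re_pow_le_one {z : ℂ} (hz : ‖z‖ ≤ 1) (N : ℕ) : (z ^ N).re ≤ 1 :=
  (Complex.re_le_norm _).trans (by rw [norm_pow]; exact pow_le_one₀ (norm_nonneg _) hz)

theorem conj_mul_self_of_pow {ω : ℂ} (hω : ω ^ (n + 1) = 1) : (starRingEnd ℂ) ω * ω = 1 := by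
  rw [mul_comm, Complex.mul_conj, Complex.normSq_apply]
  have : ω.re * ω.re + ω.im * ω.im = 1 := by nlinarith [re_sq_add_im_sq hω]
  rw [this, Complex.ofReal_one]

/-- First order data of a family of critical points satisfying the root constraints. -/
structure Near (l : Filter ι) (s : ι → ℝ) (ζ : ι → Fin n → ℂ) : Prop where
  O_one : ∀ j, OO l s 1 fun i => ζ i j
  re_O : ∀ j, OO l s 2 fun i => (ζ i j).re
  con : Constrained l s ζ

theorem exists_root_re_u₁ (hn : 3 ≤ n) :
    ∃ ω : ℂ, ω ^ (n + 1) = 1 ∧ ω.re = u₁ n ∧ ω.im ≠ 0 := by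
  obtain ⟨ω, hω, hre⟩ := exists_root_of_unity n ((n + 1) / 3)
  rw [← u₁_eq] at hre
  refine ⟨ω, hω, hre, fun h => ?_⟩
  have := re_sq_add_im_sq hω
  rw [h, hre] at this
  have h1 := u₁_lt_one hn
  have h2 := u₂_lt_u₁ hn
  have h3 := neg_one_le_u₂ n
  nlinarith

theorem exists_root_re_u₂ (n : ℕ) : ∃ ω : ℂ, ω ^ (n + 1) = 1 ∧ ω.re = u₂ n := by
  obtain ⟨ω, hω, hre⟩ := exists_root_of_unity n ((n + 1) / 3 + 1)
  rw [← u₂_eq] at hre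
  exact ⟨ω, hω, hre⟩

namespace Near

variable (hs : Tendsto s l (𝓝 0)) (hs0 : ∀ᶠ i in l, 0 ≤ s i)

theorem esym_one_re (h : Near l s ζ) : OO l s 2 fun i => (esym (ζ i) 1).re :=
  (OO.sum (S := Finset.univ) fun j _ => h.re_O j).congr fun i => by
    rw [esym_one, psum, Complex.re_sum]; simp only [pow_one]

include hs in
theorem mono_O (h : Near l s ζ) (a b k : ℕ) (hk : k ≤ 2 * a + b) :
    OO l s k fun i => ∑ j, (ζ i j).re ^ a * (ζ i j).im ^ b :=
  OO.sum fun j _ => ((h.re_O j).rpow a).mul' ((h.O_one j).im.rpow b) hs (by omega)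

-- At order s the modulus constraint involves only Im ω · Im e₁. The constraints at ω and at its
-- conjugate bound this from both sides.
include hs hs0 in
theorem esym_one_im (h : Near l s ζ) (hn : 3 ≤ n) : OO l s 2 fun i => (esym (ζ i) 1).im := by
  have key : ∀ ω : ℂ, ω ^ (n + 1) = 1 → UB l s 2 fun i => ω.im * (esym (ζ i) 1).im := by
    intro ω hω
    obtain ⟨z, hz, hr, hz1⟩ := h.con ω hω
    set o : ℂ := (starRingEnd ℂ) ω with ho
    obtain ⟨-, hg⟩ := root_first_order (o := o) (a := 1) le_rfl (by norm_num) hs (conj_mul_self_of_pow hω)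
      hω hz hr (fun k hk => cf_OO (esym_OO hs h.O_one hk))
    have hrest : OO l s 2 fun i => ∑ k ∈ Finset.Ioc 1 n, cf (ζ i) k * (o ^ k - 1) :=
      OO.sum fun k hk => (cf_OO (esym_OO hs h.O_one (Finset.mem_Ioc.1 hk).1)).mul_const _
    have h1 := ((hg.re.add hrest.re).sub
      (OO.self' hs ((n : ℝ) + 1) le_rfl)).sub ((h.esym_one_re).const_mul
        ((n + 1) / n * (1 - ω.re)))
    have h2 : UB l s 2 fun i => (z i ^ (n + 1) - 1).re :=
      UB.of_le (Eventually.of_forall fun i => by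
        rw [Complex.sub_re, Complex.one_re]; linarith [re_pow_le_one (hz1 i) (n + 1)])
    have hn0 : (0 : ℝ) < n := by positivity
    refine ((h2.add (h1.neg.ub hs0)).const_mul (c := n / (n + 1)) (by positivity)).congr
      fun i => ?_
    have e1 : (cf (ζ i) 1 * (o ^ 1 - 1)).re =
        (n + 1) / n * ((esym (ζ i) 1).re * (ω.re - 1) + (esym (ζ i) 1).im * ω.im) := by
      rw [pow_one, cf_eq, re_ofReal_mul_mul, ho, Complex.conj_re, Complex.conj_im]
      push_cast
      rw [show (n : ℝ) + 1 - 1 = n by ring]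
      ring
    have e2 : (((n : ℂ) + 1) * (s i : ℂ) ^ 2).re = (n + 1) * s i ^ 2 := by
      rw [← Complex.ofReal_pow, Complex.re_mul_ofReal]; simp
    rw [← Finset.add_sum_Ioc_eq_sum_Icc (by omega : 1 ≤ n), Complex.sub_re _ (_ + _ : ℂ),
      Complex.add_re (cf _ _ * _), Complex.add_re (_ - 1 : ℂ), e1, e2]
    field_simp
    ring
  obtain ⟨ω, hω, -, him⟩ := exists_root_re_u₁ hn
  have k1 := key ω hω
  have k2 := key _ (conj_pow_eq_one hω)
  have k3 := UB.antisymm hs0 k1 (k2.congr fun i => by rw [Complex.conj_im]; ring)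
  exact (k3.const_mul ω.im⁻¹).congr fun i => by field_simp

include hs hs0 in
theorem esym_one_O (h : Near l s ζ) (hn : 3 ≤ n) : OO l s 2 fun i => esym (ζ i) 1 :=
  OO.of_re_im (h.esym_one_re) (h.esym_one_im hs hs0 hn)

include hs hs0 in
theorem cf_O (h : Near l s ζ) (hn : 3 ≤ n) (k : ℕ) (hk : 1 ≤ k) :
    OO l s 2 fun i => cf (ζ i) k := by
  refine cf_OO ?_
  rcases hk.eq_or_lt with rfl | hk
  · exact h.esym_one_O hs hs0 hn
  · exact esym_OO hs h.O_one hk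

include hs in
theorem psum_two_O (h : Near l s ζ) : OO l s 2 fun i => psum (ζ i) 2 :=
  OO.sum fun j _ => ((h.O_one j).pow 2).mono hs (by norm_num)

include hs hs0 in
theorem esym_two_im (h : Near l s ζ) (hn : 3 ≤ n) : OO l s 3 fun i => (esym (ζ i) 2).im := by
  have h1 := h.esym_one_O hs hs0 hn
  have h2 := (h1.mul' h1 hs (by norm_num : 3 ≤ 2 + 2)).im
  have h3 : OO l s 3 fun i => (psum (ζ i) 2).im := by
    refine ((h.mono_O hs 1 1 3 (by norm_num)).const_mul 2).congr fun i => ?_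
    simp only [psum, Complex.im_sum, im_sq, pow_one, mul_assoc, ← Finset.mul_sum]
  refine ((h2.sub h3).const_mul (1 / 2)).congr fun i => ?_
  rw [esym_two, pow_two, Complex.div_ofNat_im, Complex.sub_im]
  ring

include hs hs0 in
theorem esym_three_re (h : Near l s ζ) (hn : 3 ≤ n) : OO l s 4 fun i => (esym (ζ i) 3).re := by
  have h1 := h.esym_one_O hs hs0 hn
  have h2 : OO l s 2 fun i => esym (ζ i) 2 := esym_OO hs h.O_one le_rfl
  have a1 := (h2.mul' h1 hs (by norm_num : 4 ≤ 2 + 2)).re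
  have a2 := (h1.mul' (h.psum_two_O hs) hs (by norm_num : 4 ≤ 2 + 2)).re
  have a3 : OO l s 4 fun i => (psum (ζ i) 3).re := by
    refine ((h.mono_O hs 3 0 4 (by norm_num)).sub
      ((h.mono_O hs 1 2 4 (by norm_num)).const_mul 3)).congr fun i => ?_
    simp only [psum, Complex.re_sum, re_cube, pow_one, pow_zero, mul_one, mul_assoc,
      Finset.sum_sub_distrib, ← Finset.mul_sum]
  refine (((a1.sub a2).add a3).const_mul (1 / 3)).congr fun i => ?_
  rw [esym_three, Fam.re_div3]; ring

/-- The contribution of the imaginary parts of the first symmetric functions. -/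
noncomputable def J (ζ : Fin n → ℂ) (u : ℝ) : ℝ :=
  (esym ζ 1).im / n - 2 * u * (esym ζ 2).im / (n - 1) + (4 * u ^ 2 - 1) * (esym ζ 3).im / (n - 2)

/-- The first order expansion of the modulus of a root. -/
noncomputable def conFirst (t : ℝ) (ζ : Fin n → ℂ) (ω : ℂ) : ℝ :=
  -t ^ 2 + -(esym ζ 1).re / n * (1 - ω.re)
    + 2 * ((esym ζ 2).re / (n - 1)) * (1 - ω.re ^ 2) + ω.im * J ζ ω.re

-- All coefficients are now O(s²), so the error of the first order expansion is O(s⁴). Re e₃ and e_k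
-- with k ≥ 4 are also O(s⁴), which leaves the real and imaginary parts of e₁ and e₂, and Im e₃.
include hs hs0 in
theorem conFirst_ub (h : Near l s ζ) (hn : 3 ≤ n) {ω : ℂ} (hω : ω ^ (n + 1) = 1) :
    UB l s 4 fun i => conFirst (s i) (ζ i) ω := by
  obtain ⟨z, hz, hr, hz1⟩ := h.con ω hω
  have h3 : (3 : ℝ) ≤ n := by exact_mod_cast hn
  set o : ℂ := (starRingEnd ℂ) ω with ho
  obtain ⟨-, hg⟩ := root_first_order (o := o) (a := 2) (by norm_num) le_rfl hs (conj_mul_self_of_pow hω)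
    hω hz hr (h.cf_O hs hs0 hn)
  have hck : ∀ k, 4 ≤ k → OO l s 4 fun i => cf (ζ i) k * (o ^ k - 1) := fun k hk =>
    (cf_OO (esym_OO hs h.O_one hk)).mul_const _
  have hrest : OO l s 4 fun i => ∑ k ∈ Finset.Icc 6 (n + 6), cf (ζ i) k * (o ^ k - 1) :=
    OO.sum fun k hk => hck k (by have := (Finset.mem_Icc.1 hk).1; omega)
  have h2 : UB l s 4 fun i => (z i ^ (n + 1) - 1).re :=
    UB.of_le (Eventually.of_forall fun i => by
      rw [Complex.sub_re, Complex.one_re]; linarith [re_pow_le_one (hz1 i) (n + 1)])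
  have htot := (((hg.re.add hrest.re).add (hck 5 (by norm_num)).re).add
    (hck 4 le_rfl).re).add ((h.esym_three_re hs hs0 hn).const_mul
      ((n + 1) / (n - 2) * ((o ^ 3).re - 1)))
  refine ((h2.add (htot.neg.ub hs0)).const_mul (c := 1 / (n + 1)) (by positivity)).congr
    fun i => ?_
  have hv : o.im ^ 2 = 1 - o.re ^ 2 := by
    have := re_sq_add_im_sq hω
    rw [ho, Complex.conj_re, Complex.conj_im]; linarith
  have hr2 : (o ^ 2).re = 2 * o.re ^ 2 - 1 := by rw [re_sq]; linarith
  have hi2 : (o ^ 2).im = 2 * o.re * o.im := im_sq o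
  have hi3 : (o ^ 3).im = (4 * o.re ^ 2 - 1) * o.im := by
    rw [im_cube]; linear_combination (-o.im) * hv
  have e2 : (((n : ℂ) + 1) * (s i : ℂ) ^ 2).re = (n + 1) * s i ^ 2 := by
    rw [← Complex.ofReal_pow, Complex.re_mul_ofReal]; simp
  have f1 : (cf (ζ i) 1 * (o - 1)).re = (n + 1) / n * ((esym (ζ i) 1).re * (o.re - 1)
      - (esym (ζ i) 1).im * o.im) := by
    rw [cf_eq, re_ofReal_mul_mul]; push_cast
    rw [show (n : ℝ) + 1 - 1 = n by ring]; ring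
  have f2 : (cf (ζ i) 2 * (o ^ 2 - 1)).re = -((n + 1) / (n - 1)) * ((esym (ζ i) 2).re *
      ((o ^ 2).re - 1) - (esym (ζ i) 2).im * (o ^ 2).im) := by
    rw [cf_eq, re_ofReal_mul_mul]; push_cast
    rw [show (n : ℝ) + 1 - 2 = n - 1 by ring]; ring
  have f3 : (cf (ζ i) 3 * (o ^ 3 - 1)).re = (n + 1) / (n - 2) * ((esym (ζ i) 3).re *
      ((o ^ 3).re - 1) - (esym (ζ i) 3).im * (o ^ 3).im) := by
    rw [cf_eq, re_ofReal_mul_mul]; push_cast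
    rw [show (n : ℝ) + 1 - 3 = n - 2 by ring]; ring
  rw [sum_cf_split, conFirst, J]
  simp only [Complex.sub_re _ (_ + _ : ℂ), Complex.add_re _ (Finset.sum _ _),
    Complex.add_re _ (cf _ _ * _), Complex.add_re _ ((_ + _) * _ ), e2, f1, f2, f3, hr2, hi2, hi3]
  rw [ho, Complex.conj_re, Complex.conj_im]
  have n2 : (n : ℝ) - 2 ≠ 0 := by linarith
  have n1 : (n : ℝ) - 1 ≠ 0 := by linarith
  have n0 : (n : ℝ) ≠ 0 := by linarith
  field_simp
  ring

end Near

end Upper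

/-! ### Extremal families to first order -/

section Extremal

variable {n : ℕ} {ι : Type*} {l : Filter ι} {s : ι → ℝ} {ζ : ι → Fin n → ℂ} {r : ι → ℝ}

theorem UB.split {k : ℕ} {f g : ι → ℝ} (hs0 : ∀ᶠ i in l, 0 ≤ s i) (hf : UB l s k f)
    (hg : UB l s k g) (h : OO l s k fun i => f i + g i) : OO l s k f ∧ OO l s k g := by
  have h' := h.neg.ub hs0
  exact ⟨UB.antisymm hs0 hf ((h'.add hg).congr fun i => by ring),
    UB.antisymm hs0 hg ((h'.add hf).congr fun i => by ring)⟩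

/-- A family of critical points at distance at least `r` from `1 - s ^ 2`, where `r` is at least
the value of the linear program. -/
structure Extremal (l : Filter ι) (s : ι → ℝ) (ζ : ι → Fin n → ℂ) (r : ι → ℝ) : Prop where
  near : Near l s ζ
  nonneg : ∀ i, 0 ≤ r i
  le_dist : ∀ i j, r i ≤ ‖1 - (s i : ℂ) ^ 2 - ζ i j‖
  lower : UB l s 4 fun i => 1 + (rho n (lpA n) (lpB n) - 1) * s i ^ 2 - r i

/-- The excess of the squared distance of a critical point. -/
noncomputable def slack (t r : ℝ) (z : ℂ) : ℝ := (1 - t ^ 2 - z.re) ^ 2 + z.im ^ 2 - r ^ 2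

theorem norm_sq_eq_slack (t r : ℝ) (z : ℂ) : ‖1 - (t : ℂ) ^ 2 - z‖ ^ 2 = slack t r z + r ^ 2 := by
  have e1 : (1 - (t : ℂ) ^ 2 - z).re = 1 - t ^ 2 - z.re := by simp [← Complex.ofReal_pow]
  have e2 : (1 - (t : ℂ) ^ 2 - z).im = -z.im := by simp [← Complex.ofReal_pow]
  rw [Complex.sq_norm, Complex.normSq_apply, e1, e2, slack]; ring

theorem slack_nonneg {t r : ℝ} {z : ℂ} (hr : 0 ≤ r) (h : r ≤ ‖1 - (t : ℂ) ^ 2 - z‖) :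
    0 ≤ slack t r z := by
  have h1 := pow_le_pow_left₀ hr h 2
  rw [norm_sq_eq_slack t r] at h1
  linarith

theorem sum_im_sq (ζ : Fin n → ℂ) : ∑ j, (ζ j).im ^ 2 =
    ∑ j, (ζ j).re ^ 2 - (esym ζ 1).re ^ 2 + (esym ζ 1).im ^ 2 + 2 * (esym ζ 2).re := by
  have h1 : (psum ζ 2).re = ∑ j, (ζ j).re ^ 2 - ∑ j, (ζ j).im ^ 2 := by
    simp only [psum, Complex.re_sum, re_sq, Finset.sum_sub_distrib]
  have h2 : (esym ζ 2).re = ((esym ζ 1).re ^ 2 - (esym ζ 1).im ^ 2 - (psum ζ 2).re) / 2 := by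
    rw [esym_two ζ, esym_one, Complex.div_ofNat_re, Complex.sub_re, re_sq]
  rw [h2, h1]; ring

theorem sum_re_eq (ζ : Fin n → ℂ) : ∑ j, (ζ j).re = (esym ζ 1).re := by
  rw [esym_one, psum, Complex.re_sum]; simp only [pow_one]

theorem sum_slack (t r : ℝ) (ζ : Fin n → ℂ) : ∑ j, slack t r (ζ j) =
    n * (1 - t ^ 2) ^ 2 - 2 * (1 - t ^ 2) * (esym ζ 1).re + 2 * (esym ζ 2).re
      + 2 * ∑ j, (ζ j).re ^ 2 - (esym ζ 1).re ^ 2 + (esym ζ 1).im ^ 2 - n * r ^ 2 := by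
  have : ∑ j, slack t r (ζ j) = ∑ _j : Fin n, ((1 - t ^ 2) ^ 2 - r ^ 2)
      - 2 * (1 - t ^ 2) * ∑ j, (ζ j).re + ∑ j, (ζ j).re ^ 2 + ∑ j, (ζ j).im ^ 2 := by
    rw [Finset.mul_sum, ← Finset.sum_sub_distrib, ← Finset.sum_add_distrib,
      ← Finset.sum_add_distrib]
    exact Finset.sum_congr rfl fun j _ => by rw [slack]; ring
  rw [this, sum_im_sq, sum_re_eq, Finset.sum_const, Finset.card_univ, Fintype.card_fin,
    nsmul_eq_mul]
  ring

theorem conFirst_add_conj (t : ℝ) (ζ : Fin n → ℂ) (ω : ℂ) :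
    Near.conFirst t ζ ω + Near.conFirst t ζ ((starRingEnd ℂ) ω) = 2 * (-t ^ 2
      + -(esym ζ 1).re / n * (1 - ω.re) + 2 * ((esym ζ 2).re / (n - 1)) * (1 - ω.re ^ 2)) := by
  rw [Near.conFirst, Near.conFirst, Complex.conj_re, Complex.conj_im]; ring

theorem conFirst_sub_conj (t : ℝ) (ζ : Fin n → ℂ) (ω : ℂ) :
    Near.conFirst t ζ ω - Near.conFirst t ζ ((starRingEnd ℂ) ω) = 2 * (ω.im * Near.J ζ ω.re) := by
  rw [Near.conFirst, Near.conFirst, Complex.conj_re, Complex.conj_im]; ring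

namespace Extremal

variable (hs : Tendsto s l (𝓝 0)) (hs0 : ∀ᶠ i in l, 0 ≤ s i)

theorem lower_sq (h : Extremal l s ζ r) :
    UB l s 4 fun i => 1 + 2 * (rho n (lpA n) (lpB n) - 1) * s i ^ 2 - r i ^ 2 :=
  (h.lower.const_mul (c := 2) (by norm_num)).mono (Eventually.of_forall fun i => by
    nlinarith [sq_nonneg (r i - 1)])

-- Complementary slackness. Each of the six groups of terms in `key` is bounded above by a multiple
-- of s⁴, and by duality their weighted sum is O(s⁴), because the terms in s², e₁ and e₂ cancel.
-- Hence each is O(s⁴) on both sides.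
include hs hs0 in
theorem first_order (h : Extremal l s ζ r) (hn : 3 ≤ n) {ω₁ ω₂ : ℂ} (h₁ : ω₁ ^ (n + 1) = 1)
    (h₂ : ω₂ ^ (n + 1) = 1) (r₁ : ω₁.re = u₁ n) (r₂ : ω₂.re = u₂ n) :
    (OO l s 4 fun i => 1 + 2 * (rho n (lpA n) (lpB n) - 1) * s i ^ 2 - r i ^ 2) ∧
    (∀ j, OO l s 4 fun i => slack (s i) (r i) (ζ i j)) ∧
    (OO l s 4 fun i => Near.conFirst (s i) (ζ i) ω₁) ∧
    (OO l s 4 fun i => Near.conFirst (s i) (ζ i) ((starRingEnd ℂ) ω₁)) ∧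
    (OO l s 4 fun i => Near.conFirst (s i) (ζ i) ω₂) ∧
    (OO l s 4 fun i => Near.conFirst (s i) (ζ i) ((starRingEnd ℂ) ω₂)) := by
  have hn0 : (0 : ℝ) < n := by positivity
  have h3 : (3 : ℝ) ≤ n := by exact_mod_cast hn
  have hsl : ∀ j ∈ Finset.univ, UB l s 4 fun i => -slack (s i) (r i) (ζ i j) := fun j _ =>
    UB.of_le (Eventually.of_forall fun i => by
      linarith [slack_nonneg (h.nonneg i) (h.le_dist i j)])
  have hS := UB.sum hsl
  have hR := h.lower_sq.const_mul hn0.le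
  have hC : ∀ (ν : ℝ) (ω : ℂ), 0 < ν → ω ^ (n + 1) = 1 →
      UB l s 4 fun i => n * ν * Near.conFirst (s i) (ζ i) ω := fun ν ω hν hω =>
    (h.near.conFirst_ub hs hs0 hn hω).const_mul (by positivity)
  have c1 := hC _ _ (nu₁_pos hn) h₁
  have c2 := hC _ _ (nu₁_pos hn) (conj_pow_eq_one h₁)
  have c3 := hC _ _ (nu₂_pos hn) h₂
  have c4 := hC _ _ (nu₂_pos hn) (conj_pow_eq_one h₂)
  have hx : OO l s 2 fun i => (esym (ζ i) 1).re := h.near.esym_one_re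
  have hy := h.near.esym_one_im hs hs0 hn
  have hxx : OO l s 4 fun i => ∑ j, (ζ i j).re ^ 2 :=
    (h.near.mono_O hs 2 0 4 (by norm_num)).congr fun i => by simp
  have key : OO l s 4 fun i => n * (1 + 2 * (rho n (lpA n) (lpB n) - 1) * s i ^ 2 - r i ^ 2) +
      (∑ j, -slack (s i) (r i) (ζ i j) + (n * nu₁ n * Near.conFirst (s i) (ζ i) ω₁ +
        (n * nu₁ n * Near.conFirst (s i) (ζ i) ((starRingEnd ℂ) ω₁) +
          (n * nu₂ n * Near.conFirst (s i) (ζ i) ω₂ +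
            n * nu₂ n * Near.conFirst (s i) (ζ i) ((starRingEnd ℂ) ω₂))))) := by
    refine ((((OO.self' hs (-(n : ℝ)) (le_refl 4)).sub (((OO.self 2).mul' hx hs
      (by norm_num : 4 ≤ 2 + 2)).const_mul 2)).sub (hxx.const_mul 2)).add
      ((hx.mul' hx hs (by norm_num : 4 ≤ 2 + 2)).sub (hy.mul' hy hs
      (by norm_num : 4 ≤ 2 + 2)))).congr fun i => ?_
    have a1 := conFirst_add_conj (s i) (ζ i) ω₁
    have a2 := conFirst_add_conj (s i) (ζ i) ω₂
    rw [r₁] at a1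
    rw [r₂] at a2
    have e0 := nu_sum hn
    have e1 := nu_sum_one hn
    have e2 := nu_sum_two hn
    have e3 : (esym (ζ i) 1).re / n * n = (esym (ζ i) 1).re := div_mul_cancel₀ _ hn0.ne'
    have e4 : (esym (ζ i) 2).re / (n - 1) * (n - 1) = (esym (ζ i) 2).re :=
      div_mul_cancel₀ _ (by linarith)
    have e2' : nu₁ n * (1 - u₁ n ^ 2) * n + nu₂ n * (1 - u₂ n ^ 2) * n = ((n : ℝ) - 1) / 2 := by
      rw [← add_mul, e2]; field_simp
    rw [Finset.sum_neg_distrib, sum_slack]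
    linear_combination (n * nu₁ n) * a1 + (n * nu₂ n) * a2 - 2 * n * s i ^ 2 * e0
      - 2 * n * ((esym (ζ i) 1).re / n) * e1 + 4 * ((esym (ζ i) 2).re / (n - 1)) * e2'
      - 2 * e3 + 2 * e4
  obtain ⟨k1, key⟩ := UB.split hs0 hR (hS.add (c1.add (c2.add (c3.add c4)))) key
  obtain ⟨k2, key⟩ := UB.split hs0 hS (c1.add (c2.add (c3.add c4))) key
  obtain ⟨k3, key⟩ := UB.split hs0 c1 (c2.add (c3.add c4)) key
  obtain ⟨k4, key⟩ := UB.split hs0 c2 (c3.add c4) key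
  obtain ⟨k5, k6⟩ := UB.split hs0 c3 c4 key
  have n1 := (nu₁_pos hn).ne'
  have n2 := (nu₂_pos hn).ne'
  have hn0' := hn0.ne'
  refine ⟨(k1.const_mul (n : ℝ)⁻¹).congr fun i => by field_simp, fun j => ?_,
    (k3.const_mul (n * nu₁ n)⁻¹).congr fun i => by field_simp,
    (k4.const_mul (n * nu₁ n)⁻¹).congr fun i => by field_simp,
    (k5.const_mul (n * nu₂ n)⁻¹).congr fun i => by field_simp,
    (k6.const_mul (n * nu₂ n)⁻¹).congr fun i => by field_simp⟩
  have := UB.each hs0 hsl (k2.neg.ub hs0) (Finset.mem_univ j)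
  exact this.neg.congr fun i => by ring

-- Vanishing slack expresses x_j through y_j. The even parts of the two active constraints determine
-- X and Y modulo s⁴, since u₁ ≠ u₂. The odd part at u₁, where Im ω ≠ 0, gives ∑ y_j = O(s³).
include hs hs0 in
theorem fam_five (h : Extremal l s ζ r) (hn : 3 ≤ n) : Fam l s ζ (lpA n) (lpB n) 5 := by
  obtain ⟨ω₁, h₁, r₁, i₁⟩ := exists_root_re_u₁ hn
  obtain ⟨ω₂, h₂, r₂⟩ := exists_root_re_u₂ n
  obtain ⟨kr, ksl, k1, k1', k2, k2'⟩ := h.first_order hs hs0 hn h₁ h₂ r₁ r₂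
  have h3 : (3 : ℝ) ≤ n := by exact_mod_cast hn
  have hn0 : (n : ℝ) ≠ 0 := by positivity
  have hn1 : (n : ℝ) - 1 ≠ 0 := by linarith
  have g1 : 1 - u₁ n ≠ 0 := by linarith [u₁_lt_one hn]
  have g2 : 1 - u₂ n ≠ 0 := by linarith [u₂_lt_one hn]
  have g3 : u₁ n - u₂ n ≠ 0 := by linarith [u₂_lt_u₁ hn]
  have hx : OO l s 2 fun i => (esym (ζ i) 1).re := h.near.esym_one_re
  have hy := h.near.esym_one_im hs hs0 hn
  have hxx : OO l s 4 fun i => ∑ j, (ζ i j).re ^ 2 :=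
    (h.near.mono_O hs 2 0 4 (by norm_num)).congr fun i => by simp
  have d1 : OO l s 4 fun i => (-(esym (ζ i) 1).re / n - lpA n * s i ^ 2)
      + 2 * (1 + u₁ n) * ((esym (ζ i) 2).re / (n - 1) - lpB n * s i ^ 2) := by
    refine ((k1.add k1').const_mul (1 / (2 * (1 - u₁ n)))).congr fun i => ?_
    rw [conFirst_add_conj, r₁]
    field_simp
    linear_combination (-(n * (n - 1) * s i ^ 2)) * lp_active₁ hn
  have d2 : OO l s 4 fun i => (-(esym (ζ i) 1).re / n - lpA n * s i ^ 2)
      + 2 * (1 + u₂ n) * ((esym (ζ i) 2).re / (n - 1) - lpB n * s i ^ 2) := by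
    refine ((k2.add k2').const_mul (1 / (2 * (1 - u₂ n)))).congr fun i => ?_
    rw [conFirst_add_conj, r₂]
    field_simp
    linear_combination (-(n * (n - 1) * s i ^ 2)) * lp_active₂ hn
  have hY : OO l s 4 fun i => (esym (ζ i) 2).re / (n - 1) - lpB n * s i ^ 2 :=
    ((d1.sub d2).const_mul (1 / (2 * (u₁ n - u₂ n)))).congr fun i => by field_simp; ring
  refine ⟨fun j => (h.near.O_one j).im, fun j => ?_, ?_, ?_, ?_⟩
  · have hxj := h.near.re_O j
    refine ((((OO.self' hs (1 : ℝ) (le_refl 4)).add (((OO.self 2).mul' hxj hs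
      (by norm_num : 4 ≤ 2 + 2)).const_mul 2)).add ((hxj.mul' hxj hs
      (by norm_num : 4 ≤ 2 + 2)).add (kr))).sub (ksl j)).const_mul (1 / 2) |>.congr fun i => ?_
    rw [slack]; ring
  · refine ((hxx.sub ((hx.mul' hx hs (by norm_num : 4 ≤ 2 + 2)).sub (hy.mul' hy hs
      (by norm_num : 4 ≤ 2 + 2)))).add (hY.const_mul (2 * (n - 1)))).congr fun i => ?_
    rw [sum_im_sq]
    field_simp
    ring
  · have hJ : OO l s 4 fun i => Near.J (ζ i) (u₁ n) := by
      refine ((k1.sub k1').const_mul (1 / (2 * ω₁.im))).congr fun i => ?_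
      rw [conFirst_sub_conj, r₁]; field_simp
    have e2 := h.near.esym_two_im hs hs0 hn
    have e3 : OO l s 3 fun i => (esym (ζ i) 3).im := (esym_OO hs h.near.O_one le_rfl).im
    refine (((hJ.mono hs (by norm_num : 3 ≤ 4)).add (e2.const_mul (2 * u₁ n / (n - 1)))).sub
      (e3.const_mul ((4 * u₁ n ^ 2 - 1) / (n - 2)))).const_mul (n : ℝ) |>.congr fun i => ?_
    rw [← Fam.esym_one_im, Near.J]
    field_simp
    ring
  · exact (h.near.mono_O hs 0 3 3 (by norm_num)).congr fun i => by simp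

-- When u₂ ≠ -1 the odd parts at u₁ and at u₂ give two linear equations for ∑ y_j and ∑ y_j³ modulo
-- s⁴, and these are independent.
include hs hs0 in
theorem fam_six (h : Extremal l s ζ r) (hn : 3 ≤ n) (hn3 : n ≠ 3) (hn5 : n ≠ 5) :
    Fam l s ζ (lpA n) (lpB n) 6 := by
  have hF := h.fam_five hs hs0 hn
  obtain ⟨ω₁, h₁, r₁, i₁⟩ := exists_root_re_u₁ hn
  obtain ⟨ω₂, h₂, r₂⟩ := exists_root_re_u₂ n
  have h3 : (3 : ℝ) ≤ n := by exact_mod_cast hn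
  have hn0 : (n : ℝ) ≠ 0 := by positivity
  have i₂ : ω₂.im ≠ 0 := by
    intro h0
    have e := re_sq_add_im_sq h₂
    rw [h0, r₂] at e
    have e1 : (1 - u₂ n) * (1 + u₂ n) = 0 := by linarith
    rcases mul_eq_zero.1 e1 with e2 | e2
    · linarith [u₂_lt_one hn]
    · exact u₂_ne_neg_one hn hn3 hn5 (by linarith)
  obtain ⟨-, -, k1, k1', k2, k2'⟩ := h.first_order hs hs0 hn h₁ h₂ r₁ r₂
  have a2 := (hF.esym_two_im hs le_rfl hn0).mono hs (by norm_num : 4 ≤ 5)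
  have a3 := (hF.esym_three_im hs le_rfl hn0).mono hs (by norm_num : 4 ≤ 5)
  have hJ : ∀ u : ℝ, (OO l s 4 fun i => Near.J (ζ i) u) → OO l s 4 fun i =>
      (∑ j, (ζ i j).im) / n + (u / (n - 1) - (4 * u ^ 2 - 1) / (3 * (n - 2)))
        * ∑ j, (ζ i j).im ^ 3 := fun u hu => by
    refine ((hu.add (a2.const_mul (2 * u / (n - 1)))).sub
      (a3.const_mul ((4 * u ^ 2 - 1) / (n - 2)))).congr fun i => ?_
    rw [← Fam.esym_one_im, Near.J]
    have n2 : (n : ℝ) - 2 ≠ 0 := by linarith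
    have n1 : (n : ℝ) - 1 ≠ 0 := by linarith
    field_simp
    ring
  have j1 := hJ (u₁ n) (((k1.sub k1').const_mul (1 / (2 * ω₁.im))).congr fun i => by
      rw [conFirst_sub_conj, r₁]; field_simp)
  have j2 := hJ (u₂ n) (((k2.sub k2').const_mul (1 / (2 * ω₂.im))).congr fun i => by
      rw [conFirst_sub_conj, r₂]; field_simp)
  have g3 : u₁ n - u₂ n ≠ 0 := by linarith [u₂_lt_u₁ hn]
  -- (u₁-u₂)c is the coefficient of ∑ y_j³ in the difference of the two equations; it is nonzero
  -- because u₁ + u₂ ≤ 0.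
  set c : ℝ := 1 / (n - 1) - 4 * (u₁ n + u₂ n) / (3 * (n - 2)) with hc
  have hc0 : 0 < c := by
    have q1 : 0 < 1 / ((n : ℝ) - 1) := one_div_pos.2 (by linarith)
    have q2 : 4 * (u₁ n + u₂ n) / (3 * ((n : ℝ) - 2)) ≤ 0 :=
      div_nonpos_of_nonpos_of_nonneg (by linarith [u₁_add_u₂_nonpos hn]) (by linarith)
    linarith
  have hτ : OO l s 4 fun i => ∑ j, (ζ i j).im ^ 3 := by
    refine ((j1.sub j2).const_mul ((u₁ n - u₂ n) * c)⁻¹).congr fun i => ?_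
    have : (∑ j, (ζ i j).im) / n + (u₁ n / (n - 1) - (4 * u₁ n ^ 2 - 1) / (3 * (n - 2)))
        * ∑ j, (ζ i j).im ^ 3 - ((∑ j, (ζ i j).im) / n + (u₂ n / (n - 1)
        - (4 * u₂ n ^ 2 - 1) / (3 * (n - 2))) * ∑ j, (ζ i j).im ^ 3) =
        (u₁ n - u₂ n) * c * ∑ j, (ζ i j).im ^ 3 := by rw [hc]; ring
    rw [this, inv_mul_cancel_left₀ (mul_ne_zero g3 hc0.ne')]
  refine ⟨hF.im_O, hF.re_exp, hF.sq, ?_, hτ⟩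
  exact ((j1.sub (hτ.const_mul (u₁ n / (n - 1) - (4 * u₁ n ^ 2 - 1) / (3 * (n - 2))))).const_mul
    (n : ℝ)).congr fun i => by field_simp; ring

end Extremal

end Extremal

/-! ### Extremal families to second order -/

section SecondOrder

variable {n m : ℕ} {ι : Type*} {l : Filter ι} {s : ι → ℝ} {ζ : ι → Fin n → ℂ} {r : ι → ℝ}

theorem UB.of_sq {k : ℕ} {t : ι → ℝ} (hs0 : ∀ᶠ i in l, 0 ≤ s i) (ht : Tendsto t l (𝓝 1))
    (h : UB l s k fun i => r i ^ 2 / 2 - t i ^ 2 / 2) : UB l s k fun i => r i - t i := by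
  obtain ⟨C, hC⟩ := h
  refine ⟨2 * |C|, ?_⟩
  filter_upwards [hC, hs0, ht.eventually (lt_mem_nhds (by norm_num : (1 / 2 : ℝ) < 1))]
    with i h1 h2 h3
  have hp := pow_nonneg h2 k
  have h4 : C * s i ^ k ≤ |C| * s i ^ k := mul_le_mul_of_nonneg_right (le_abs_self C) hp
  have h5 : 0 ≤ |C| * s i ^ k := by positivity
  by_contra! h6
  nlinarith [sq_nonneg (r i - t i)]

/-- The part of the second order expansion of the modulus which is even in the imaginary part. -/
noncomputable def conSecond (n : ℕ) (t q : ℝ) (ζ : Fin n → ℂ) (u : ℝ) : ℝ :=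
  -t ^ 2 + -(esym ζ 1).re / n * (1 - u) + 2 * ((esym ζ 2).re / (n - 1)) * (1 - u ^ 2)
    + conQ n u * q + conS n (lpA n) (lpB n) u * t ^ 4

namespace Extremal

variable (hs : Tendsto s l (𝓝 0)) (hs0 : ∀ᶠ i in l, 0 ≤ s i)

-- Averaging the constraints at ω and its conjugate removes the odd term `conJ`, whose size need not
-- be controlled here.
include hs hs0 in
theorem conSecond_ub (h : Extremal l s ζ r) (hF : Fam l s ζ (lpA n) (lpB n) m) (hm5 : 5 ≤ m)
    (hm6 : m ≤ 6) (hn : 3 ≤ n) {ω : ℂ} (hω : ω ^ (n + 1) = 1) :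
    UB l s m fun i => conSecond n (s i) (∑ j, (ζ i j).im ^ 4) (ζ i) ω.re := by
  have key : ∀ ω : ℂ, ω ^ (n + 1) = 1 → UB l s m fun i =>
      conSecond n (s i) (∑ j, (ζ i j).im ^ 4) (ζ i) ω.re + ω.im * conJ (ζ i) ω.re := by
    intro ω hω
    obtain ⟨z, hz, hr, hz1⟩ := h.near.con ω hω
    have h1 := con_expansion hF hs hm5 hm6 hn hω (re_sq_add_im_sq hω) hz hr
    have h2 : UB l s m fun i => (Complex.normSq (z i ^ (n + 1)) - 1) / (2 * (n + 1)) :=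
      UB.of_le (Eventually.of_forall fun i => div_nonpos_of_nonpos_of_nonneg
        (by linarith [normSq_pow_le_one (hz1 i) (n + 1)]) (by positivity))
    exact (h2.add (h1.neg.ub hs0)).congr fun i => by rw [conSecond]; ring
  refine (((key ω hω).add (key _ (conj_pow_eq_one hω))).const_mul
    (c := 1 / 2) (by norm_num)).congr fun i => ?_
  rw [Complex.conj_re, Complex.conj_im]; ring

-- Add the averaged squared distances, the second order constraints at u₁ and u₂ weighted by ν₁ and
-- ν₂, and the bound on κ ∑ y_j⁴. The exact values of X and Y cancel by the dual equations in the
-- linear terms. In the quadratic terms they may be replaced by their leading parts at cost O(s⁶).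
include hs hs0 in
theorem second_order (h : Extremal l s ζ r) (hF : Fam l s ζ (lpA n) (lpB n) m) (hm5 : 5 ≤ m)
    (hm6 : m ≤ 6) (hn : 3 ≤ n) {Q : ℝ}
    (hq : UB l s m fun i => kappa n * (∑ j, (ζ i j).im ^ 4 - Q * s i ^ 4)) :
    UB l s m fun i => r i -
      (1 + (rho n (lpA n) (lpB n) - 1) * s i ^ 2 + objC n Q * s i ^ 4) := by
  obtain ⟨ω₁, h₁, r₁, -⟩ := exists_root_re_u₁ hn
  obtain ⟨ω₂, h₂, r₂⟩ := exists_root_re_u₂ n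
  have hn0 : (n : ℝ) ≠ 0 := by positivity
  have h3 : (3 : ℝ) ≤ n := by exact_mod_cast hn
  have hn1 : (n : ℝ) - 1 ≠ 0 := by linarith
  have c1 := h.conSecond_ub hs hs0 hF hm5 hm6 hn h₁
  have c2 := h.conSecond_ub hs hs0 hF hm5 hm6 hn h₂
  rw [r₁] at c1
  rw [r₂] at c2
  have hc := (c1.const_mul (nu₁_pos hn).le).add (c2.const_mul (nu₂_pos hn).le)
  have x1 : OO l s 4 fun i => -(esym (ζ i) 1).re / n - lpA n * s i ^ 2 :=
    ((hF.psum_one_re hs hn0).const_mul (-1 / n)).congr fun i => by field_simp; ring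
  have x2 : OO l s 2 fun i => -(esym (ζ i) 1).re / n + lpA n * s i ^ 2 :=
    ((h.near.esym_one_re).const_mul (-1 / n)).add (OO.self' hs (lpA n) le_rfl) |>.congr
      fun i => by field_simp
  have x3 := (x1.mul' (OO.self 2) hs hm6).neg
  have x4 := (x1.mul' x2 hs hm6).const_mul (-(n : ℝ) / 2)
  have x5 := ((hF.sum_re_sq hs).mono hs hm6).const_mul (1 / (n : ℝ))
  have x6 := ((hF.psum_one_im hs hm5).mul' (hF.psum_one_im hs hm5) hs hm6).const_mul
    (1 / (2 * (n : ℝ)))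
  have hr : UB l s m fun i => -(∑ j, slack (s i) (r i) (ζ i j)) / (2 * n) :=
    UB.of_le (Eventually.of_forall fun i => div_nonpos_of_nonpos_of_nonneg
      (neg_nonpos.2 (Finset.sum_nonneg fun j _ => slack_nonneg (h.nonneg i) (h.le_dist i j)))
      (by positivity))
  have y1 := OO.self' hs (-((rho n (lpA n) (lpB n) - 1) * objC n Q)) hm6
  have y2 := OO.self' hs (-(objC n Q ^ 2 / 2)) (hm6.trans (by norm_num : 6 ≤ 8))
  refine UB.of_sq hs0 ?_ (((hr.add hc).add hq).add
    (((((x3.add x4).add x5).add x6).add (y1.add y2)).ub hs0) |>.congr fun i => ?_)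
  · have := ((hs.pow 2).const_mul (rho n (lpA n) (lpB n) - 1)).const_add 1 |>.add
      ((hs.pow 4).const_mul (objC n Q))
    simpa using this
  · rw [sum_slack, conSecond, conSecond, objC, kappa]
    set X := -(esym (ζ i) 1).re / n with hX
    set Y := (esym (ζ i) 2).re / (n - 1) with hY
    have eX : (esym (ζ i) 1).re = -(n * X) := by rw [hX]; field_simp
    have eY : (esym (ζ i) 2).re = (n - 1) * Y := by rw [hY]; field_simp
    rw [eX, eY]
    have e0 := nu_sum hn
    have e1 := nu_sum_one hn
    have e2 := nu_sum_two hn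
    have e2' : nu₁ n * (1 - u₁ n ^ 2) * n + nu₂ n * (1 - u₂ n ^ 2) * n = ((n : ℝ) - 1) / 2 := by
      rw [← add_mul, e2]; field_simp
    clear_value X Y
    clear hX hY eX eY hq hc c1 c2 x1 x2 x3 x4 x5 x6 hr y1 y2
    field_simp
    linear_combination (128 * (n : ℝ) ^ 2 * s i ^ 2) * e0 - (128 * (n : ℝ) ^ 2 * X) * e1
      - (256 * n * Y) * e2'

end Extremal

end SecondOrder

/-! ### Bounds for the fourth power sum -/

section PowerSums

variable {ι J : Type*} {n m : ℕ} {l : Filter ι} {s : ι → ℝ} {ζ : ι → Fin n → ℂ} {A B : ℝ}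

theorem sum_four_le_sq (S : Finset J) (y : J → ℝ) : ∑ j ∈ S, y j ^ 4 ≤ (∑ j ∈ S, y j ^ 2) ^ 2 := by
  rw [pow_two (∑ j ∈ S, y j ^ 2), Finset.sum_mul]
  refine Finset.sum_le_sum fun j hj => ?_
  have h1 := Finset.single_le_sum (f := fun j => y j ^ 2) (fun j _ => sq_nonneg (y j)) hj
  have := mul_le_mul_of_nonneg_left h1 (sq_nonneg (y j))
  nlinarith

theorem abs_sum_cube_le (S : Finset J) (y : J → ℝ) :
    |∑ j ∈ S, y j ^ 3| ≤ √(∑ j ∈ S, y j ^ 2) ^ 3 := by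
  set σ := √(∑ j ∈ S, y j ^ 2) with hσ
  have h0 : 0 ≤ ∑ j ∈ S, y j ^ 2 := Finset.sum_nonneg fun j _ => sq_nonneg _
  have h2 : σ ^ 3 = ∑ j ∈ S, σ * y j ^ 2 := by
    rw [← Finset.mul_sum, pow_succ', hσ, Real.sq_sqrt h0]
  rw [h2]
  refine (Finset.abs_sum_le_sum_abs _ _).trans (Finset.sum_le_sum fun j hj => ?_)
  have h1 := Finset.single_le_sum (f := fun j => y j ^ 2) (fun j _ => sq_nonneg (y j)) hj
  have h3 : |y j| ≤ σ := by
    rw [← Real.sqrt_sq_eq_abs]; exact Real.sqrt_le_sqrt h1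
  have : |y j ^ 3| = |y j| * y j ^ 2 := by rw [pow_succ', abs_mul, abs_pow, sq_abs]
  rw [this]
  exact mul_le_mul_of_nonneg_right h3 (sq_nonneg _)

/-- Let M be the largest |y_j| and σ² the sum of the squares of the others. If M ≤ σ, then 2∑ y⁴ ≤
2M² ∑ y² ≤ (∑ y²)². Otherwise the bracket is at most (M²-σ²)², while |∑ y³| ≥ M³ - σ³, and
(M²-σ²)²(M²+σ²) ≤ 4(M³-σ³)². Equality occurs for y = (1, -1, 0, …). -/
theorem fourth_power_sum_le [NeZero n] (y : Fin n → ℝ) :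
    (2 * ∑ j, y j ^ 4 - (∑ j, y j ^ 2) ^ 2) * ∑ j, y j ^ 2 ≤ 4 * (∑ j, y j ^ 3) ^ 2 := by
  obtain ⟨a, -, ha⟩ := Finset.exists_max_image Finset.univ (fun j => y j ^ 2)
    ⟨(0 : Fin n), Finset.mem_univ _⟩
  set R := Finset.univ.erase a with hR
  have hT := Finset.add_sum_erase Finset.univ (fun j => y j ^ 2) (Finset.mem_univ a)
  have hq := Finset.add_sum_erase Finset.univ (fun j => y j ^ 4) (Finset.mem_univ a)
  have hτ := Finset.add_sum_erase Finset.univ (fun j => y j ^ 3) (Finset.mem_univ a)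
  have h4 := sum_four_le_sq R y
  have h3 := abs_sum_cube_le R y
  have hS0 : 0 ≤ ∑ j ∈ R, y j ^ 2 := Finset.sum_nonneg fun j _ => sq_nonneg _
  have hmax : ∑ j, y j ^ 4 ≤ y a ^ 2 * ∑ j, y j ^ 2 := by
    rw [Finset.mul_sum]
    refine Finset.sum_le_sum fun j _ => ?_
    have := mul_le_mul_of_nonneg_right (ha j (Finset.mem_univ j)) (sq_nonneg (y j))
    nlinarith
  rw [← hT, ← hq] at hmax
  rw [← hT, ← hq, ← hτ]
  set q := ∑ j ∈ R, y j ^ 4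
  set S := ∑ j ∈ R, y j ^ 2
  set c := ∑ j ∈ R, y j ^ 3
  set σ := √S with hσ
  have hσ0 : 0 ≤ σ := Real.sqrt_nonneg _
  have hσS : S = σ ^ 2 := (Real.sq_sqrt hS0).symm
  set M := |y a| with hM
  have hM0 : 0 ≤ M := abs_nonneg _
  have hM2 : y a ^ 2 = M ^ 2 := (sq_abs _).symm
  have hM4 : y a ^ 4 = M ^ 4 := by
    rw [show y a ^ 4 = (y a ^ 2) ^ 2 by ring, hM2]; ring
  rw [hM2, hM4, hσS] at hmax
  rw [hσS] at h4
  rw [hM2, hM4, hσS]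
  rcases le_total M σ with hle | hle
  · have h5 : M ^ 2 ≤ σ ^ 2 := pow_le_pow_left₀ hM0 hle 2
    have h6 : 0 ≤ M ^ 2 + σ ^ 2 := by positivity
    have h7 : 2 * (M ^ 4 + q) - (M ^ 2 + σ ^ 2) ^ 2 ≤ 0 := by nlinarith
    nlinarith [mul_nonneg (neg_nonneg.2 h7) h6, sq_nonneg (y a ^ 3 + c)]
  · have h5 : M ^ 3 - σ ^ 3 ≤ |y a ^ 3 + c| := by
      have h6 : |y a ^ 3| = M ^ 3 := by rw [abs_pow]
      have h7 := abs_sub_abs_le_abs_sub (y a ^ 3) (-c)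
      rw [sub_neg_eq_add, abs_neg, h6] at h7
      linarith
    have h6 : 0 ≤ M ^ 3 - σ ^ 3 := sub_nonneg.2 (pow_le_pow_left₀ hσ0 hle 3)
    have h7 : (M ^ 3 - σ ^ 3) ^ 2 ≤ (y a ^ 3 + c) ^ 2 := by
      rw [← sq_abs (y a ^ 3 + c)]; exact pow_le_pow_left₀ h6 h5 2
    have h8 : (2 * (M ^ 4 + q) - (M ^ 2 + σ ^ 2) ^ 2) * (M ^ 2 + σ ^ 2) ≤
        (M ^ 2 - σ ^ 2) ^ 2 * (M ^ 2 + σ ^ 2) := by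
      refine mul_le_mul_of_nonneg_right ?_ (by positivity)
      nlinarith
    have h9 : (M ^ 2 - σ ^ 2) ^ 2 * (M ^ 2 + σ ^ 2) ≤ 4 * (M ^ 3 - σ ^ 3) ^ 2 := by
      have e1 : (M ^ 2 - σ ^ 2) ^ 2 * (M ^ 2 + σ ^ 2) =
          (M - σ) ^ 2 * ((M + σ) ^ 2 * (M ^ 2 + σ ^ 2)) := by ring
      have e2 : 4 * (M ^ 3 - σ ^ 3) ^ 2 = (M - σ) ^ 2 * (4 * (M ^ 2 + M * σ + σ ^ 2) ^ 2) := by ring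
      rw [e1, e2]
      refine mul_le_mul_of_nonneg_left ?_ (sq_nonneg _)
      have hp : 0 ≤ M * σ := mul_nonneg hM0 hσ0
      nlinarith [sq_nonneg (M - σ), mul_nonneg hp (add_nonneg (sq_nonneg M) (sq_nonneg σ))]
    linarith

/-- Sum the inequality (y-4a)(y+2a)(y+a)² ≤ 0. It has no cubic term, and it is an equality at the
extremal configuration (4a, -a, -a, -a, -a). -/
theorem fourth_power_sum_five_of_le (y : Fin 5 → ℝ) (hy : ∑ j, y j = 0) {a : ℝ}
    (ha : ∑ j, y j ^ 2 = 20 * a ^ 2) (h4 : ∀ j, y j ≤ 4 * a) (h2 : ∀ j, -(2 * a) ≤ y j) :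
    20 * ∑ j, y j ^ 4 ≤ 13 * (∑ j, y j ^ 2) ^ 2 := by
  have h : ∑ j, (y j ^ 4 - 11 * a ^ 2 * y j ^ 2 - 18 * a ^ 3 * y j - 8 * a ^ 4) ≤ 0 :=
    Finset.sum_nonpos fun j _ => by
      have h1 : 0 ≤ (4 * a - y j) * (y j + 2 * a) :=
        mul_nonneg (by linarith [h4 j]) (by linarith [h2 j])
      nlinarith [mul_nonneg h1 (sq_nonneg (y j + a))]
  rw [Finset.sum_sub_distrib, Finset.sum_sub_distrib, Finset.sum_sub_distrib, ← Finset.mul_sum,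
    ← Finset.mul_sum, hy, ha, Finset.sum_const, Finset.card_univ, Fintype.card_fin,
    nsmul_eq_mul] at h
  rw [ha]
  push_cast at h
  nlinarith

/-- The case of one entry -x below -2a and one entry w above 2a. S is the sum of the squares of the
other three, whose sum x - w is controlled by Cauchy–Schwarz. This forces x², w² into [4a², 15a²]
and S ≤ 12a², where chords of the squares suffice. -/
theorem pair_bound {a x w S : ℝ} (ha0 : 0 ≤ a) (hx2 : 2 * a < x) (hx4 : x ≤ 4 * a)
    (hw2 : 2 * a < w) (hw4 : w ≤ 4 * a) (hS : S = 20 * a ^ 2 - x ^ 2 - w ^ 2)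
    (h3 : (-(-x + w)) ^ 2 ≤ 3 * S) :
    20 * (x ^ 4 + (w ^ 4 + S ^ 2)) ≤ 13 * (20 * a ^ 2) ^ 2 := by
  have hS0 : 0 ≤ S := by linarith [sq_nonneg (-(-x + w))]
  have bound : ∀ p v : ℝ, 2 * a < p → p ≤ 4 * a → 2 * a < v →
      p ^ 2 + v ^ 2 + (p - v) ^ 2 / 3 ≤ 20 * a ^ 2 → p ^ 2 ≤ 15 * a ^ 2 := by
    intro p v h1 h2 h3 h4
    have h5 : (2 * a) ^ 2 + (p - 2 * a) ^ 2 / 3 ≤ v ^ 2 + (p - v) ^ 2 / 3 := by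
      linarith [mul_nonneg (by linarith : 0 ≤ v - 2 * a) (by linarith : 0 ≤ 2 * v + 4 * a - p)]
    linarith [mul_nonneg ha0 (by linarith : 0 ≤ 4 * a - p)]
  have hx15 := bound x w hx2 hx4 hw2 (by linarith)
  have hw15 := bound w x hw2 hw4 hx2 (by linarith)
  have hx4' : 4 * a ^ 2 ≤ x ^ 2 := by
    linarith [pow_le_pow_left₀ (by positivity : 0 ≤ 2 * a) hx2.le 2]
  have hw4' : 4 * a ^ 2 ≤ w ^ 2 := by
    linarith [pow_le_pow_left₀ (by positivity : 0 ≤ 2 * a) hw2.le 2]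
  have f1 : x ^ 4 ≤ 19 * a ^ 2 * x ^ 2 - 60 * a ^ 4 := by
    linarith [mul_nonneg (sub_nonneg.2 hx15) (sub_nonneg.2 hx4')]
  have f2 : w ^ 4 ≤ 19 * a ^ 2 * w ^ 2 - 60 * a ^ 4 := by
    linarith [mul_nonneg (sub_nonneg.2 hw15) (sub_nonneg.2 hw4')]
  have f4 : S ^ 2 ≤ 12 * a ^ 2 * S := by
    rw [pow_two]; exact mul_le_mul_of_nonneg_right (by linarith) hS0
  have f5 : a ^ 2 * S = 20 * a ^ 4 - a ^ 2 * x ^ 2 - a ^ 2 * w ^ 2 := by rw [hS]; ring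
  have f6 : 0 ≤ a ^ 2 * S := by positivity
  linarith

theorem fourth_power_sum_five (y : Fin 5 → ℝ) (hy : ∑ j, y j = 0) :
    20 * ∑ j, y j ^ 4 ≤ 13 * (∑ j, y j ^ 2) ^ 2 := by
  set a := √((∑ j, y j ^ 2) / 20) with ha
  have ha0 : 0 ≤ a := Real.sqrt_nonneg _
  have hT0 : 0 ≤ ∑ j, y j ^ 2 := Finset.sum_nonneg fun j _ => sq_nonneg _
  have hT : ∑ j, y j ^ 2 = 20 * a ^ 2 := by rw [ha, Real.sq_sqrt (by positivity)]; ring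
  -- Cauchy–Schwarz for the other four entries, whose sum is -y_j.
  have habs : ∀ j, |y j| ≤ 4 * a := by
    intro j
    have e1 := Finset.add_sum_erase Finset.univ y (Finset.mem_univ j)
    have e2 := Finset.add_sum_erase Finset.univ (fun j => y j ^ 2) (Finset.mem_univ j)
    have e3 := sq_sum_le_card_mul_sum_sq (s := Finset.univ.erase j) (f := y)
    rw [Finset.card_erase_of_mem (Finset.mem_univ j), Finset.card_univ, Fintype.card_fin] at e3
    rw [hy] at e1
    rw [hT] at e2
    have e4 : ∑ k ∈ Finset.univ.erase j, y k = -y j := by linarith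
    rw [e4] at e3
    push_cast at e3
    exact abs_le_of_sq_le_sq (by nlinarith) (by positivity)
  by_cases c1 : ∀ j, -(2 * a) ≤ y j
  · exact fourth_power_sum_five_of_le y hy hT (fun j => (le_abs_self _).trans (habs j)) c1
  by_cases c2 : ∀ j, y j ≤ 2 * a
  · have := fourth_power_sum_five_of_le (fun j => -y j) (by rw [Finset.sum_neg_distrib, hy, neg_zero])
      (a := a) (by simpa using hT) (fun j => (neg_le_abs _).trans (habs j))
      (fun j => neg_le_neg (c2 j))
    simpa [Even.neg_pow (by decide : Even 4)] using this
  push Not at c1 c2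
  obtain ⟨j, hj⟩ := c1
  obtain ⟨k, hk⟩ := c2
  have hjk : k ≠ j := by rintro rfl; linarith
  have hkm : k ∈ Finset.univ.erase j := Finset.mem_erase.2 ⟨hjk, Finset.mem_univ k⟩
  set R := (Finset.univ.erase j).erase k with hR
  have hcard : R.card = 3 := by
    rw [hR, Finset.card_erase_of_mem hkm, Finset.card_erase_of_mem (Finset.mem_univ j),
      Finset.card_univ, Fintype.card_fin]
  have split : ∀ f : Fin 5 → ℝ, ∑ i, f i = f j + (f k + ∑ i ∈ R, f i) := fun f => by
    rw [hR, Finset.add_sum_erase _ f hkm, Finset.add_sum_erase _ f (Finset.mem_univ j)]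
  have e1 := split y
  have e2 := split fun i => y i ^ 2
  have e4 := split fun i => y i ^ 4
  have h3 := sq_sum_le_card_mul_sum_sq (s := R) (f := y)
  have h4 := sum_four_le_sq R y
  have hS0 : 0 ≤ ∑ i ∈ R, y i ^ 2 := Finset.sum_nonneg fun i _ => sq_nonneg _
  rw [hcard] at h3
  push_cast at h3
  rw [e4, hT]
  rw [hy] at e1
  rw [hT] at e2
  set S := ∑ i ∈ R, y i ^ 2
  have h6 : ∑ i ∈ R, y i = -(y j + y k) := by linarith
  rw [h6] at h3
  obtain ⟨x, hx⟩ : ∃ x, x = -y j := ⟨_, rfl⟩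
  obtain ⟨w, hw⟩ : ∃ w, w = y k := ⟨_, rfl⟩
  have hx4 : x ≤ 4 * a := hx ▸ (neg_le_abs _).trans (habs j)
  have hw4 : w ≤ 4 * a := hw ▸ (le_abs_self _).trans (habs k)
  have hyj : y j = -x := by linarith
  rw [hyj, ← hw] at h3 e2 ⊢
  refine le_trans ?_ (pair_bound ha0 (by linarith) hx4 (hw ▸ hk) hw4 (by linarith) h3)
  have : (-x) ^ 4 = x ^ 4 := by ring
  linarith

namespace Fam

variable (hs : Tendsto s l (𝓝 0)) (hs0 : ∀ᶠ i in l, 0 ≤ s i)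

-- Three points have e₄ = 0, and the expansion of Re e₄ then determines ∑ y_j⁴.
include hs in
theorem fourth_three (h : Fam l s ζ A B 5) (hn : n = 3) :
    OO l s 6 fun i => ∑ j, (ζ i j).im ^ 4 - 2 * ((n - 1) * B) ^ 2 * s i ^ 4 := by
  refine ((h.esym_four_re hs le_rfl (by rw [hn]; norm_num)).const_mul 4).congr fun i => ?_
  rw [esym_eq_zero (ζ i) (by omega : n < 4), Complex.zero_re]; ring

include hs in
theorem sq_sq (h : Fam l s ζ A B m) :
    OO l s 6 fun i => (∑ j, (ζ i j).im ^ 2) ^ 2 - (2 * ((n - 1) * B)) ^ 2 * s i ^ 4 := by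
  have h1 : OO l s 2 fun i => ∑ j, (ζ i j).im ^ 2 + 2 * ((n - 1) * B) * s i ^ 2 :=
    (((h.mono_O hs 0 2 2 (by norm_num)).congr fun i => by simp)).add (OO.self' hs _ le_rfl)
  exact (h.sq.mul h1).congr fun i => by ring

include hs hs0 in
theorem fourth_generic (h : Fam l s ζ A B 6) (hn : 2 ≤ n) (hB : 0 < B) :
    UB l s 6 fun i => ∑ j, (ζ i j).im ^ 4 - 2 * ((n - 1) * B) ^ 2 * s i ^ 4 := by
  have : NeZero n := ⟨by omega⟩
  have h2 : (2 : ℝ) ≤ n := by exact_mod_cast hn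
  set E := (n - 1) * B with hE
  have hE0 : 0 < E := mul_pos (by linarith) hB
  obtain ⟨C, hC, hτ⟩ := h.im3.bound hs0
  obtain ⟨C', hC', hT⟩ := h.sq.bound hs0
  have key : UB l s 6 fun i => 2 * ∑ j, (ζ i j).im ^ 4 - (∑ j, (ζ i j).im ^ 2) ^ 2 := by
    refine ⟨4 * C ^ 2 / E, ?_⟩
    have hsm : ∀ᶠ i in l, C' * s i ^ 2 < E := by
      have : Tendsto (fun i => C' * s i ^ 2) l (𝓝 0) := by simpa using (hs.pow 2).const_mul C'
      exact this.eventually (gt_mem_nhds hE0)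
    filter_upwards [hτ, hT, hs0, hsm] with i a1 a2 a3 a4
    have a5 := fourth_power_sum_le fun j => (ζ i j).im
    have a6 := sum_four_le_sq Finset.univ fun j => (ζ i j).im
    rw [Real.norm_eq_abs, abs_le] at a1 a2
    have hx : (∑ j, (ζ i j).im ^ 3) ^ 2 ≤ (C * s i ^ 4) ^ 2 := sq_le_sq' a1.1 a1.2
    set T := ∑ j, (ζ i j).im ^ 2
    set q := ∑ j, (ζ i j).im ^ 4
    rw [← hE] at a2
    have hT1 : E * s i ^ 2 ≤ T := by
      nlinarith [a2.1, mul_le_mul_of_nonneg_right a4.le (sq_nonneg (s i))]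
    -- The filter does not exclude s = 0, where one cannot divide by ∑ y_j².
    rcases a3.eq_or_lt with h0 | h0
    · rw [← h0] at a2 ⊢
      have : T = 0 := by
        have := a2.1; have := a2.2; norm_num at *; linarith
      rw [this] at a6 ⊢
      norm_num at a6 ⊢
      linarith
    · by_contra! hcon
      have hpos : 0 ≤ 4 * C ^ 2 / E * s i ^ 6 := by positivity
      have h7 : 4 * C ^ 2 / E * s i ^ 6 * (E * s i ^ 2) <
          (2 * q - T ^ 2) * T := mul_lt_mul hcon hT1 (by positivity) (by linarith)
      have h8 : 4 * C ^ 2 / E * s i ^ 6 * (E * s i ^ 2) = 4 * (C * s i ^ 4) ^ 2 := by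
        field_simp
      linarith
  refine ((key.add ((h.sq_sq hs).ub hs0)).const_mul (c := 1 / 2) (by norm_num)).congr fun i => ?_
  rw [← hE]; ring

-- The y_j are centred at their mean, which is O(s³), so that the inequality for sum zero applies
-- exactly.
include hs hs0 in
theorem fourth_five {ζ : ι → Fin 5 → ℂ} (h : Fam l s ζ A B 5) : UB l s 5 fun i =>
    ∑ j, (ζ i j).im ^ 4 - 13 / 20 * (2 * (((5 : ℕ) - 1) * B)) ^ 2 * s i ^ 4 := by
  have hμ : OO l s 3 fun i => (∑ j, (ζ i j).im) / 5 := h.im1.div_const 5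
  set μ := fun i => (∑ j, (ζ i j).im) / 5 with hμd
  have hy : ∀ j, OO l s 1 fun i => (ζ i j).im - μ i := fun j =>
    (h.im_O j).sub (hμ.mono hs (by norm_num))
  have hT : OO l s 4 fun i => ∑ j, ((ζ i j).im - μ i) ^ 2 - ∑ j, (ζ i j).im ^ 2 := by
    refine (OO.sum (S := Finset.univ) (f := fun j i => -μ i * ((ζ i j).im - μ i + (ζ i j).im))
      fun j _ => hμ.neg.mul' ((hy j).add (h.im_O j)) hs (by norm_num)).congr fun i => ?_
    rw [← Finset.sum_sub_distrib]
    exact Finset.sum_congr rfl fun j _ => by ring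
  have hq : OO l s 5 fun i => ∑ j, ((ζ i j).im - μ i) ^ 4 - ∑ j, (ζ i j).im ^ 4 := by
    refine (OO.sum (S := Finset.univ) (f := fun j i => -μ i * (((ζ i j).im - μ i + (ζ i j).im) *
      (((ζ i j).im - μ i) * ((ζ i j).im - μ i) + (ζ i j).im * (ζ i j).im)))
      fun j _ => hμ.neg.mul' (((hy j).add (h.im_O j)).mul (((hy j).mul (hy j)).add
        ((h.im_O j).mul (h.im_O j)))) hs (by norm_num)).congr fun i => ?_
    rw [← Finset.sum_sub_distrib]
    exact Finset.sum_congr rfl fun j _ => by ring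
  have h2 : OO l s 2 fun i => ∑ j, ((ζ i j).im - μ i) ^ 2 + ∑ j, (ζ i j).im ^ 2 :=
    (OO.sum fun j _ => (hy j).rpow 2).add (OO.sum fun j _ => (h.im_O j).rpow 2)
  have hTT := (hT.mul' h2 hs (by norm_num : 5 ≤ 4 + 2)).const_mul (13 / 20)
  have hcert : UB l s 5 fun i => ∑ j, ((ζ i j).im - μ i) ^ 4
      - 13 / 20 * (∑ j, ((ζ i j).im - μ i) ^ 2) ^ 2 :=
    UB.of_le (Eventually.of_forall fun i => by
      have := fourth_power_sum_five (fun j => (ζ i j).im - μ i) (by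
        rw [Finset.sum_sub_distrib, Finset.sum_const, Finset.card_univ, Fintype.card_fin,
          nsmul_eq_mul, hμd]
        push_cast; ring)
      linarith)
  refine (hcert.add ((((hTT.add ((h.sq_sq hs).const_mul (13 / 20) |>.mono hs
    (by norm_num))).sub hq)).ub hs0)).congr fun i => ?_
  push_cast
  ring

end Fam

end PowerSums

/-! ### The upper bound -/

section UpperBound

variable {n : ℕ} {ι : Type*} {l : Filter ι} {s : ι → ℝ} {ζ : ι → Fin n → ℂ} {r : ι → ℝ}

/-- The order of the error term in `s`. -/
def order (n : ℕ) : ℕ := if n = 3 ∨ n = 5 then 5 else 6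

theorem five_le_order (n : ℕ) : 5 ≤ order n := by rw [order]; split_ifs <;> norm_num

theorem order_le_six (n : ℕ) : order n ≤ 6 := by rw [order]; split_ifs <;> norm_num

/-- The expansion of the Sendov radius at `1 - t ^ 2`. -/
noncomputable def expansion (n : ℕ) (t : ℝ) : ℝ :=
  1 + (D₁ n + D₂ n / n) * t ^ 2 + (D n + Δ n) * t ^ 4

theorem Extremal.ub (h : Extremal l s ζ r) (hs : Tendsto s l (𝓝 0)) (hs0 : ∀ᶠ i in l, 0 ≤ s i)
    (hn : 3 ≤ n) : UB l s (order n) fun i => r i - expansion n (s i) := by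
  have hF := h.fam_five hs hs0 hn
  simp only [expansion]
  rw [← rho_eq hn]
  by_cases h3 : n = 3
  · have ho : order n = 5 := by rw [order, if_pos (Or.inl h3)]
    have hΔ : Δ n = 0 := by rw [Δ, if_neg (by omega)]
    rw [ho, hΔ, add_zero, ← objC_eq hn]
    exact h.second_order hs hs0 hF le_rfl (by norm_num) hn
      (((((hF.fourth_three hs h3).mono hs (by norm_num)).const_mul _)).ub hs0)
  by_cases h5 : n = 5
  · subst h5
    have ho : order 5 = 5 := by rw [order, if_pos (Or.inr rfl)]
    have hΔ : Δ 5 = 7 / 225 := by rw [Δ, if_pos rfl]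
    rw [ho, hΔ, ← objC_five]
    exact h.second_order hs hs0 hF le_rfl (by norm_num) hn
      ((hF.fourth_five hs hs0).const_mul (kappa_nonneg (by norm_num)))
  · have ho : order n = 6 := by rw [order, if_neg (by omega)]
    have hΔ : Δ n = 0 := by rw [Δ, if_neg h5]
    have hF6 := h.fam_six hs hs0 hn h3 h5
    rw [ho, hΔ, add_zero, ← objC_eq hn]
    exact h.second_order hs hs0 hF6 (by norm_num) le_rfl hn
      ((hF6.fourth_generic hs hs0 (by omega) (lpB_pos hn)).const_mul (kappa_nonneg (by omega)))

/-- Uniformity in P comes from taking as index set all pairs (t, P) that are nearly extremal, with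
the filter t → 0. The asymptotic bound along this filter is then a bound for all P at once. -/
theorem critDist_le_expansion (hn : 3 ≤ n) : ∃ C δ : ℝ, 0 < δ ∧ ∀ t : ℝ, 0 ≤ t → t < δ →
    ∀ P ∈ polys (n + 1) ((1 - t ^ 2 : ℝ) : ℂ),
      critDist P ((1 - t ^ 2 : ℝ) : ℂ) ≤ expansion n t + C * t ^ order n := by
  set K := |D n + Δ n| with hK
  let ι := {p : ℝ × ℂ[X] // 0 ≤ p.1 ∧ p.2 ∈ polys (n + 1) ((1 - p.1 ^ 2 : ℝ) : ℂ) ∧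
    1 + (D₁ n + D₂ n / n) * p.1 ^ 2 - K * p.1 ^ 4 ≤ critDist p.2 ((1 - p.1 ^ 2 : ℝ) : ℂ)}
  let s : ι → ℝ := fun i => i.1.1
  let l : Filter ι := comap s (𝓝 0)
  have hs : Tendsto s l (𝓝 0) := tendsto_comap
  have hs0 : ∀ᶠ i in l, 0 ≤ s i := Eventually.of_forall fun i => i.2.1
  have hex := fun i : ι => exists_critical_points i.2.2.1.1
  choose Q ζ hQm hQd hQr hQD hQs using hex
  set r : ι → ℝ := fun i => critDist i.1.2 ((1 - i.1.1 ^ 2 : ℝ) : ℂ) with hr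
  have hcast : ∀ i : ι, ((1 - i.1.1 ^ 2 : ℝ) : ℂ) = 1 - (s i : ℂ) ^ 2 := fun i => by
    push_cast; rfl
  have hle : ∀ i j, r i ≤ ‖1 - (s i : ℂ) ^ 2 - ζ i j‖ := by
    intro i j
    rw [← dist_eq_norm, hr, ← hcast]
    refine Metric.infDist_le_dist_of_mem ?_
    rw [hQs]; exact Set.mem_range_self j
  have hβ : ∀ i, (Q i).eval (1 - (s i : ℂ) ^ 2) = 0 := fun i => by
    rw [hQr, ← hcast]; exact i.2.2.1.2.1
  have hroot : ∀ i z, (Q i).eval z = 0 → ‖z‖ ≤ 1 := fun i z hz =>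
    i.2.2.1.2.2 z ((hQr i z).1 hz)
  have hlow : UB l s 4 fun i => 1 + (rho n (lpA n) (lpB n) - 1) * s i ^ 2 - r i :=
    ⟨K, Eventually.of_forall fun i => by
      rw [rho_eq hn]; have := i.2.2.2; simp only [hr, s]; linarith⟩
  have hlow2 : UB l s 2 fun i => 1 - r i :=
    ((hlow.weaken hs0 hs (by norm_num : 2 ≤ 4)).add ((OO.self' hs
      (-(rho n (lpA n) (lpB n) - 1)) le_rfl).ub hs0)).congr fun i => by ring
  have hsm := critical_points_small (by omega) hs hs0 hQD hQm hQd hβ hroot hle hlow2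
  have hE : Extremal l s ζ r :=
    ⟨⟨fun j => (hsm j).1, fun j => (hsm j).2, constrained_of_polynomials hs (fun j => (hsm j).1) hQD
      hQm hQd hβ hroot⟩, fun i => Metric.infDist_nonneg, hle, hlow⟩
  obtain ⟨C, hC⟩ := hE.ub hs hs0 hn
  rw [eventually_comap, Metric.eventually_nhds_iff] at hC
  obtain ⟨δ, hδ, hC⟩ := hC
  refine ⟨|C|, δ, hδ, fun t ht0 htδ P hP => ?_⟩
  have hp : 0 ≤ t ^ order n := pow_nonneg ht0 _
  -- Polynomials outside the index set satisfy the bound trivially, by the choice of K.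
  by_cases hc : 1 + (D₁ n + D₂ n / n) * t ^ 2 - K * t ^ 4 ≤ critDist P ((1 - t ^ 2 : ℝ) : ℂ)
  · have := hC (y := t) (by rwa [Real.dist_eq, sub_zero, abs_of_nonneg ht0])
      ⟨(t, P), ht0, hP, hc⟩ rfl
    have h2 := mul_le_mul_of_nonneg_right (le_abs_self C) hp
    simp only [hr, s] at this
    linarith
  · push Not at hc
    have h4 : 0 ≤ t ^ 4 := by positivity
    have h5 := mul_le_mul_of_nonneg_right (neg_abs_le (D n + Δ n)) h4
    have h6 := mul_nonneg (abs_nonneg C) hp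
    rw [expansion]
    linarith

end UpperBound

/-! ### Polynomial families of critical points -/

section PolynomialFamily

variable {n m : ℕ} {ι : Type*} {l : Filter ι} {s : ι → ℝ}

theorem OO.of_continuous (hs : Tendsto s l (𝓝 0)) (k : ℕ) {g : ℝ → ℝ} (hg : Continuous g) :
    OO l s k fun i => s i ^ k * g (s i) := by
  have h : OO l s 0 fun i => g (s i) := OO.of_tendsto ((hg.tendsto 0).comp hs)
  exact (OO.self k).mul h

theorem esym_comp_equiv (ζ : Fin n → ℂ) (e : Equiv.Perm (Fin n)) (k : ℕ) :
    esym (ζ ∘ e) k = esym ζ k := by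
  rw [esym, esym, ← Multiset.map_map, Multiset.map_univ_val_equiv]

theorem esym_conj (ζ : Fin n → ℂ) (k : ℕ) :
    esym (fun j => (starRingEnd ℂ) (ζ j)) k = (starRingEnd ℂ) (esym ζ k) := by
  simp only [esym_eq_sum, map_sum, map_prod]

theorem esym_im_eq_zero {ζ : Fin n → ℂ} {e : Equiv.Perm (Fin n)}
    (h : ∀ j, ζ (e j) = (starRingEnd ℂ) (ζ j)) (k : ℕ) : (esym ζ k).im = 0 := by
  rw [← Complex.conj_eq_iff_im, ← esym_conj, ← esym_comp_equiv ζ e]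
  exact congrArg (esym · k) (funext fun j => (h j).symm)

theorem conJ_eq_zero {ζ : Fin n → ℂ} (h : ∀ k, (esym ζ k).im = 0) (u : ℝ) : conJ ζ u = 0 := by
  simp [conJ, h]

/-- The coefficient of `s ^ 2` in the real parts. -/
noncomputable def coeffP (n : ℕ) (a : ℝ) : ℝ := a ^ 2 / 2 - rho n (lpA n) (lpB n)

/-- The coefficient of `s ^ 4` in the real parts. -/
noncomputable def coeffQ (n : ℕ) (R a b : ℝ) : ℝ :=
  a * b + ((1 + coeffP n a) ^ 2 - (rho n (lpA n) (lpB n) - 1) ^ 2) / 2 - R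

/-- The family of critical points with imaginary parts `a s + b s³`, at distance
`1 + (rho - 1) s² + R s⁴ + O(s⁶)` from `1 - s²`. -/
noncomputable def polyFam (n : ℕ) (R : ℝ) (a b : Fin n → ℝ) (t : ℝ) (j : Fin n) : ℂ :=
  ⟨coeffP n (a j) * t ^ 2 + coeffQ n R (a j) (b j) * t ^ 4, a j * t + b j * t ^ 3⟩

variable {a b : Fin n → ℝ} {R : ℝ}

theorem polyFam_im (t : ℝ) (j : Fin n) : (polyFam n R a b t j).im = a j * t + b j * t ^ 3 := rfl

theorem polyFam_re (t : ℝ) (j : Fin n) : (polyFam n R a b t j).re =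
    coeffP n (a j) * t ^ 2 + coeffQ n R (a j) (b j) * t ^ 4 := rfl

/-- `coeffP` and `coeffQ` are the values for which the coefficients of t² and t⁴ in the slack
vanish. -/
theorem slack_polyFam (hs : Tendsto s l (𝓝 0)) (j : Fin n) : OO l s 6 fun i => slack (s i)
    (1 + (rho n (lpA n) (lpB n) - 1) * s i ^ 2 + R * s i ^ 4) (polyFam n R a b (s i) j) := by
  refine (OO.of_continuous hs 6 (g := fun t => 2 * (1 + coeffP n (a j)) * coeffQ n R (a j) (b j)
    + b j ^ 2 - 2 * (rho n (lpA n) (lpB n) - 1) * R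
    + (coeffQ n R (a j) (b j) ^ 2 - R ^ 2) * t ^ 2) (by fun_prop)).congr fun i => ?_
  rw [slack, polyFam_im, polyFam_re, coeffQ, coeffP]
  ring

theorem sum_im_polyFam (t : ℝ) : ∑ j, (polyFam n R a b t j).im =
    (∑ j, a j) * t + (∑ j, b j) * t ^ 3 := by
  simp only [polyFam_im, Finset.sum_add_distrib, Finset.sum_mul]

theorem sum_im_sq_polyFam (t : ℝ) : ∑ j, (polyFam n R a b t j).im ^ 2 =
    (∑ j, a j ^ 2) * t ^ 2 + 2 * (∑ j, a j * b j) * t ^ 4 + (∑ j, b j ^ 2) * t ^ 6 := by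
  simp only [Finset.sum_mul, Finset.mul_sum, ← Finset.sum_add_distrib, polyFam_im]
  exact Finset.sum_congr rfl fun j _ => by ring

theorem sum_im_cube_polyFam (t : ℝ) : ∑ j, (polyFam n R a b t j).im ^ 3 =
    (∑ j, a j ^ 3) * t ^ 3 + t ^ 5 * (∑ j, (3 * a j ^ 2 * b j + 3 * a j * b j ^ 2 * t ^ 2
      + b j ^ 3 * t ^ 4)) := by
  simp only [Finset.sum_mul, Finset.mul_sum, ← Finset.sum_add_distrib, polyFam_im]
  exact Finset.sum_congr rfl fun j _ => by ring

theorem sum_im_four_polyFam (t : ℝ) : ∑ j, (polyFam n R a b t j).im ^ 4 =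
    (∑ j, a j ^ 4) * t ^ 4 + t ^ 6 * (∑ j, (4 * a j ^ 3 * b j + 6 * a j ^ 2 * b j ^ 2 * t ^ 2
      + 4 * a j * b j ^ 3 * t ^ 4 + b j ^ 4 * t ^ 6)) := by
  simp only [Finset.sum_mul, Finset.mul_sum, ← Finset.sum_add_distrib, polyFam_im]
  exact Finset.sum_congr rfl fun j _ => by ring

theorem sum_re_sq_polyFam (t : ℝ) : ∑ j, (polyFam n R a b t j).re ^ 2 =
    (∑ j, coeffP n (a j) ^ 2) * t ^ 4 + t ^ 6 * (∑ j, (2 * coeffP n (a j) *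
      coeffQ n R (a j) (b j) + coeffQ n R (a j) (b j) ^ 2 * t ^ 2)) := by
  simp only [Finset.sum_mul, Finset.mul_sum, ← Finset.sum_add_distrib, polyFam_re]
  exact Finset.sum_congr rfl fun j _ => by ring

theorem fam_polyFam (hs : Tendsto s l (𝓝 0)) (h0 : ∑ j, a j = 0)
    (h2 : ∑ j, a j ^ 2 = 2 * ((n - 1) * lpB n)) (hm : m ≤ 6)
    (hb : m ≤ 5 ∨ ∑ j, b j = 0 ∧ ∑ j, a j ^ 3 = 0) :
    Fam l s (fun i => polyFam n R a b (s i)) (lpA n) (lpB n) m := by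
  refine ⟨fun j => ?_, fun j => ?_, ?_, ?_, ?_⟩
  · exact (OO.of_continuous hs 1 (g := fun t => a j + b j * t ^ 2) (by fun_prop)).congr fun i => by
      rw [polyFam_im]; ring
  · exact (OO.of_continuous hs 4 (g := fun t => coeffQ n R (a j) (b j) - a j * b j
      - b j ^ 2 * t ^ 2 / 2) (by fun_prop)).congr fun i => by
        rw [polyFam_im, polyFam_re, coeffP]; ring
  · exact (OO.of_continuous hs 4 (g := fun t => 2 * (∑ j, a j * b j) + (∑ j, b j ^ 2) * t ^ 2)
      (by fun_prop)).congr fun i => by rw [sum_im_sq_polyFam, h2]; ring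
  · simp only [sum_im_polyFam, h0, zero_mul, zero_add]
    rcases hb with hb | ⟨hb, -⟩
    · exact OO.self' hs _ (by omega)
    · simp only [hb, zero_mul]; exact OO.zero
  · simp only [sum_im_cube_polyFam]
    refine OO.add ?_ ((OO.of_continuous hs 5 (g := fun t => ∑ j, (3 * a j ^ 2 * b j
      + 3 * a j * b j ^ 2 * t ^ 2 + b j ^ 3 * t ^ 4)) (by fun_prop)).mono hs (by omega))
    rcases hb with hb | ⟨-, hb⟩
    · exact OO.self' hs _ (by omega)
    · simp only [hb, zero_mul]; exact OO.zero

theorem sum_coeffP (hn : 3 ≤ n) (h2 : ∑ j, a j ^ 2 = 2 * ((n - 1) * lpB n)) :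
    ∑ j, coeffP n (a j) = -(n * lpA n) := by
  have hn0 : (n : ℝ) ≠ 0 := by positivity
  simp only [coeffP, Finset.sum_sub_distrib, ← Finset.sum_div, h2, Finset.sum_const,
    Finset.card_univ, Fintype.card_fin, nsmul_eq_mul, rho]
  field_simp
  ring

theorem sum_coeffP_sq (h2 : ∑ j, a j ^ 2 = 2 * ((n - 1) * lpB n)) : ∑ j, coeffP n (a j) ^ 2 =
    (∑ j, a j ^ 4) / 4 - 2 * rho n (lpA n) (lpB n) * ((n - 1) * lpB n)
      + n * rho n (lpA n) (lpB n) ^ 2 := by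
  have : ∀ j, coeffP n (a j) ^ 2 = a j ^ 4 / 4 - rho n (lpA n) (lpB n) * a j ^ 2
      + rho n (lpA n) (lpB n) ^ 2 := fun j => by rw [coeffP]; ring
  simp only [this, Finset.sum_add_distrib, Finset.sum_sub_distrib, ← Finset.sum_div,
    ← Finset.mul_sum, h2, Finset.sum_const, Finset.card_univ, Fintype.card_fin, nsmul_eq_mul]
  ring

theorem sum_coeffQ (hn : 3 ≤ n) (h2 : ∑ j, a j ^ 2 = 2 * ((n - 1) * lpB n)) :
    ∑ j, coeffQ n R (a j) (b j) = ∑ j, a j * b j + (n - 2 * (n * lpA n)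
      + ∑ j, coeffP n (a j) ^ 2) / 2 - n * ((rho n (lpA n) (lpB n) - 1) ^ 2 / 2 + R) := by
  have : ∀ j, coeffQ n R (a j) (b j) = a j * b j + coeffP n (a j) + coeffP n (a j) ^ 2 / 2
      + (1 - (rho n (lpA n) (lpB n) - 1) ^ 2 - 2 * R) / 2 := fun j => by rw [coeffQ]; ring
  simp only [this, Finset.sum_add_distrib, ← Finset.sum_div, Finset.sum_const, Finset.card_univ,
    Fintype.card_fin, nsmul_eq_mul, sum_coeffP hn h2]
  ring

/-- The sum of the squares of the coefficients `coeffP`, in terms of the fourth power sum. -/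
noncomputable def sumP (n : ℕ) (Q : ℝ) : ℝ :=
  Q / 4 - 2 * rho n (lpA n) (lpB n) * ((n - 1) * lpB n) + n * rho n (lpA n) (lpB n) ^ 2

/-- The coefficient of `s ^ 4` in the modulus of the roots, given `∑ a b` and `∑ a ^ 4`. -/
noncomputable def conFour (n : ℕ) (R σ Q u : ℝ) : ℝ :=
  -(σ + (n - 2 * (n * lpA n) + sumP n Q) / 2
      - n * ((rho n (lpA n) (lpB n) - 1) ^ 2 / 2 + R)) / n * (1 - u)
    + (2 * σ - sumP n Q + (n * lpA n) ^ 2) / (n - 1) * (1 - u ^ 2) + conQ n u * Q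
    + conS n (lpA n) (lpB n) u

theorem conSecond_polyFam (hs : Tendsto s l (𝓝 0)) (hn : 3 ≤ n) (h0 : ∑ j, a j = 0)
    (h2 : ∑ j, a j ^ 2 = 2 * ((n - 1) * lpB n)) (u : ℝ) : OO l s 6 fun i =>
      conSecond n (s i) (∑ j, (polyFam n R a b (s i) j).im ^ 4) (polyFam n R a b (s i)) u
        - (-(1 - lpA n * (1 - u) - 2 * lpB n * (1 - u ^ 2)) * s i ^ 2
          + conFour n R (∑ j, a j * b j) (∑ j, a j ^ 4) u * s i ^ 4) := by
  have h3 : (3 : ℝ) ≤ n := by exact_mod_cast hn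
  have hn0 : (n : ℝ) ≠ 0 := by positivity
  have hn1 : (n : ℝ) - 1 ≠ 0 := by linarith
  have e1 : ∀ i, (esym (polyFam n R a b (s i)) 1).re = -(n * lpA n) * s i ^ 2
      + (∑ j, coeffQ n R (a j) (b j)) * s i ^ 4 := fun i => by
    rw [← sum_re_eq, ← sum_coeffP hn h2]
    simp only [polyFam_re, Finset.sum_add_distrib, Finset.sum_mul]
  have e1' : ∀ i, (esym (polyFam n R a b (s i)) 1).im = (∑ j, b j) * s i ^ 3 := fun i => by
    rw [Fam.esym_one_im (ζ := fun i => polyFam n R a b (s i)), sum_im_polyFam, h0]; ring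
  set c := ∑ j, coeffQ n R (a j) (b j) with hc
  have e2 : OO l s 6 fun i => (esym (polyFam n R a b (s i)) 2).re - ((n - 1) * lpB n * s i ^ 2
      + (∑ j, a j * b j - (∑ j, coeffP n (a j) ^ 2) / 2 + (n * lpA n) ^ 2 / 2) * s i ^ 4) := by
    have f1 : OO l s 6 fun i => s i ^ 6 * ((∑ j, b j ^ 2) - (∑ j, (2 * coeffP n (a j) *
        coeffQ n R (a j) (b j) + coeffQ n R (a j) (b j) ^ 2 * s i ^ 2))
        + (-2 * (n * lpA n) * c + c ^ 2 * s i ^ 2) - (∑ j, b j) ^ 2) :=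
      OO.of_continuous hs 6 (g := fun t => (∑ j, b j ^ 2) - (∑ j, (2 * coeffP n (a j) *
        coeffQ n R (a j) (b j) + coeffQ n R (a j) (b j) ^ 2 * t ^ 2))
        + (-2 * (n * lpA n) * c + c ^ 2 * t ^ 2) - (∑ j, b j) ^ 2) (by fun_prop)
    refine (f1.const_mul (1 / 2)).congr fun i => ?_
    have := sum_im_sq (polyFam n R a b (s i))
    rw [sum_im_sq_polyFam, sum_re_sq_polyFam, e1, e1', h2] at this
    linear_combination (-1 / 2) * this
  have e4 : OO l s 6 fun i => ∑ j, (polyFam n R a b (s i) j).im ^ 4 - (∑ j, a j ^ 4) * s i ^ 4 := by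
    refine (OO.of_continuous hs 6 (g := fun t => ∑ j, (4 * a j ^ 3 * b j
      + 6 * a j ^ 2 * b j ^ 2 * t ^ 2 + 4 * a j * b j ^ 3 * t ^ 4 + b j ^ 4 * t ^ 6))
      (by fun_prop)).congr fun i => ?_
    rw [sum_im_four_polyFam]; ring
  refine ((e2.const_mul (2 / (n - 1) * (1 - u ^ 2))).add (e4.const_mul (conQ n u))).congr
    fun i => ?_
  rw [conSecond, e1, hc, sum_coeffQ hn h2, sum_coeffP_sq h2, conFour, sumP]
  field_simp
  ring

/-- The dual equations cancel σ, and R = `objC n Q` is the value for which the rest cancels too. So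
the two active constraints at order s⁴ are equivalent. -/
theorem conFour_combination (hn : 3 ≤ n) (σ Q : ℝ) :
    nu₁ n * conFour n (objC n Q) σ Q (u₁ n) + nu₂ n * conFour n (objC n Q) σ Q (u₂ n) = 0 := by
  have h3 : (3 : ℝ) ≤ n := by exact_mod_cast hn
  have hn0 : (n : ℝ) ≠ 0 := by positivity
  have hn1 : (n : ℝ) - 1 ≠ 0 := by linarith
  have e1 := nu_sum_one hn
  have e2 := nu_sum_two hn
  have key : ∀ X Y : ℝ, nu₁ n * (X * (1 - u₁ n) + Y * (1 - u₁ n ^ 2) + conQ n (u₁ n) * Q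
      + conS n (lpA n) (lpB n) (u₁ n)) + nu₂ n * (X * (1 - u₂ n) + Y * (1 - u₂ n ^ 2)
      + conQ n (u₂ n) * Q + conS n (lpA n) (lpB n) (u₂ n)) =
      X + Y * ((n - 1) / (2 * n)) + (1 / (4 * n) - kappa n) * Q
        + nu₁ n * conS n (lpA n) (lpB n) (u₁ n) + nu₂ n * conS n (lpA n) (lpB n) (u₂ n) := by
    intro X Y
    rw [kappa]
    linear_combination X * e1 + Y * e2
  rw [conFour, conFour]
  rw [key, objC, sumP]
  field_simp
  ring

/-- The constraint at u₁ is affine in σ with slope a nonzero multiple of u₁ - `ustar n`, hence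
solvable; the one at u₂ then follows. -/
theorem exists_conFour_eq_zero (hn : 3 ≤ n) (Q : ℝ) : ∃ σ : ℝ,
    conFour n (objC n Q) σ Q (u₁ n) = 0 ∧ conFour n (objC n Q) σ Q (u₂ n) = 0 := by
  have h3 : (3 : ℝ) ≤ n := by exact_mod_cast hn
  have hn0 : (n : ℝ) ≠ 0 := by positivity
  have hn1 : (n : ℝ) - 1 ≠ 0 := by linarith
  have hu := ustar_lt_u₁ hn
  have hu1 := u₁_lt_one hn
  set d : ℝ := -1 / n * (1 - u₁ n) + 2 / (n - 1) * (1 - u₁ n ^ 2) with hd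
  have hd0 : d ≠ 0 := by
    have : d = (1 - u₁ n) * (2 / (n - 1)) * (u₁ n - ustar n) := by
      rw [hd, ustar]; field_simp; ring
    rw [this]
    exact mul_ne_zero (mul_ne_zero (by linarith) (div_ne_zero two_ne_zero hn1)) (by linarith)
  have hlin : ∀ σ, conFour n (objC n Q) σ Q (u₁ n) = conFour n (objC n Q) 0 Q (u₁ n) + d * σ := by
    intro σ
    simp only [conFour, hd]
    ring
  refine ⟨-conFour n (objC n Q) 0 Q (u₁ n) / d, ?_⟩
  have h1 : conFour n (objC n Q) (-conFour n (objC n Q) 0 Q (u₁ n) / d) Q (u₁ n) = 0 := by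
    rw [hlin]; field_simp; ring
  refine ⟨h1, ?_⟩
  have := conFour_combination hn (-conFour n (objC n Q) 0 Q (u₁ n) / d) Q
  rw [h1, mul_zero, zero_add] at this
  exact (mul_eq_zero.1 this).resolve_left (nu₂_pos hn).ne'

end PolynomialFamily

/-! ### Nearly extremal families -/

section Witness

variable {n : ℕ}

theorem tendsto_id_right : Tendsto (fun t : ℝ => t) (𝓝[≥] 0) (𝓝 0) :=
  tendsto_id.mono_left nhdsWithin_le_nhds

/-- Families of critical points for which the active constraints hold to order `m`. -/
structure Witness (m : ℕ) (ζ : ℝ → Fin n → ℂ) : Prop where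
  fam : Fam (𝓝[≥] (0 : ℝ)) (fun t => t) ζ (lpA n) (lpB n) m
  slack : ∀ j, OO (𝓝[≥] (0 : ℝ)) (fun t => t) m fun t => slack t (expansion n t) (ζ t j)
  active : ∀ ω : ℂ, ω ^ (n + 1) = 1 → ω.re = u₁ n ∨ ω.re = u₂ n →
    OO (𝓝[≥] (0 : ℝ)) (fun t => t) m fun t =>
      conSecond n t (∑ j, (ζ t j).im ^ 4) (ζ t) ω.re + ω.im * conJ (ζ t) ω.re

theorem witness_polyFam {m : ℕ} (hn : 3 ≤ n) {a b : Fin n → ℝ} {Q : ℝ}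
    (hR : objC n Q = D n + Δ n) (h0 : ∑ j, a j = 0) (h2 : ∑ j, a j ^ 2 = 2 * ((n - 1) * lpB n))
    (h4 : ∑ j, a j ^ 4 = Q) (hm : m ≤ 6) (hb : m ≤ 5 ∨ ∑ j, b j = 0 ∧ ∑ j, a j ^ 3 = 0)
    (h₁ : conFour n (objC n Q) (∑ j, a j * b j) Q (u₁ n) = 0)
    (h₂ : conFour n (objC n Q) (∑ j, a j * b j) Q (u₂ n) = 0)
    (hJ : ∀ ω : ℂ, ω ^ (n + 1) = 1 → ω.re = u₁ n ∨ ω.re = u₂ n →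
      OO (𝓝[≥] (0 : ℝ)) (fun t => t) m fun t =>
        ω.im * conJ (polyFam n (objC n Q) a b t) ω.re) :
    Witness m (polyFam n (objC n Q) a b) := by
  refine ⟨fam_polyFam tendsto_id_right h0 h2 hm hb, fun j => ?_, fun ω hω hu => ?_⟩
  · have := slack_polyFam (R := objC n Q) (a := a) (b := b) tendsto_id_right j
    rw [rho_eq hn] at this
    simp only [expansion, ← hR]
    exact this.mono tendsto_id_right hm
  · have h := (conSecond_polyFam (R := objC n Q) (b := b) tendsto_id_right hn h0 h2
      ω.re).mono tendsto_id_right hm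
    have e : conFour n (objC n Q) (∑ j, a j * b j) Q ω.re = 0 := by
      rcases hu with h | h <;> rw [h] <;> assumption
    have e' : 1 - lpA n * (1 - ω.re) - 2 * lpB n * (1 - ω.re ^ 2) = 0 := by
      rw [lp_slack hn]
      rcases hu with h | h <;> rw [h] <;> simp
    rw [h4, e, e'] at h
    exact (h.add (hJ ω hω hu)).congr fun t => by ring

/-- Take a and b proportional to (1, -1, 0, …, 0), the equality case of `fourth_power_sum_le`. The
family is invariant under conjugation up to a transposition, so all e_k are real and the odd term
vanishes. -/
theorem exists_witness_generic (hn : 3 ≤ n) (hn5 : n ≠ 5) :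
    ∃ ζ : ℝ → Fin n → ℂ, Witness 6 ζ := by
  have hR : objC n (2 * ((n - 1) * lpB n) ^ 2) = D n + Δ n := by
    rw [objC_eq hn, Δ, if_neg hn5, add_zero]
  obtain ⟨σ, h₁, h₂⟩ := exists_conFour_eq_zero hn (2 * ((n - 1) * lpB n) ^ 2)
  have hE : 0 < (n - 1) * lpB n :=
    mul_pos (by have : (3 : ℝ) ≤ n := by exact_mod_cast hn
                linarith) (lpB_pos hn)
  set E := (n - 1) * lpB n with hEd
  set w := √E with hw
  have hw0 : 0 < w := Real.sqrt_pos.2 hE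
  have hw2 : w ^ 2 = E := Real.sq_sqrt hE.le
  obtain ⟨k, hk⟩ : ∃ k, n = k + 2 := ⟨n - 2, by omega⟩
  obtain ⟨d, e, hde, d1, d2, d3, d4⟩ : ∃ (d : Fin n → ℝ) (e : Equiv.Perm (Fin n)),
      (∀ j, d (e j) = -d j) ∧ ∑ j, d j = 0 ∧ ∑ j, d j ^ 2 = 2 ∧ ∑ j, d j ^ 3 = 0 ∧
      ∑ j, d j ^ 4 = 2 := by
    subst hk
    refine ⟨Fin.cons 1 (Fin.cons (-1) fun _ => 0), Equiv.swap 0 1, fun j => ?_, ?_⟩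
    · refine Fin.cases ?_ (fun j => Fin.cases ?_ (fun j => ?_) j) j
      · rw [Equiv.swap_apply_left, show (1 : Fin (k + 2)) = Fin.succ 0 from rfl]; simp
      · rw [show (Fin.succ 0 : Fin (k + 2)) = 1 from rfl, Equiv.swap_apply_right,
          show (1 : Fin (k + 2)) = Fin.succ 0 from rfl]; simp
      · rw [Equiv.swap_apply_of_ne_of_ne (b := (1 : Fin (k + 2))) (Fin.succ_ne_zero _)
          (fun h => Fin.succ_ne_zero j (Fin.succ_injective _ (h.trans (Fin.succ_zero_eq_one).symm)))]
        simp
    · simp [Fin.sum_univ_succ]; norm_num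
  set c := σ / (2 * w) with hc
  have hab : ∑ j, w * d j * (c * d j) = σ := by
    have : ∑ j, w * d j * (c * d j) = w * c * ∑ j, d j ^ 2 := by
      rw [Finset.mul_sum]; exact Finset.sum_congr rfl fun j _ => by ring
    -- The factor c is chosen to give ∑ a_j b_j the required value σ.
    rw [this, d2, hc]; field_simp
  refine ⟨_, witness_polyFam (a := fun j => w * d j) (b := fun j => c * d j) hn hR ?_ ?_ ?_ le_rfl
    (Or.inr ⟨?_, ?_⟩) (by rw [hab]; exact h₁) (by rw [hab]; exact h₂) fun ω _ _ => ?_⟩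
  · rw [← Finset.mul_sum, d1, mul_zero]
  · simp only [mul_pow]; rw [← Finset.mul_sum, d2, hw2, mul_comm]
  · simp only [mul_pow]; rw [← Finset.mul_sum, d4, show w ^ 4 = (w ^ 2) ^ 2 by ring, hw2, mul_comm]
  · rw [← Finset.mul_sum, d1, mul_zero]
  · simp only [mul_pow]; rw [← Finset.mul_sum, d3, mul_zero]
  · refine (OO.zero (E := ℝ)).congr fun t => ?_
    rw [conJ_eq_zero (esym_im_eq_zero (e := e) fun j => ?_), mul_zero]
    rw [Complex.ext_iff, Complex.conj_re, Complex.conj_im, polyFam_re, polyFam_re, polyFam_im,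
      polyFam_im, hde, coeffP, coeffP, coeffQ, coeffQ, coeffP, coeffP]
    constructor <;> ring

/-- Take a proportional to (4, -1, -1, -1, -1), the equality case for sum zero. The cube sum no
longer vanishes, so the odd term at u₁ = -1/2 must be cancelled by hand; at u₂ = -1 it carries the
factor Im ω = 0. -/
theorem exists_witness_five : ∃ ζ : ℝ → Fin 5 → ℂ, Witness 5 ζ := by
  have hR : objC 5 (13 / 20 * (2 * (((5 : ℕ) - 1) * lpB 5)) ^ 2) = D 5 + Δ 5 := by
    rw [objC_five, Δ, if_pos rfl]
  set Q : ℝ := 13 / 20 * (2 * (((5 : ℕ) - 1) * lpB 5)) ^ 2 with hQ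
  have hQ' : Q = 52 / 45 := by rw [hQ, lpB_five]; norm_num
  obtain ⟨σ, h₁, h₂⟩ := exists_conFour_eq_zero (n := 5) (by norm_num) Q
  set w : ℝ := √(1 / 15) with hw
  have hw0 : 0 < w := Real.sqrt_pos.2 (by norm_num)
  have hw2 : w ^ 2 = 1 / 15 := Real.sq_sqrt (by norm_num)
  set c := (σ - 150 * w ^ 4) / (20 * w) with hc
  set a : Fin 5 → ℝ := ![4 * w, -w, -w, -w, -w] with ha
  -- The extra 75/2 w³ makes (∑ b_j)/5 cancel -(1/8)∑ a_j³ = -(15/2)w³ in `conJ` at u = -1/2; there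
  -- the coefficient of Im e₃ is 0. The multiple c of (4, -1, -1, -1, -1) adjusts ∑ a_j b_j to σ.
  set b : Fin 5 → ℝ := ![4 * c + 75 / 2 * w ^ 3, -c, -c, -c, -c] with hb
  have h0 : ∑ j, a j = 0 := by simp [ha, Fin.sum_univ_succ]; ring
  have h2 : ∑ j, a j ^ 2 = 2 * (((5 : ℕ) - 1) * lpB 5) := by
    have : ∑ j, a j ^ 2 = 20 * w ^ 2 := by simp [ha, Fin.sum_univ_succ]; ring
    rw [this, hw2, lpB_five]; norm_num
  have h3 : ∑ j, a j ^ 3 = 60 * w ^ 3 := by simp [ha, Fin.sum_univ_succ]; ring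
  have h4 : ∑ j, a j ^ 4 = Q := by
    have : ∑ j, a j ^ 4 = 260 * (w ^ 2) ^ 2 := by simp [ha, Fin.sum_univ_succ]; ring
    rw [this, hw2, hQ']; norm_num
  have hbs : ∑ j, b j = 75 / 2 * w ^ 3 := by simp [hb, Fin.sum_univ_succ]; ring
  have hab : ∑ j, a j * b j = σ := by
    have : ∑ j, a j * b j = 20 * w * c + 150 * w ^ 4 := by
      simp [ha, hb, Fin.sum_univ_succ]; ring
    rw [this, hc]; field_simp; ring
  have hfam : Fam (𝓝[≥] (0 : ℝ)) (fun t => t) (polyFam 5 (objC 5 Q) a b) (lpA 5) (lpB 5) 5 :=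
    fam_polyFam tendsto_id_right h0 h2 (by norm_num) (Or.inl le_rfl)
  refine ⟨_, witness_polyFam (by norm_num) hR h0 h2 h4 (by norm_num) (Or.inl le_rfl)
    (by rw [hab]; exact h₁) (by rw [hab]; exact h₂) fun ω hω hu => ?_⟩
  rcases hu with hu | hu
  · refine OO.const_mul ?_ ω.im
    rw [hu, u₁_five]
    have e2 := hfam.esym_two_im tendsto_id_right le_rfl (by norm_num)
    have e4 := hfam.esym_four_im tendsto_id_right le_rfl (by norm_num)
    have e5 := (hfam.esym_O tendsto_id_right 5).im
    have e3 := OO.of_continuous tendsto_id_right 5 (g := fun t => ∑ j, (3 * a j ^ 2 * b j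
      + 3 * a j * b j ^ 2 * t ^ 2 + b j ^ 3 * t ^ 4)) (by fun_prop)
    refine (((e2.const_mul (1 / 4)).sub (e4.const_mul (1 / 2))).sub
      (e5.add (e3.const_mul (1 / 8)))).congr fun t => ?_
    simp only [sum_im_cube_polyFam]
    rw [conJ, Fam.esym_one_im (ζ := polyFam 5 (objC 5 Q) a b), sum_im_polyFam, h0, hbs, h3]
    push_cast
    ring
  · have him : ω.im = 0 := by
      have := re_sq_add_im_sq hω
      rw [hu, u₂_five] at this
      nlinarith
    rw [him]
    exact OO.zero.congr fun t => zero_mul _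

theorem exists_witness (hn : 3 ≤ n) : ∃ ζ : ℝ → Fin n → ℂ, Witness (order n) ζ := by
  by_cases h5 : n = 5
  · subst h5
    rw [order, if_pos (Or.inr rfl)]
    exact exists_witness_five
  · obtain ⟨ζ, h⟩ := exists_witness_generic hn h5
    have hm := order_le_six n
    have hm5 := five_le_order n
    have f := h.fam
    exact ⟨ζ, ⟨f.im_O, f.re_exp, f.sq, f.im1.mono tendsto_id_right (by omega),
      f.im3.mono tendsto_id_right (by omega)⟩, fun j => (h.slack j).mono tendsto_id_right hm,
      fun ω hω hu => (h.active ω hω hu).mono tendsto_id_right hm⟩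

end Witness

/-! ### The roots of nearly extremal families -/

section Roots

variable {n m : ℕ} {ζ : ℝ → Fin n → ℂ}

theorem eventually_nonneg_right : ∀ᶠ t : ℝ in 𝓝[≥] 0, 0 ≤ t := self_mem_nhdsWithin

theorem Fam.conJ_O {ι : Type*} {l : Filter ι} {s : ι → ℝ} {ζ : ι → Fin n → ℂ} {A B : ℝ}
    (h : Fam l s ζ A B m) (hs : Tendsto s l (𝓝 0)) (hm : 5 ≤ m) (hn : (n : ℝ) ≠ 0) (u : ℝ) :
    OO l s 3 fun i => conJ (ζ i) u := by
  have e1 := h.psum_one_im hs hm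
  have e2 := h.esym_two_im' hs hm hn
  have e3 := h.esym_three_im' hs hm hn
  have e4 := ((h.esym_O hs 4).im).mono hs (by norm_num : 3 ≤ 4)
  have e5 := ((h.esym_O hs 5).im).mono hs (by norm_num : 3 ≤ 5)
  exact (((((e1.div_const n).sub ((e2.const_mul (2 * u)).div_const (n - 1))).add
    ((e3.const_mul (4 * u ^ 2 - 1)).div_const (n - 2))).sub
    ((e4.const_mul (8 * u ^ 3 - 4 * u)).div_const (n - 3))).add
    ((e5.const_mul (16 * u ^ 4 - 12 * u ^ 2 + 1)).div_const (n - 4)))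

/-- At inactive roots of unity the strict first order slack -c t² dominates all errors, which are
O(t³). -/
theorem Witness.con_ub (h : Witness m ζ) (hn : 3 ≤ n) (hm : 5 ≤ m) {ω : ℂ}
    (hω : ω ^ (n + 1) = 1) : UB (𝓝[≥] (0 : ℝ)) (fun t => t) m fun t =>
      conSecond n t (∑ j, (ζ t j).im ^ 4) (ζ t) ω.re + ω.im * conJ (ζ t) ω.re := by
  have hn0 : (n : ℝ) ≠ 0 := by positivity
  have hn1 : (n : ℝ) - 1 ≠ 0 := by
    have : (3 : ℝ) ≤ n := by exact_mod_cast hn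
    linarith
  have hs := tendsto_id_right
  rcases root_of_unity_cases hn hω with hu | hu | hu
  · exact (h.active ω hω (Or.inl hu)).ub eventually_nonneg_right
  · exact (h.active ω hω (Or.inr hu)).ub eventually_nonneg_right
  set c := (ω.re - u₁ n) * (ω.re - u₂ n) / ((1 - u₁ n) * (1 - u₂ n)) with hc
  have hc0 : 0 < c := div_pos hu (mul_pos (by linarith [u₁_lt_one hn]) (by linarith [u₂_lt_one hn]))
  rw [← lp_slack hn] at hc
  have e1 := ((h.fam.psum_one_re hs hn0).mono hs (by norm_num : 3 ≤ 4)).const_mul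
    (-(1 - ω.re) / n)
  have e2 := ((h.fam.esym_two_re hs hm hn0).mono hs (by norm_num : 3 ≤ 4)).const_mul
    (2 * (1 - ω.re ^ 2) / (n - 1))
  have e3 := ((h.fam.sum_four_O hs).mono hs (by norm_num : 3 ≤ 4)).const_mul (conQ n ω.re)
  have e4 := (OO.self' hs (conS n (lpA n) (lpB n) ω.re) (by norm_num : 3 ≤ 4))
  have e5 := (h.fam.conJ_O hs hm hn0 ω.re).const_mul ω.im
  have e : OO (𝓝[≥] (0 : ℝ)) (fun t => t) 3 fun t => conSecond n t (∑ j, (ζ t j).im ^ 4) (ζ t) ω.re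
      + ω.im * conJ (ζ t) ω.re + c * t ^ 2 := by
    refine ((((e1.add e2).add e3).add e4).add e5).congr fun t => ?_
    rw [conSecond, hc]
    field_simp
    ring
  obtain ⟨C, hC, hb⟩ := e.bound eventually_nonneg_right
  refine UB.of_le ?_
  have hsm : ∀ᶠ t : ℝ in 𝓝[≥] 0, C * t < c := by
    have : Tendsto (fun t : ℝ => C * t) (𝓝[≥] 0) (𝓝 0) := by simpa using hs.const_mul C
    exact this.eventually_lt_const hc0
  filter_upwards [hb, hsm] with t h1 h2
  have h3 := (le_abs_self _).trans h1
  have h4 := mul_le_mul_of_nonneg_right h2.le (sq_nonneg t)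
  nlinarith

theorem norm_le_of_normSq_pow_le {z : ℂ} {N : ℕ} (hN : N ≠ 0) {e : ℝ} (he : 0 ≤ e)
    (h : Complex.normSq (z ^ N) ≤ 1 + e) : ‖z‖ ≤ 1 + e := by
  rcases le_or_gt ‖z‖ 1 with h1 | h1
  · linarith
  · rw [← Complex.sq_norm, norm_pow, ← pow_mul] at h
    exact (le_self_pow₀ h1.le (by omega)).trans h

open Polynomial in
theorem roots_eq_of_card {P : ℂ[X]} {N : ℕ} (hP : P ≠ 0) (hd : P.natDegree = N)
    {S : Finset ℂ} (hS : S.card = N) {z : ℂ → ℂ} (hz : ∀ ω ∈ S, P.eval (z ω) = 0)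
    (hinj : ∀ ω ∈ S, ∀ ω' ∈ S, ω ≠ ω' → z ω ≠ z ω') {w : ℂ} (hw : P.eval w = 0) :
    ∃ ω ∈ S, z ω = w := by
  classical
  have h1 : S.image z ⊆ P.roots.toFinset := by
    intro x hx
    obtain ⟨ω, hω, rfl⟩ := Finset.mem_image.1 hx
    rw [Multiset.mem_toFinset, mem_roots hP]
    exact hz ω hω
  have h2 : (S.image z).card = N := by
    rw [Finset.card_image_of_injOn, hS]
    intro a ha b hb hab
    by_contra hne
    exact hinj a ha b hb hne hab
  have h3 : P.roots.toFinset.card ≤ N :=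
    (Multiset.toFinset_card_le _).trans ((card_roots' P).trans hd.le)
  have h4 := Finset.eq_of_subset_of_card_le h1 (by omega)
  have h5 : w ∈ P.roots.toFinset := by
    rw [Multiset.mem_toFinset, mem_roots hP]; exact hw
  rw [← h4, Finset.mem_image] at h5
  exact h5

-- The roots found near the n + 1 distinct roots of unity are eventually distinct, so they are all
-- the roots. Hence the bounds near each ω control every root.
open Polynomial in
theorem Witness.exists_polynomials (h : Witness m ζ) (hn : 3 ≤ n) (hm5 : 5 ≤ m) (hm6 : m ≤ 6) :
    ∃ (P : ℝ → ℂ[X]) (K : ℝ), 0 ≤ K ∧ ∀ᶠ t : ℝ in 𝓝[≥] 0, (P t).natDegree = n + 1 ∧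
      (P t).eval (1 - (t : ℂ) ^ 2) = 0 ∧
      (P t).derivative = C ((n : ℂ) + 1) * ∏ j, (X - C (ζ t j)) ∧
      (∀ w, (P t).eval w = 0 → ‖w‖ ≤ 1 + K * t ^ m) ∧
      ∀ j, expansion n t - K * t ^ m ≤ ‖1 - (t : ℂ) ^ 2 - ζ t j‖ := by
  have hs := tendsto_id_right
  have hs0 := eventually_nonneg_right
  have h1 := h.fam.O_one hs
  choose P hPm hPd hPβ hPD using fun t : ℝ => exists_polynomial (ζ t) (1 - (t : ℂ) ^ 2)
  have hroot : ∀ ω : ℂ, ∃ (z : ℝ → ℂ) (K : ℝ), ω ^ (n + 1) = 1 → Tendsto z (𝓝[≥] 0) (𝓝 ω) ∧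
      (∀ t, (P t).eval (z t) = 0) ∧ ∀ᶠ t : ℝ in 𝓝[≥] 0, ‖z t‖ ≤ 1 + |K| * t ^ m := by
    intro ω
    by_cases hω : ω ^ (n + 1) = 1
    swap
    · exact ⟨fun _ => 0, 0, fun h => absurd h hω⟩
    obtain ⟨z, hz, he, h0⟩ := exists_root_tendsto hs h1 hPD hPm hPd hPβ hω
    have e1 := con_expansion h.fam hs hm5 hm6 hn hω (re_sq_add_im_sq hω) hz he
    have e2 : UB (𝓝[≥] (0 : ℝ)) (fun t => t) m fun t => Complex.normSq (z t ^ (n + 1)) - 1 :=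
      (((h.con_ub hn hm5 hω).add (e1.ub hs0)).const_mul (c := 2 * ((n : ℝ) + 1))
        (by positivity)).congr fun t => by
          rw [conSecond]
          have hn1 : (n : ℝ) + 1 ≠ 0 := by positivity
          field_simp
          ring
    obtain ⟨K, hK⟩ := e2
    refine ⟨z, K, fun _ => ⟨hz, h0, ?_⟩⟩
    filter_upwards [hK, hs0] with t a1 a2
    have a3 := mul_le_mul_of_nonneg_right (le_abs_self K) (pow_nonneg a2 m)
    exact norm_le_of_normSq_pow_le (N := n + 1) (by omega) (by positivity) (by linarith)
  choose z K hzK using hroot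
  set S := nthRootsFinset (n + 1) (1 : ℂ) with hS
  have hSmem : ∀ ω, ω ∈ S ↔ ω ^ (n + 1) = 1 := fun ω => mem_nthRootsFinset (by omega) 1
  have hScard : S.card = n + 1 := (Complex.isPrimitiveRoot_exp (n + 1) (by omega)).card_nthRootsFinset
  have hne : ∀ᶠ t in 𝓝[≥] (0 : ℝ), ∀ ω ∈ S, ∀ ω' ∈ S, ω ≠ ω' → z ω t ≠ z ω' t := by
    rw [Finset.eventually_all]
    intro ω hω
    rw [Finset.eventually_all]
    intro ω' hω'
    by_cases hne : ω = ω'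
    · exact Eventually.of_forall fun t h => absurd hne h
    · have hd := ((hzK ω ((hSmem ω).1 hω)).1).sub ((hzK ω' ((hSmem ω').1 hω')).1)
      filter_upwards [hd.eventually_ne (sub_ne_zero.2 hne)] with t ht _
      exact sub_ne_zero.1 ht
  have hbd : ∀ᶠ t in 𝓝[≥] (0 : ℝ), ∀ ω ∈ S, ‖z ω t‖ ≤ 1 + |K ω| * t ^ m := by
    rw [Finset.eventually_all]
    exact fun ω hω => (hzK ω ((hSmem ω).1 hω)).2.2
  have hdist : ∀ j, UB (𝓝[≥] (0 : ℝ)) (fun t => t) m fun t =>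
      expansion n t - ‖1 - (t : ℂ) ^ 2 - ζ t j‖ := by
    intro j
    refine UB.of_sq hs0 ?_ (((h.slack j).const_mul (-1 / 2)).ub hs0 |>.congr fun t => ?_)
    · have t1 : Tendsto (fun t : ℝ => (t : ℂ)) (𝓝[≥] 0) (𝓝 0) := by
        have := (Complex.continuous_ofReal.tendsto 0).comp hs
        rwa [Complex.ofReal_zero] at this
      have t2 := (((t1.pow 2).const_sub 1).sub ((h1 j).tendsto hs le_rfl)).norm
      simpa using t2
    · rw [norm_sq_eq_slack t (expansion n t)]; ring
  choose K' hK' using hdist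
  refine ⟨P, ∑ ω ∈ S, |K ω| + ∑ j, |K' j|, by positivity, ?_⟩
  have hK'' : ∀ᶠ t in 𝓝[≥] (0 : ℝ), ∀ j, expansion n t - ‖1 - (t : ℂ) ^ 2 - ζ t j‖ ≤ K' j * t ^ m :=
    eventually_all.2 hK'
  filter_upwards [hne, hbd, hK'', hs0] with t a1 a2 a3 a4
  have hp := pow_nonneg a4 m
  refine ⟨hPd t, hPβ t, hPD t, fun w hw => ?_, fun j => ?_⟩
  · obtain ⟨ω, hω, rfl⟩ := roots_eq_of_card (hPm t).ne_zero (hPd t) hScard (z := fun ω => z ω t)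
      (fun ω hω => (hzK ω ((hSmem ω).1 hω)).2.1 t) a1 hw
    refine (a2 ω hω).trans ?_
    have := Finset.single_le_sum (f := fun ω => |K ω|) (fun ω _ => abs_nonneg _) hω
    have h5 : 0 ≤ ∑ j, |K' j| := by positivity
    gcongr
    linarith
  · have := Finset.single_le_sum (f := fun j => |K' j|) (fun j _ => abs_nonneg _) (Finset.mem_univ j)
    have h5 : 0 ≤ ∑ ω ∈ S, |K ω| := by positivity
    have h6 : K' j * t ^ m ≤ (∑ ω ∈ S, |K ω| + ∑ j, |K' j|) * t ^ m :=
      mul_le_mul_of_nonneg_right (by linarith [le_abs_self (K' j)]) hp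
    linarith [a3 j]

end Roots

/-! ### The lower bound -/

section LowerBound

variable {n m : ℕ}

open Polynomial in
theorem exists_scaled_polynomial {P : ℂ[X]} {ζ : Fin n → ℂ} (hn : n ≠ 0) {b lam d : ℝ}
    (hlam : 0 < lam) (hd : P.natDegree = n + 1) (hβ : P.eval ((lam * b : ℝ) : ℂ) = 0)
    (hP : P.derivative = C ((n : ℂ) + 1) * ∏ j, (X - C (ζ j)))
    (hr : ∀ w, P.eval w = 0 → ‖w‖ ≤ lam) (hζ : ∀ j, d ≤ ‖((lam * b : ℝ) : ℂ) - ζ j‖) :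
    ∃ Q ∈ polys (n + 1) (b : ℂ), d / lam ≤ critDist Q b := by
  have hl : (lam : ℂ) ≠ 0 := Complex.ofReal_ne_zero.2 hlam.ne'
  have hev : ∀ w, (P.comp (C (lam : ℂ) * X)).eval w = P.eval (lam * w) := fun w => by
    rw [eval_comp, eval_mul, eval_C, eval_X]
  refine ⟨P.comp (C (lam : ℂ) * X), ⟨?_, ?_, fun z hz => ?_⟩, ?_⟩
  · rw [natDegree_comp, natDegree_C_mul_X _ hl, mul_one, hd]
  · rw [IsRoot, hev, ← Complex.ofReal_mul, hβ]
  · rw [IsRoot, hev] at hz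
    have := hr _ hz
    rw [norm_mul, Complex.norm_real, Real.norm_of_nonneg hlam.le] at this
    exact le_of_mul_le_mul_left (by linarith) hlam
  · have hder : ∀ w, (P.comp (C (lam : ℂ) * X)).derivative.eval w =
        lam * (((n : ℂ) + 1) * ∏ j, (lam * w - ζ j)) := fun w => by
      rw [derivative_comp, hP, eval_mul, eval_comp, derivative_C_mul, derivative_X, mul_one, eval_C,
        eval_mul, eval_C, eval_prod]
      simp
    have hn1 : (n : ℂ) + 1 ≠ 0 := by exact_mod_cast n.succ_ne_zero
    rw [critDist, Metric.le_infDist]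
    · intro z hz
      rw [Set.mem_ofPred_eq, IsRoot, hder] at hz
      obtain ⟨j, -, hj⟩ := Finset.prod_eq_zero_iff.1
        ((mul_eq_zero.1 ((mul_eq_zero.1 hz).resolve_left hl)).resolve_left hn1)
      have h1 := hζ j
      rw [← sub_eq_zero.1 hj, Complex.ofReal_mul, ← mul_sub, norm_mul, Complex.norm_real,
        Real.norm_of_nonneg hlam.le] at h1
      rw [dist_eq_norm, div_le_iff₀ hlam, mul_comm]
      exact h1
    · refine ⟨ζ ⟨0, Nat.pos_of_ne_zero hn⟩ / lam, ?_⟩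
      rw [Set.mem_ofPred_eq, IsRoot, hder, Finset.prod_eq_zero (Finset.mem_univ ⟨0, _⟩)]
      · simp
      · rw [mul_div_cancel₀ _ hl, sub_self]

theorem UB.exists_pos {f : ℝ → ℝ} (h : UB (𝓝[≥] (0 : ℝ)) (fun t => t) m f) :
    ∃ C : ℝ, 0 ≤ C ∧ ∀ᶠ t : ℝ in 𝓝[≥] 0, f t ≤ C * t ^ m := by
  obtain ⟨C, hC⟩ := h
  refine ⟨|C|, abs_nonneg _, ?_⟩
  filter_upwards [hC, eventually_nonneg_right] with t h1 h2
  exact h1.trans (mul_le_mul_of_nonneg_right (le_abs_self C) (pow_nonneg h2 m))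

/-- The witness at parameter u is divided by lam(t) = 1 + K t^m, with u defined by 1 - u² = lam(t)(1
- t²), so that the distinguished root becomes exactly 1 - t². Since u ≤ t, all its roots land in the
unit disk. Since u² - t² = O(t^m), neither the change of parameter nor the scaling affects the
expansion beyond the error. -/
theorem expansion_le_critDist (hn : 3 ≤ n) : ∃ C : ℝ, ∀ᶠ t : ℝ in 𝓝[≥] 0,
    ∃ P ∈ polys (n + 1) ((1 - t ^ 2 : ℝ) : ℂ),
      expansion n t - C * t ^ order n ≤ critDist P ((1 - t ^ 2 : ℝ) : ℂ) := by
  have hs := tendsto_id_right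
  have hs0 := eventually_nonneg_right
  have hm := five_le_order n
  set m := order n with hmd
  obtain ⟨ζ, hW⟩ := exists_witness hn
  obtain ⟨P, K, hK, hP⟩ := hW.exists_polynomials hn hm (order_le_six n)
  have hlamO : OO (𝓝[≥] (0 : ℝ)) (fun t => t) m fun t => K * t ^ m := OO.self' hs K le_rfl
  have hlam1 : Tendsto (fun t : ℝ => K * t ^ m) (𝓝[≥] 0) (𝓝 0) := hlamO.tendsto hs (by omega)
  set lam : ℝ → ℝ := fun t => 1 + K * t ^ m with hlam
  set v : ℝ → ℝ := fun t => 1 - lam t * (1 - t ^ 2) with hv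
  set u : ℝ → ℝ := fun t => √(v t) with hu
  have hvle : ∀ t : ℝ, 0 ≤ t → t ≤ 1 → v t ≤ t ^ 2 := fun t h0 h1 => by
    have h2 : 0 ≤ K * t ^ m * (1 - t ^ 2) :=
      mul_nonneg (by positivity) (by nlinarith)
    rw [hv, hlam]; linarith
  have hle1 : ∀ᶠ t : ℝ in 𝓝[≥] 0, t ≤ 1 := (hs.eventually_lt_const one_pos).mono fun t h => h.le
  have hv0 : ∀ᶠ t : ℝ in 𝓝[≥] 0, 0 ≤ v t := by
    have : Tendsto (fun t : ℝ => K * t) (𝓝[≥] 0) (𝓝 0) := by simpa using hs.const_mul K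
    filter_upwards [hs0, hle1, this.eventually_lt_const one_pos] with t h0 h1 h2
    have h3 : t ^ m ≤ t ^ 3 := pow_le_pow_of_le_one h0 h1 (by omega)
    have h4 : K * t ^ m ≤ K * t ^ 3 := mul_le_mul_of_nonneg_left h3 hK
    have h5 : K * t * t ^ 2 ≤ 1 * t ^ 2 := mul_le_mul_of_nonneg_right h2.le (sq_nonneg t)
    have h6 : 0 ≤ K * t ^ m * t ^ 2 := by positivity
    rw [hv, hlam]
    linarith
  have hut : ∀ᶠ t : ℝ in 𝓝[≥] 0, u t ≤ t := by
    filter_upwards [hs0, hle1] with t h0 h1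
    rw [hu, Real.sqrt_le_left h0]
    exact hvle t h0 h1
  have hu0 : ∀ t, 0 ≤ u t := fun t => Real.sqrt_nonneg _
  have huT : Tendsto u (𝓝[≥] 0) (𝓝[≥] 0) :=
    tendsto_nhdsWithin_iff.2 ⟨tendsto_of_tendsto_of_tendsto_of_le_of_le' tendsto_const_nhds hs
      (Eventually.of_forall hu0) hut, Eventually.of_forall hu0⟩
  have hu2 : ∀ᶠ t : ℝ in 𝓝[≥] 0, u t ^ 2 = v t := hv0.mono fun t h => Real.sq_sqrt h
  have hone : OO (𝓝[≥] (0 : ℝ)) (fun t => t) 0 fun t => 1 - t ^ 2 :=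
    OO.of_tendsto (c := 1) (by simpa using (hs.pow 2).const_sub 1)
  have hdiff : OO (𝓝[≥] (0 : ℝ)) (fun t => t) m fun t => u t ^ 2 - t ^ 2 := by
    refine (hlamO.neg.mul' hone hs le_rfl).congr' (hu2.mono fun t h => ?_)
    rw [h, hv, hlam]; ring
  have hu2T : Tendsto (fun t => u t ^ 2) (𝓝[≥] 0) (𝓝 0) := by
    simpa using (huT.mono_right nhdsWithin_le_nhds).pow 2
  have hsum : OO (𝓝[≥] (0 : ℝ)) (fun t => t) 0 fun t => u t ^ 2 + t ^ 2 :=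
    OO.of_tendsto (c := 0 + 0 ^ 2) (hu2T.add (hs.pow 2))
  have hexp : OO (𝓝[≥] (0 : ℝ)) (fun t => t) m fun t => expansion n t - expansion n (u t) := by
    refine ((hdiff.const_mul (-(D₁ n + D₂ n / n))).add ((hdiff.mul' hsum hs le_rfl).const_mul
      (-(D n + Δ n)))).congr fun t => ?_
    rw [expansion, expansion]; ring
  have hexp0 : OO (𝓝[≥] (0 : ℝ)) (fun t => t) 0 fun t => expansion n (u t) := by
    refine OO.of_tendsto (c := 1 + (D₁ n + D₂ n / n) * 0 + (D n + Δ n) * 0 ^ 2)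
      (((hu2T.const_mul _).const_add 1).add ((hu2T.pow 2).const_mul _) |>.congr fun t => ?_)
    rw [expansion]; ring
  have hinv : OO (𝓝[≥] (0 : ℝ)) (fun t => t) 0 fun t => (lam t)⁻¹ :=
    OO.of_tendsto (c := (1 + 0)⁻¹) ((hlam1.const_add 1).inv₀ (by norm_num))
  have hpos : ∀ t : ℝ, 0 ≤ t → 1 ≤ lam t := fun t ht => by
    have := mul_nonneg hK (pow_nonneg ht m)
    rw [hlam]; linarith
  have hKu : UB (𝓝[≥] (0 : ℝ)) (fun t => t) m fun t => K * u t ^ m / lam t := by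
    refine ⟨K, ?_⟩
    filter_upwards [hs0, hut] with t h0 h1
    have h2 : K * u t ^ m ≤ K * t ^ m :=
      mul_le_mul_of_nonneg_left (pow_le_pow_left₀ (hu0 t) h1 m) hK
    exact (div_le_self (mul_nonneg hK (pow_nonneg (hu0 t) m)) (hpos t h0)).trans h2
  have htot : UB (𝓝[≥] (0 : ℝ)) (fun t => t) m fun t =>
      expansion n t - (expansion n (u t) - K * u t ^ m) / lam t := by
    refine ((hexp.add ((hexp0.mul' (hlamO.mul' hinv hs le_rfl) hs
      (by omega : m ≤ 0 + m)))).ub hs0).add hKu |>.mono ?_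
    filter_upwards [hs0] with t h0
    have hne : lam t ≠ 0 := by linarith [hpos t h0]
    have e : K * t ^ m = lam t - 1 := by rw [hlam]; ring
    rw [e]
    refine le_of_eq ?_
    field_simp
    ring
  obtain ⟨C, -, hC⟩ := htot.exists_pos
  refine ⟨C, ?_⟩
  filter_upwards [hC, huT.eventually hP, hs0, hut, hu2] with t h1 ⟨p1, p2, p3, p4, p5⟩ h3 h4 h5
  have hb : (((lam t) * (1 - t ^ 2) : ℝ) : ℂ) = 1 - (u t : ℂ) ^ 2 := by
    rw [← Complex.ofReal_pow, h5, hv]; push_cast; ring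
  obtain ⟨Q, hQ, hQd⟩ := exists_scaled_polynomial (n := n) (ζ := ζ (u t)) (b := 1 - t ^ 2)
    (lam := lam t) (d := expansion n (u t) - K * u t ^ m) (by omega) (by linarith [hpos t h3]) p1
    (by rw [hb]; exact p2) p3 (fun w hw => (p4 w hw).trans (by
      have := mul_le_mul_of_nonneg_left (pow_le_pow_left₀ (hu0 t) h4 m) hK
      rw [hlam]; linarith)) (fun j => by rw [hb]; exact p5 j)
  exact ⟨Q, hQ, by linarith⟩

theorem radius_sub_expansion (hn : 3 ≤ n) : OO (𝓝[≥] (0 : ℝ)) (fun t => t) (order n) fun t =>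
    radius (n + 1) ((1 - t ^ 2 : ℝ) : ℂ) - expansion n t := by
  obtain ⟨C, δ, hδ, hU⟩ := critDist_le_expansion hn
  obtain ⟨C', hL⟩ := expansion_le_critDist hn
  have hlt := tendsto_id_right.eventually_lt_const hδ
  refine UB.antisymm eventually_nonneg_right ⟨C, ?_⟩ ⟨C', ?_⟩
  · filter_upwards [hL, hlt, eventually_nonneg_right] with t ⟨P, hP, _⟩ h1 h0
    have : radius (n + 1) ((1 - t ^ 2 : ℝ) : ℂ) ≤ expansion n t + C * t ^ order n := by
      refine csSup_le ⟨_, Set.mem_image_of_mem _ hP⟩ ?_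
      rintro _ ⟨Q, hQ, rfl⟩
      exact hU t h0 h1 Q hQ
    linarith
  · filter_upwards [hL, hlt, eventually_nonneg_right] with t ⟨P, hP, hd⟩ h1 h0
    have : critDist P ((1 - t ^ 2 : ℝ) : ℂ) ≤ radius (n + 1) ((1 - t ^ 2 : ℝ) : ℂ) := by
      refine le_csSup ⟨expansion n t + C * t ^ order n, ?_⟩ (Set.mem_image_of_mem _ hP)
      rintro _ ⟨Q, hQ, rfl⟩
      exact hU t h0 h1 Q hQ
    linarith

theorem sqrt_pow_order (n : ℕ) {x : ℝ} (hx : 0 ≤ x) : √x ^ order n = x ^ (α n + 1) := by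
  rw [Real.sqrt_eq_rpow, ← Real.rpow_natCast, ← Real.rpow_mul hx, order, α]
  split_ifs <;> norm_num

end LowerBound

end Sendov

theorem theorem1 (n : ℕ) (hn : 3 ≤ n) :
    (fun β : ℝ => Sendov.radius (n + 1) (β : ℂ) -
        (1 + (Sendov.D₁ n + Sendov.D₂ n / (n : ℝ)) * (1 - β) +
          (Sendov.D n + Sendov.Δ n) * (1 - β) ^ 2))
      =O[𝓝[≤] (1 : ℝ)] (fun β : ℝ => (1 - β) ^ (Sendov.α n + 1)) := by
  have hT : Tendsto (fun β : ℝ => √(1 - β)) (𝓝[≤] 1) (𝓝[≥] 0) := by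
    refine tendsto_nhdsWithin_iff.2 ⟨?_, Eventually.of_forall fun β => Real.sqrt_nonneg _⟩
    have h : ContinuousAt (fun β : ℝ => √(1 - β)) 1 := by fun_prop
    have h' := h.tendsto
    rw [sub_self, Real.sqrt_zero] at h'
    exact h'.mono_left nhdsWithin_le_nhds
  have h := Asymptotics.IsBigO.comp_tendsto (Sendov.radius_sub_expansion hn) hT
  have hle : ∀ᶠ β : ℝ in 𝓝[≤] 1, β ≤ 1 := self_mem_nhdsWithin
  refine Asymptotics.IsBigO.congr' h ?_ ?_
  · filter_upwards [hle] with β hβ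
    have h2 : √(1 - β) ^ 2 = 1 - β := Real.sq_sqrt (by linarith)
    have h4 : √(1 - β) ^ 4 = (1 - β) ^ 2 := by
      rw [show (4 : ℕ) = 2 * 2 from rfl, pow_mul, h2]
    rw [Function.comp_apply, Sendov.expansion, h4, h2, sub_sub_cancel]
  · filter_upwards [hle] with β hβ
    exact Sendov.sqrt_pow_order n (by linarith)
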